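/- Let $G$ be a compact Lie group with Lie algebra $\mathfrak g$. All manifolds are smooth, Hausdorff and second countable. A taming map on a $G$-manifold $N$ is a smooth $G$-equivariant map $v\colon N\to\mathfrak g$; its localizing set is $Z=\{x\in N : v^\sharp|_x=0\}$, where $v^\sharp|_x$ is the value at $x$ of the vector field on $N$ generated by $v(x)\in\mathfrak g$. A map $\Phi\colon N\to\mathfrak g^*$ is $v$-polarized if $\langle\Phi,v\rangle\colon N\to\mathbb R$ is proper and bounded from below. A Hamiltonian $G$-manifold $(N,\omega,\Phi)$ is an oriented $G$-manifold, possibly with boundary, with a $G$-invariant closed (possibly degenerate) $2$-form $\omega$ and a $G$-equivariant map $\Phi\colon N\to\mathfrak g^*$ such that $d\langle\Phi,X\rangle=\iota(X^\sharp)\omega$ for all $X\in\mathfrak g$; it is proper if $\Phi$ is proper. If $Y\subseteq N$ is closed and $G$-invariant and $\Phi|_Y$ is $v|_Y$-polarized, a $v$-polarized completion of $(N,\omega,\Phi)$ relative to $Y$ is a Hamiltonian $G$-manifold $(N,\tilde\omega,\tilde\Phi)$ on the same oriented $G$-manifold such that $\tilde\Phi$ is $v$-polarized and $\tilde\omega+\tilde\Phi$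 agrees with $\omega+\Phi$ on $Y$, i.e. both have the same pullback under every smooth map $p\colon D\to N$ with image in $Y$, for $D$ open in some $\mathbb R^k$, $k\ge 1$. A proper Hamiltonian cobordism between $(M_0,\omega_0,\Phi_0,A_0)$ and $(M_1,\omega_1,\Phi_1,A_1)$, where the $(M_j,\omega_j,\Phi_j)$ are Hamiltonian $G$-manifolds without boundary and $A_j\in H_G^*(M_j;\mathbb R)$ (Cartan model), is a proper Hamiltonian $G$-manifold with boundary $(W,\tilde\omega,\tilde\Phi)$ with a class $\tilde A\in H_G^*(W;\mathbb R)$ and a $G$-equivariant orientation preserving diffeomorphism $i\colon -M_0\sqcup M_1\to\partial W$ with $i^*\tilde\omega=\omega_0\sqcup\omega_1$, $i^*\tilde\Phi=\Phi_0\sqcup\Phi_1$ and $i^*\tilde A=A_0\sqcup A_1$. **Proposition.** Let $(M,\omega,\Phi)$ be an even-dimensional Hamiltonian $G$-manifold without boundary, $v\colon M\to\mathfrak g$ a bounded taming map, $Z=\{v^\sharp=0\}$ its localizing set, and $U_Z$ a $G$-invariant open neighbourhood of $Z$ in $M$. Suppose that $\Phi$ is $v$-polarized on $M$, and let $A\in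 H_G^*(M;\mathbb R)$. Then there exist a $v|_{U_Z}$-polarized completion $(U_Z,\omega_Z,\Phi_Z)$ of $(U_Z,\omega|_{U_Z},\Phi|_{U_Z})$ relative to $Z$ and a proper Hamiltonian cobordism between $(M,\omega,\Phi,A)$ and $(U_Z,\omega_Z,\Phi_Z,A|_{U_Z})$. -/

import Mathlib

open Set Filter Topology
open scoped Manifold ContDiff

set_option linter.unusedSectionVars false

noncomputable section

section Forms

variable {E : Type*} [NormedAddCommGroup E] [NormedSpace ℝ E]
  {E' : Type*} [NormedAddCommGroup E'] [NormedSpace ℝ E']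
  {E'' : Type*} [NormedAddCommGroup E''] [NormedSpace ℝ E'']
  {H : Type*} [TopologicalSpace H] {H' : Type*} [TopologicalSpace H']
  {H'' : Type*} [TopologicalSpace H'']

/-- The differential `T_x N → T_{f x} N'` of a map `f : N → N'`. In Mathlib the tangent space
`TangentSpace I x` is by definition the model vector space `E` (read in the preferred chart at
`x`), and the differential is written here as a linear map between model spaces. -/
def tangentMapAt (I : ModelWithCorners ℝ E H) (I' : ModelWithCorners ℝ E' H')
    {N : Type*} [TopologicalSpace N] [ChartedSpace H N]
    {N' : Type*} [TopologicalSpace N'] [ChartedSpace H' N']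
    (f : N → N') (x : N) : E →L[ℝ] E' :=
  mfderiv I I' f x

/-- A (not necessarily smooth) differential `k`-form on `N`: an alternating `k`-form on
`T_x N = E` for every point `x`. -/
abbrev RawForm (E : Type*) [NormedAddCommGroup E] [NormedSpace ℝ E] (N : Type*) (k : ℕ) :=
  N → E [⋀^Fin k]→L[ℝ] ℝ

/-- The differential at the coordinate vector `z` of the inverse of the preferred chart at `x₀`. -/
def chartSymmMapAt (I : ModelWithCorners ℝ E H) {N : Type*} [TopologicalSpace N]
    [ChartedSpace H N] (x₀ : N) (z : E) : E →L[ℝ] E :=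
  mfderivWithin 𝓘(ℝ, E) I (extChartAt I x₀).symm (range I) z

/-- The coordinate expression of a form in the preferred chart at `x₀`: its pullback under the
inverse of that chart. -/
def chartRep (I : ModelWithCorners ℝ E H) {N : Type*} [TopologicalSpace N] [ChartedSpace H N]
    {k : ℕ} (α : RawForm E N k) (x₀ : N) (z : E) : E [⋀^Fin k]→L[ℝ] ℝ :=
  (α ((extChartAt I x₀).symm z)).compContinuousLinearMap
    (chartSymmMapAt I x₀ z)

/-- Smooth differential `k`-forms: those with smooth coordinate expressions. -/
def smoothForms (I : ModelWithCorners ℝ E H) (N : Type*) [TopologicalSpace N] [ChartedSpace H N]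
    (k : ℕ) : Submodule ℝ (RawForm E N k) where
  carrier := {α | ∀ x₀ : N, ContDiffOn ℝ ∞ (chartRep I α x₀) (extChartAt I x₀).target}
  add_mem' ha hb x₀ := (ha x₀).add (hb x₀)
  zero_mem' _ := contDiffOn_const (c := 0)
  smul_mem' c _ ha x₀ := (ha x₀).const_smul c

/-- The exterior derivative, computed at `x` in the preferred chart at `x`. -/
def extD (I : ModelWithCorners ℝ E H) {N : Type*} [TopologicalSpace N] [ChartedSpace H N]
    {k : ℕ} (α : RawForm E N k) : RawForm E N (k + 1) := fun x =>
  (extDerivWithin (chartRep I α x) (range I) (extChartAt I x x)).compContinuousLinearMap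
    (tangentMapAt I 𝓘(ℝ, E) (extChartAt I x) x)

/-- The pullback `f^* α` of a form. -/
def pullbackForm (I : ModelWithCorners ℝ E H) (I' : ModelWithCorners ℝ E' H')
    {N : Type*} [TopologicalSpace N] [ChartedSpace H N]
    {N' : Type*} [TopologicalSpace N'] [ChartedSpace H' N']
    (f : N → N') {k : ℕ} (α : RawForm E' N' k) : RawForm E N k := fun x =>
  (α (f x)).compContinuousLinearMap (tangentMapAt I I' f x)

variable {I : ModelWithCorners ℝ E H} {I' : ModelWithCorners ℝ E' H'}
  {I'' : ModelWithCorners ℝ E'' H''}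
  {N : Type*} [TopologicalSpace N] [ChartedSpace H N]
  {N' : Type*} [TopologicalSpace N'] [ChartedSpace H' N']
  {N'' : Type*} [TopologicalSpace N''] [ChartedSpace H'' N'']

theorem tangentMapAt_comp {f : N → N'} {g : N' → N''} (hg : ContMDiff I' I'' ∞ g)
    (hf : ContMDiff I I' ∞ f) (x : N) :
    tangentMapAt I I'' (fun y => g (f y)) x =
      (tangentMapAt I' I'' g (f x)).comp (tangentMapAt I I' f x) :=
  mfderiv_comp x (hg.mdifferentiable (by simp) _) (hf.mdifferentiable (by simp) _)

theorem tangentMapAt_extChartAt_self [IsManifold I ∞ N] (x : N) :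
    tangentMapAt I 𝓘(ℝ, E) (extChartAt I x) x = ContinuousLinearMap.id ℝ E :=
  mfderiv_extChartAt_self

theorem extD_eq [IsManifold I ∞ N] {k : ℕ} (α : RawForm E N k) (x : N) :
    extD I α x = extDerivWithin (chartRep I α x) (range I) (extChartAt I x x) := by
  rw [extD, tangentMapAt_extChartAt_self]
  rfl

/-- The coordinate expression of a map in preferred charts. -/
def coordMap (I : ModelWithCorners ℝ E H) (I' : ModelWithCorners ℝ E' H') (f : N → N')
    (x₀ : N) (y₀ : N') : E → E' :=
  fun z => extChartAt I' y₀ (f ((extChartAt I x₀).symm z))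

theorem contDiffWithinAt_coordMap [IsManifold I ∞ N] [IsManifold I' ∞ N'] {f : N → N'}
    (hf : ContMDiff I I' ∞ f) {x₀ : N} {y₀ : N'} {z : E} (hz : z ∈ (extChartAt I x₀).target)
    (hfz : f ((extChartAt I x₀).symm z) ∈ (extChartAt I' y₀).source) :
    ContDiffWithinAt ℝ ∞ (coordMap I I' f x₀ y₀) (range I) z := by
  rw [← contMDiffWithinAt_iff_contDiffWithinAt]
  have h1 : ContMDiffWithinAt 𝓘(ℝ, E) I ∞ (extChartAt I x₀).symm (range I) z :=
    contMDiffWithinAt_extChartAt_symm_range x₀ hz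
  have h2 : ContMDiffAt I' 𝓘(ℝ, E') ∞ (extChartAt I' y₀) (f ((extChartAt I x₀).symm z)) :=
    contMDiffAt_extChartAt' (by simpa using hfz)
  exact (h2.comp _ (hf.contMDiffAt)).comp_contMDiffWithinAt z h1

theorem tangentMapAt_comp_symm [IsManifold I ∞ N] [IsManifold I' ∞ N'] {f : N → N'}
    (hf : ContMDiff I I' ∞ f) {x₀ : N} {y₀ : N'} {z : E} (hz : z ∈ (extChartAt I x₀).target)
    (hfz : f ((extChartAt I x₀).symm z) ∈ (extChartAt I' y₀).source) :
    (tangentMapAt I I' f ((extChartAt I x₀).symm z)).comp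
      (chartSymmMapAt I x₀ z) =
    (chartSymmMapAt I' y₀ (coordMap I I' f x₀ y₀ z)).comp
      (fderivWithin ℝ (coordMap I I' f x₀ y₀) (range I) z) := by
  have hzr : z ∈ range I := extChartAt_target_subset_range x₀ hz
  have hu : UniqueMDiffWithinAt 𝓘(ℝ, E) (range I) z := I.uniqueMDiffOn z hzr
  have hsymm : MDifferentiableWithinAt 𝓘(ℝ, E) I (extChartAt I x₀).symm (range I) z :=
    mdifferentiableWithinAt_extChartAt_symm hz
  have hF : MDifferentiableWithinAt 𝓘(ℝ, E) 𝓘(ℝ, E') (coordMap I I' f x₀ y₀) (range I) z :=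
    ((contDiffWithinAt_coordMap hf hz hfz).differentiableWithinAt (by simp)).mdifferentiableWithinAt
  have hFz : coordMap I I' f x₀ y₀ z ∈ (extChartAt I' y₀).target :=
    (extChartAt I' y₀).map_source hfz
  have hsymm' : MDifferentiableWithinAt 𝓘(ℝ, E') I' (extChartAt I' y₀).symm (range I')
      (coordMap I I' f x₀ y₀ z) := mdifferentiableWithinAt_extChartAt_symm hFz
  have e1 : mfderivWithin 𝓘(ℝ, E) I' (f ∘ (extChartAt I x₀).symm) (range I) z =
      (mfderiv I I' f ((extChartAt I x₀).symm z)).comp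
        (mfderivWithin 𝓘(ℝ, E) I (extChartAt I x₀).symm (range I) z) :=
    mfderiv_comp_mfderivWithin z (hf.mdifferentiable (by simp) _) hsymm hu
  have e2 : mfderivWithin 𝓘(ℝ, E) I' ((extChartAt I' y₀).symm ∘ coordMap I I' f x₀ y₀)
      (range I) z =
      (mfderivWithin 𝓘(ℝ, E') I' (extChartAt I' y₀).symm (range I')
        (coordMap I I' f x₀ y₀ z)).comp
        (mfderivWithin 𝓘(ℝ, E) 𝓘(ℝ, E') (coordMap I I' f x₀ y₀) (range I) z) :=
    mfderivWithin_comp z hsymm' hF (fun w _ => ⟨_, rfl⟩) hu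
  have hev : (f ∘ (extChartAt I x₀).symm) =ᶠ[𝓝[range I] z]
      ((extChartAt I' y₀).symm ∘ coordMap I I' f x₀ y₀) := by
    have hc : ContinuousWithinAt (f ∘ (extChartAt I x₀).symm) (range I) z :=
      (hf.continuous.continuousAt).comp_continuousWithinAt hsymm.continuousWithinAt
    have := hc.preimage_mem_nhdsWithin
      ((isOpen_extChartAt_source (I := I') y₀).mem_nhds hfz)
    filter_upwards [this] with w hw
    exact ((extChartAt I' y₀).left_inv hw).symm
  have e3 := hev.mfderivWithin_eq (I := 𝓘(ℝ, E)) (I' := I')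
    ((extChartAt I' y₀).left_inv hfz).symm
  rw [mfderivWithin_eq_fderivWithin] at e2
  exact e1.symm.trans (e3.trans e2)

theorem chartRep_pullbackForm [IsManifold I ∞ N] [IsManifold I' ∞ N'] {f : N → N'}
    (hf : ContMDiff I I' ∞ f) {x₀ : N} {y₀ : N'} {z : E} (hz : z ∈ (extChartAt I x₀).target)
    (hfz : f ((extChartAt I x₀).symm z) ∈ (extChartAt I' y₀).source)
    {k : ℕ} (α : RawForm E' N' k) :
    chartRep I (pullbackForm I I' f α) x₀ z =
      (chartRep I' α y₀ (coordMap I I' f x₀ y₀ z)).compContinuousLinearMap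
        (fderivWithin ℝ (coordMap I I' f x₀ y₀) (range I) z) := by
  have h1 := tangentMapAt_comp_symm hf hz hfz
  have h2 : (extChartAt I' y₀).symm (coordMap I I' f x₀ y₀ z) = f ((extChartAt I x₀).symm z) :=
    (extChartAt I' y₀).left_inv hfz
  ext v
  simp only [chartRep, pullbackForm, h2]
  exact congrArg (fun L : E →L[ℝ] E' => (α (f ((extChartAt I x₀).symm z))) (fun i => L (v i))) h1

/-- Smoothness of the composition of an alternating map with a linear map, as a function of both. -/
theorem contDiff_compCLM (k : ℕ) :
    ContDiff ℝ ∞ (fun p : (E' [⋀^Fin k]→L[ℝ] ℝ) × (E →L[ℝ] E') =>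
      p.1.compContinuousLinearMap p.2) := by
  classical
  -- A left inverse of the inclusion of alternating maps into multilinear maps
  let L : ContinuousMultilinearMap ℝ (fun _ : Fin k => E) ℝ →L[ℝ] E [⋀^Fin k]→L[ℝ] ℝ :=
    LinearMap.mkContinuous
      { toFun := fun f => ((k.factorial : ℝ)⁻¹) • ContinuousMultilinearMap.alternatization f
        map_add' := fun f g => by simp
        map_smul' := fun c f => by
          ext v
          have h : ContinuousMultilinearMap.alternatization (c • f) v =
              c * ContinuousMultilinearMap.alternatization f v := by
            simp only [ContinuousMultilinearMap.alternatization_apply_apply, Finset.mul_sum]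
            refine Finset.sum_congr rfl fun σ _ => ?_
            exact (mul_smul_comm _ _ _).symm
          simp only [ContinuousAlternatingMap.smul_apply, h, smul_eq_mul, RingHom.id_apply]
          ring } 1 (fun f => by
        refine ContinuousAlternatingMap.opNorm_le_bound _ (by positivity) (fun v => ?_)
        have hb : ‖∑ σ : Equiv.Perm (Fin k), Equiv.Perm.sign σ • f (v ∘ σ)‖ ≤
            (k.factorial : ℝ) * (‖f‖ * ∏ i, ‖v i‖) := by
          refine (norm_sum_le _ _).trans ?_
          have : ∀ σ ∈ (Finset.univ : Finset (Equiv.Perm (Fin k))),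
              ‖Equiv.Perm.sign σ • f (v ∘ σ)‖ ≤ ‖f‖ * ∏ i, ‖v i‖ := by
            intro σ _
            have h1 : ‖Equiv.Perm.sign σ • f (v ∘ σ)‖ = ‖f (v ∘ σ)‖ := by
              rcases Int.units_eq_one_or (Equiv.Perm.sign σ) with h | h <;> simp [h]
            rw [h1]
            refine (f.le_opNorm _).trans (le_of_eq ?_)
            congr 1
            exact Equiv.prod_comp σ (fun i => ‖v i‖)
          refine (Finset.sum_le_card_nsmul _ _ _ this).trans (le_of_eq ?_)
          simp [Fintype.card_perm]
        have hk : (0 : ℝ) < k.factorial := by exact_mod_cast k.factorial_pos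
        simp only [LinearMap.coe_mk, AddHom.coe_mk, ContinuousAlternatingMap.smul_apply,
          ContinuousMultilinearMap.alternatization_apply_apply, norm_smul, norm_inv,
          Real.norm_natCast, one_mul]
        calc _ ≤ (k.factorial : ℝ)⁻¹ * ((k.factorial : ℝ) * (‖f‖ * ∏ i, ‖v i‖)) := by gcongr
          _ = _ := by field_simp)
  have hL : ∀ f : E [⋀^Fin k]→L[ℝ] ℝ, L f.toContinuousMultilinearMap = f := by
    intro f
    have hk : (k.factorial : ℝ) ≠ 0 := by exact_mod_cast k.factorial_ne_zero
    ext v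
    have : ∀ σ ∈ (Finset.univ : Finset (Equiv.Perm (Fin k))),
        Equiv.Perm.sign σ • f.toContinuousMultilinearMap (v ∘ σ) = f v := by
      intro σ _
      have h := f.toAlternatingMap.map_perm v σ
      change Equiv.Perm.sign σ • f (v ∘ σ) = f v
      have h' : f (v ∘ σ) = Equiv.Perm.sign σ • f v := h
      rw [h', smul_smul]
      simp
    change (k.factorial : ℝ)⁻¹ •
      (ContinuousMultilinearMap.alternatization f.toContinuousMultilinearMap) v = f v
    rw [ContinuousMultilinearMap.alternatization_apply_apply, Finset.sum_congr rfl this]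
    simp [Fintype.card_perm, hk]
  have h2 : ContDiff ℝ ∞ (fun q : (ContinuousMultilinearMap ℝ (fun _ : Fin k => E') ℝ) ×
      (E →L[ℝ] E') => q.1.compContinuousLinearMap (fun _ : Fin k => q.2)) := by
    have h3 : ContDiff ℝ ∞ (fun q : (ContinuousMultilinearMap ℝ (fun _ : Fin k => E') ℝ) ×
        (E →L[ℝ] E') =>
        ContinuousMultilinearMap.compContinuousLinearMapContinuousMultilinear ℝ
          (fun _ : Fin k => E) (fun _ : Fin k => E') ℝ (fun _ : Fin k => q.2)) :=
      (ContinuousMultilinearMap.contDiff _).comp (contDiff_pi.2 fun _ => contDiff_snd)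
    exact h3.clm_apply contDiff_fst
  have h4 : (fun p : (E' [⋀^Fin k]→L[ℝ] ℝ) × (E →L[ℝ] E') => p.1.compContinuousLinearMap p.2) =
      fun p => L (p.1.toContinuousMultilinearMap.compContinuousLinearMap fun _ => p.2) := by
    funext p
    exact (hL _).symm
  rw [h4]
  exact L.contDiff.comp (h2.comp
    (((ContinuousAlternatingMap.toContinuousMultilinearMapLI (𝕜 := ℝ) (E := E') (F := ℝ)
      (ι := Fin k)).toContinuousLinearMap.contDiff.comp contDiff_fst).prodMk contDiff_snd))

theorem pullbackForm_mem_smoothForms [IsManifold I ∞ N] [IsManifold I' ∞ N'] {f : N → N'}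
    (hf : ContMDiff I I' ∞ f) {k : ℕ} {α : RawForm E' N' k} (hα : α ∈ smoothForms I' N' k) :
    pullbackForm I I' f α ∈ smoothForms I N k := by
  intro x₀ z hz
  set y₀ := f ((extChartAt I x₀).symm z) with hy₀
  have hfz : f ((extChartAt I x₀).symm z) ∈ (extChartAt I' y₀).source := mem_extChartAt_source _
  have hF := contDiffWithinAt_coordMap hf hz hfz
  have hzr : z ∈ range I := extChartAt_target_subset_range x₀ hz
  have hFz : coordMap I I' f x₀ y₀ z ∈ (extChartAt I' y₀).target :=
    (extChartAt I' y₀).map_source hfz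
  have htgt : (extChartAt I x₀).target ∈ 𝓝[range I] z := extChartAt_target_mem_nhdsWithin_of_mem hz
  have hc : ContinuousWithinAt (fun w => f ((extChartAt I x₀).symm w)) (range I) z :=
    (hf.continuous.continuousAt).comp_continuousWithinAt
      (mdifferentiableWithinAt_extChartAt_symm hz).continuousWithinAt
  have hev := hc.preimage_mem_nhdsWithin ((isOpen_extChartAt_source (I := I') y₀).mem_nhds hfz)
  have h1 : ContDiffWithinAt ℝ ∞ (fun w => (chartRep I' α y₀ (coordMap I I' f x₀ y₀ w),
      fderivWithin ℝ (coordMap I I' f x₀ y₀) (range I) w)) (range I) z := by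
    refine ContDiffWithinAt.prodMk ?_ ?_
    · have ha : ContDiffWithinAt ℝ ∞ (chartRep I' α y₀) (range I') (coordMap I I' f x₀ y₀ z) :=
        (hα y₀ _ hFz).mono_of_mem_nhdsWithin (extChartAt_target_mem_nhdsWithin_of_mem hFz)
      exact ha.comp z hF (fun w _ => ⟨_, rfl⟩)
    · exact hF.fderivWithin_right I.uniqueDiffOn (by simp) hzr
  have h2 := (contDiff_compCLM (E := E) (E' := E') k).contDiffAt.comp_contDiffWithinAt z h1
  refine ContDiffWithinAt.mono_of_mem_nhdsWithin (t := (extChartAt I x₀).target)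
    (s := range I) ?_ ?_
  · refine h2.congr_of_eventuallyEq ?_ (chartRep_pullbackForm hf hz hfz α)
    filter_upwards [hev, htgt] with w hw hw'
    exact chartRep_pullbackForm hf hw' hw α
  · exact mem_of_superset self_mem_nhdsWithin (extChartAt_target_subset_range x₀)

theorem extDerivWithin_chartRep_pullbackForm [IsManifold I ∞ N] [IsManifold I' ∞ N'] {f : N → N'}
    (hf : ContMDiff I I' ∞ f) {x₀ : N} {y₀ : N'} {z : E} (hz : z ∈ (extChartAt I x₀).target)
    (hfz : f ((extChartAt I x₀).symm z) ∈ (extChartAt I' y₀).source)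
    {k : ℕ} {α : RawForm E' N' k} (hα : α ∈ smoothForms I' N' k) :
    extDerivWithin (chartRep I (pullbackForm I I' f α) x₀) (range I) z =
      (extDerivWithin (chartRep I' α y₀) (range I')
        (coordMap I I' f x₀ y₀ z)).compContinuousLinearMap
        (fderivWithin ℝ (coordMap I I' f x₀ y₀) (range I) z) := by
  have hF := contDiffWithinAt_coordMap hf hz hfz
  have hzr : z ∈ range I := extChartAt_target_subset_range x₀ hz
  have hFz : coordMap I I' f x₀ y₀ z ∈ (extChartAt I' y₀).target :=
    (extChartAt I' y₀).map_source hfz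
  have htgt : (extChartAt I x₀).target ∈ 𝓝[range I] z := extChartAt_target_mem_nhdsWithin_of_mem hz
  have hc : ContinuousWithinAt (fun w => f ((extChartAt I x₀).symm w)) (range I) z :=
    (hf.continuous.continuousAt).comp_continuousWithinAt
      (mdifferentiableWithinAt_extChartAt_symm hz).continuousWithinAt
  have hev := hc.preimage_mem_nhdsWithin ((isOpen_extChartAt_source (I := I') y₀).mem_nhds hfz)
  have ha : ContDiffWithinAt ℝ ∞ (chartRep I' α y₀) (range I') (coordMap I I' f x₀ y₀ z) :=
    (hα y₀ _ hFz).mono_of_mem_nhdsWithin (extChartAt_target_mem_nhdsWithin_of_mem hFz)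
  have hcongr : chartRep I (pullbackForm I I' f α) x₀ =ᶠ[𝓝[range I] z] fun w =>
      (chartRep I' α y₀ (coordMap I I' f x₀ y₀ w)).compContinuousLinearMap
        (fderivWithin ℝ (coordMap I I' f x₀ y₀) (range I) w) := by
    filter_upwards [hev, htgt] with w hw hw'
    exact chartRep_pullbackForm hf hw' hw α
  rw [hcongr.extDerivWithin_eq_of_mem hzr]
  exact extDerivWithin_pullback (ha.differentiableWithinAt (by simp)) hF
    (by rw [minSmoothness_of_isRCLikeNormedField]; exact ENat.LEInfty.out)
    I.uniqueDiffOn (I.range_subset_closure_interior hzr) hzr (fun w _ => ⟨_, rfl⟩)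

theorem tangentMapAt_eq_fderivWithin [IsManifold I ∞ N] [IsManifold I' ∞ N'] {f : N → N'}
    (hf : ContMDiff I I' ∞ f) (x : N) :
    tangentMapAt I I' f x =
      fderivWithin ℝ (coordMap I I' f x (f x)) (range I) (extChartAt I x x) := by
  have h : MDifferentiableAt I I' f x := hf.mdifferentiable (by simp) x
  exact h.mfderiv

/-- The exterior derivative commutes with pullback. -/
theorem extD_pullbackForm [IsManifold I ∞ N] [IsManifold I' ∞ N'] {f : N → N'}
    (hf : ContMDiff I I' ∞ f) {k : ℕ} {α : RawForm E' N' k} (hα : α ∈ smoothForms I' N' k) :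
    extD I (pullbackForm I I' f α) = pullbackForm I I' f (extD I' α) := by
  funext x
  have hx : (extChartAt I x).symm (extChartAt I x x) = x := extChartAt_to_inv x
  have h := extDerivWithin_chartRep_pullbackForm hf (mem_extChartAt_target x) (y₀ := f x)
    (by rw [hx]; exact mem_extChartAt_source _) hα
  rw [extD_eq, h, pullbackForm, extD_eq, ← tangentMapAt_eq_fderivWithin hf]
  simp only [coordMap, hx]

theorem differentiableWithinAt_chartRep {k : ℕ} {α : RawForm E N k}
    (hα : α ∈ smoothForms I N k) (x : N) :
    DifferentiableWithinAt ℝ (chartRep I α x) (range I) (extChartAt I x x) :=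
  ((hα x _ (mem_extChartAt_target x)).mono_of_mem_nhdsWithin
    (extChartAt_target_mem_nhdsWithin x)).differentiableWithinAt (by simp)

theorem extD_add {k : ℕ} {α β : RawForm E N k}
    (hα : α ∈ smoothForms I N k) (hβ : β ∈ smoothForms I N k) :
    extD I (α + β) = extD I α + extD I β := by
  funext x
  have hu : UniqueDiffWithinAt ℝ (range I) (extChartAt I x x) :=
    I.uniqueDiffOn _ (mem_range_self _)
  have h := extDerivWithin_add hu (differentiableWithinAt_chartRep hα x)
    (differentiableWithinAt_chartRep hβ x)
  have h' : chartRep I (α + β) x = chartRep I α x + chartRep I β x := rfl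
  simp only [extD, h', h]
  rfl

theorem extD_smul {k : ℕ} (c : ℝ) (α : RawForm E N k) :
    extD I (c • α) = c • extD I α := by
  funext x
  have hu : UniqueDiffWithinAt ℝ (range I) (extChartAt I x x) :=
    I.uniqueDiffOn _ (mem_range_self _)
  have h := extDerivWithin_smul c (chartRep I α x) hu
  have h' : chartRep I (c • α) x = c • chartRep I α x := rfl
  simp only [extD, h', h]
  rfl

end Forms

section GManifolds

/-! Throughout, the Lie group `G` is modelled on the vector space `𝔤`, so that its Lie algebra,
the tangent space at `1`, is `𝔤`; the dual `𝔤*` is `𝔤 →L[ℝ] ℝ`. -/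

variable (𝔤 : Type*) [NormedAddCommGroup 𝔤] [NormedSpace ℝ 𝔤]
  (G : Type*) [TopologicalSpace G] [ChartedSpace 𝔤 G] [Group G]

variable {G} in
/-- The adjoint action `Ad_g : 𝔤 → 𝔤`: the differential at `1` of `h ↦ g h g⁻¹`. -/
def adjointMap (g : G) : 𝔤 →L[ℝ] 𝔤 :=
  tangentMapAt 𝓘(ℝ, 𝔤) 𝓘(ℝ, 𝔤) (fun h : G => g * h * g⁻¹) 1

variable {E : Type*} [NormedAddCommGroup E] [NormedSpace ℝ E]
  {E' : Type*} [NormedAddCommGroup E'] [NormedSpace ℝ E']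
  {H : Type*} [TopologicalSpace H] {H' : Type*} [TopologicalSpace H']
  (I : ModelWithCorners ℝ E H) (I' : ModelWithCorners ℝ E' H')
  (N : Type*) [TopologicalSpace N] [ChartedSpace H N] [MulAction G N]
  (N' : Type*) [TopologicalSpace N'] [ChartedSpace H' N'] [MulAction G N']

variable {𝔤 N} in
/-- The vector field `X♯` generated by `X ∈ 𝔤`; its value at `x` is the image of `X` under the
differential at `1` of `g ↦ g • x`, that is, `d/dt|_{t=0} exp (t X) • x`. -/
def fundamentalField (X : 𝔤) (x : N) : E :=
  tangentMapAt 𝓘(ℝ, 𝔤) I (fun g : G => g • x) 1 X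

/-- A smooth `G`-equivariant map between `G`-manifolds. -/
structure EquivariantMap where
  toFun : N → N'
  smooth : ContMDiff I I' ∞ toFun
  equivariant : ∀ (g : G) (x : N), toFun (g • x) = g • toFun x

instance : CoeFun (EquivariantMap G I I' N N') (fun _ => N → N') := ⟨EquivariantMap.toFun⟩

/-- A taming map: a smooth `G`-equivariant map to the Lie algebra. -/
structure TamingMap where
  toFun : N → 𝔤
  smooth : ContMDiff I 𝓘(ℝ, 𝔤) ∞ toFun
  equivariant : ∀ (g : G) (x : N), toFun (g • x) = adjointMap 𝔤 g (toFun x)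

instance : CoeFun (TamingMap 𝔤 G I N) (fun _ => N → 𝔤) := ⟨TamingMap.toFun⟩

variable {𝔤 G I N} in
/-- The vector field `v♯`, with `v♯|_x = (v x)♯|_x`. -/
def TamingMap.sharp (v : TamingMap 𝔤 G I N) (x : N) : E :=
  fundamentalField G I (v x) x

variable {𝔤 G I N} in
/-- The localizing set `Z = {v♯ = 0}`. -/
def TamingMap.localizingSet (v : TamingMap 𝔤 G I N) : Set N :=
  {x | v.sharp x = 0}

variable {𝔤} in
/-- `Φ` is `v`-polarized: `⟨Φ, v⟩` is proper and bounded from below. -/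
def IsPolarized {S : Type*} [TopologicalSpace S] (v : S → 𝔤) (Φ : S → (𝔤 →L[ℝ] ℝ)) : Prop :=
  IsProperMap (fun x => Φ x (v x)) ∧ BddBelow (range fun x => Φ x (v x))

/-- A Hamiltonian `G`-structure `(ω, Φ)` on `N`: a `G`-invariant closed `2`-form (possibly
degenerate) and an equivariant momentum map with `d Φ^X = ι(X♯) ω`. -/
structure HamiltonianStructure where
  form : RawForm E N 2
  moment : N → (𝔤 →L[ℝ] ℝ)
  form_smooth : form ∈ smoothForms I N 2
  form_closed : extD I form = 0
  form_invariant : ∀ g : G, pullbackForm I I (fun x : N => g • x) form = form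
  moment_smooth : ContMDiff I 𝓘(ℝ, 𝔤 →L[ℝ] ℝ) ∞ moment
  moment_equivariant : ∀ (g : G) (x : N), moment (g • x) = (moment x).comp (adjointMap 𝔤 g⁻¹)
  hamilton : ∀ (X : 𝔤) (x : N) (w : E),
    tangentMapAt I 𝓘(ℝ, ℝ) (fun y => moment y X) x w = form x ![fundamentalField G I X x, w]

variable {N I} in
/-- The equivariant forms `σ + Φ` and `σ' + Φ'` agree on the subset `Y` of `N`: their pullbacks
coincide under every smooth map `p : D → N` with image in `Y`, for `D` open in some `ℝ^m`,
`m > 0`. -/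
def AgreeOn (I : ModelWithCorners ℝ E H) (Y : Set N) (σ : RawForm E N 2) (Φ : N → (𝔤 →L[ℝ] ℝ))
    (σ' : RawForm E N 2) (Φ' : N → (𝔤 →L[ℝ] ℝ)) : Prop :=
  ∀ (m : ℕ), 0 < m → ∀ (D : Set (EuclideanSpace ℝ (Fin m))), IsOpen D →
    ∀ p : EuclideanSpace ℝ (Fin m) → N, ContMDiffOn (𝓡 m) I ∞ p D → MapsTo p D Y →
      ∀ u ∈ D, pullbackForm (𝓡 m) I p σ u = pullbackForm (𝓡 m) I p σ' u ∧
        Φ (p u) = Φ' (p u)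

variable {𝔤 G I N} in
/-- `(N, ω', Φ')` is a `v`-polarized completion of `(N, ω, Φ)` relative to the closed invariant
subset `Y`, on which `Φ` is required to be `v`-polarized. -/
structure IsPolarizedCompletion (v : TamingMap 𝔤 G I N) (h h' : HamiltonianStructure 𝔤 G I N)
    (Y : Set N) : Prop where
  isClosed : IsClosed Y
  invariant : ∀ (g : G), ∀ x ∈ Y, g • x ∈ Y
  polarized_on : IsPolarized (fun y : Y => v y) (fun y : Y => h.moment y)
  polarized : IsPolarized v h'.moment
  agree : AgreeOn 𝔤 I Y h'.form h'.moment h.form h.moment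

/-! ### The Cartan model -/

/-- Functions `𝔤 → Ω^*(N)` (not necessarily smooth or polynomial). An element of `Ω^*(N)` is given
by its components of all degrees (those above the dimension vanish). -/
def Cochains (𝔤 E : Type*) [NormedAddCommGroup E] [NormedSpace ℝ E] (N : Type*) :=
  𝔤 → ∀ k, RawForm E N k

instance (𝔤 E : Type*) [NormedAddCommGroup E] [NormedSpace ℝ E] (N : Type*) :
    AddCommGroup (Cochains 𝔤 E N) :=
  inferInstanceAs (AddCommGroup (𝔤 → ∀ k, RawForm E N k))

instance (𝔤 E : Type*) [NormedAddCommGroup E] [NormedSpace ℝ E] (N : Type*) :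
    Module ℝ (Cochains 𝔤 E N) :=
  inferInstanceAs (Module ℝ (𝔤 → ∀ k, RawForm E N k))

/-- Real polynomial functions on a vector space: the algebra generated by linear functions. -/
def polynomialAlgebra (V : Type*) [NormedAddCommGroup V] [NormedSpace ℝ V] :
    Subalgebra ℝ (V → ℝ) :=
  Algebra.adjoin ℝ {p | ∃ ℓ : V →L[ℝ] ℝ, p = fun X => ℓ X}

/-- Polynomial functions `𝔤 → Ω^*(N)`, i.e. elements of `S(𝔤*) ⊗ Ω^*(N)`. -/
def polynomialForms : Submodule ℝ (Cochains 𝔤 E N) :=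
  Submodule.span ℝ {β | ∃ p ∈ polynomialAlgebra 𝔤, ∃ α : ∀ k, RawForm E N k,
    (∀ k, α k ∈ smoothForms I N k) ∧ β = fun X => p X • α}

/-- Equivariant differential forms: the equivariant polynomial functions `𝔤 → Ω^*(N)`. -/
def equivariantForms : Submodule ℝ (Cochains 𝔤 E N) where
  carrier := {β | β ∈ polynomialForms 𝔤 I N ∧ ∀ (g : G) (X : 𝔤) (k : ℕ),
    pullbackForm I I (fun x : N => g • x) (β (adjointMap 𝔤 g X) k) = β X k}
  add_mem' {a b} ha hb := ⟨add_mem ha.1 hb.1, fun g X k => by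
    have h1 := ha.2 g X k
    have h2 := hb.2 g X k
    change pullbackForm I I _ (a (adjointMap 𝔤 g X) k) +
      pullbackForm I I _ (b (adjointMap 𝔤 g X) k) = a X k + b X k
    rw [h1, h2]⟩
  zero_mem' := ⟨zero_mem _, fun _ _ _ => rfl⟩
  smul_mem' c a ha := ⟨Submodule.smul_mem _ c ha.1, fun g X k => by
    have h1 := ha.2 g X k
    change c • pullbackForm I I _ (a (adjointMap 𝔤 g X) k) = c • a X k
    rw [h1]⟩

variable {N} in
/-- The exterior derivative on `Ω^*(N)`. -/
def totalD (α : ∀ k, RawForm E N k) : ∀ k, RawForm E N k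
  | 0 => 0
  | k + 1 => extD I (α k)

variable {N} in
/-- The contraction `ι_V` on `Ω^*(N)` with a vector field `V`. -/
def contract (V : N → E) (α : ∀ k, RawForm E N k) : ∀ k, RawForm E N k :=
  fun k x => (α (k + 1) x).curryLeft (V x)

variable {𝔤 N} in
/-- The equivariant differential `(d_G α)(X) = d (α(X)) - ι_{X♯} (α(X))`. -/
def equivariantD (α : Cochains 𝔤 E N) : Cochains 𝔤 E N :=
  fun X => totalD I (α X) - contract (fundamentalField G I X) (α X)

variable {𝔤 I N} in
theorem smooth_of_mem_polynomialForms {β : Cochains 𝔤 E N}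
    (hβ : β ∈ polynomialForms 𝔤 I N) (X : 𝔤) (k : ℕ) : β X k ∈ smoothForms I N k := by
  induction hβ using Submodule.span_induction with
  | mem β h =>
    obtain ⟨p, -, α, hα, rfl⟩ := h
    exact Submodule.smul_mem _ (p X) (hα k)
  | zero => exact zero_mem _
  | add a b _ _ ha hb => exact add_mem ha hb
  | smul c a _ ha => exact Submodule.smul_mem _ c ha

variable {𝔤 G I N} in
theorem equivariantD_add {α β : Cochains 𝔤 E N}
    (hα : α ∈ polynomialForms 𝔤 I N) (hβ : β ∈ polynomialForms 𝔤 I N) :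
    equivariantD G I (α + β) = equivariantD G I α + equivariantD G I β := by
  funext X k
  have hd : totalD I ((α + β) X) k = totalD I (α X) k + totalD I (β X) k := by
    cases k with
    | zero => exact (add_zero _).symm
    | succ k =>
      exact extD_add (smooth_of_mem_polynomialForms hα X k) (smooth_of_mem_polynomialForms hβ X k)
  change totalD I ((α + β) X) k -
      (contract (fundamentalField G I X) (α X) k + contract (fundamentalField G I X) (β X) k) =
    (totalD I (α X) k - contract (fundamentalField G I X) (α X) k) +
      (totalD I (β X) k - contract (fundamentalField G I X) (β X) k)
  rw [hd]
  abel

variable {𝔤 G I N} in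
theorem equivariantD_smul (c : ℝ) (α : Cochains 𝔤 E N) :
    equivariantD G I (c • α) = c • equivariantD G I α := by
  funext X k
  have hd : totalD I ((c • α) X) k = c • totalD I (α X) k := by
    cases k with
    | zero => exact (smul_zero _).symm
    | succ k => exact extD_smul c _
  change totalD I ((c • α) X) k - c • contract (fundamentalField G I X) (α X) k =
    c • (totalD I (α X) k - contract (fundamentalField G I X) (α X) k)
  rw [hd, smul_sub]

/-- Equivariantly closed forms. -/
def equivariantCocycles : Submodule ℝ (Cochains 𝔤 E N) where
  carrier := {β | β ∈ equivariantForms 𝔤 G I N ∧ equivariantD G I β = 0}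
  add_mem' ha hb := ⟨add_mem ha.1 hb.1, by
    rw [equivariantD_add ha.1.1 hb.1.1, ha.2, hb.2, add_zero]⟩
  zero_mem' := ⟨zero_mem _, by simpa using equivariantD_smul (G := G) (I := I) (N := N) (0 : ℝ) 0⟩
  smul_mem' c a ha := ⟨Submodule.smul_mem _ c ha.1, by
    rw [equivariantD_smul, ha.2, smul_zero]⟩

/-- Equivariantly exact forms. -/
def equivariantCoboundaries : Submodule ℝ (Cochains 𝔤 E N) where
  carrier := {β | ∃ γ ∈ equivariantForms 𝔤 G I N, equivariantD G I γ = β}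
  add_mem' := by
    rintro _ _ ⟨a, ha, rfl⟩ ⟨b, hb, rfl⟩
    exact ⟨a + b, add_mem ha hb, equivariantD_add ha.1 hb.1⟩
  zero_mem' := ⟨0, zero_mem _, by
    simpa using equivariantD_smul (G := G) (I := I) (N := N) (0 : ℝ) 0⟩
  smul_mem' := by
    rintro c _ ⟨a, ha, rfl⟩
    exact ⟨c • a, Submodule.smul_mem _ c ha, equivariantD_smul c a⟩

/-- Equivariant cohomology `H_G^*(N; ℝ)` (all degrees together): closed equivariant forms modulo
exact ones. -/
abbrev EquivariantCohomology :=
  equivariantCocycles 𝔤 G I N ⧸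
    (equivariantCoboundaries 𝔤 G I N).comap (equivariantCocycles 𝔤 G I N).subtype

/-! ### Pullbacks -/

section Pullback

variable {𝔤 G I I' N N'}

theorem contMDiff_orbitMap [ContMDiffSMul 𝓘(ℝ, 𝔤) I ∞ G N] (x : N) :
    ContMDiff 𝓘(ℝ, 𝔤) I ∞ (fun g : G => g • x) :=
  (contMDiff_smul (I := 𝓘(ℝ, 𝔤)) (I' := I) (n := ∞) (G := G) (M := N)).comp
    (contMDiff_id.prodMk contMDiff_const)

theorem contMDiff_smulMap (𝔤 : Type*) [NormedAddCommGroup 𝔤] [NormedSpace ℝ 𝔤]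
    [ChartedSpace 𝔤 G] [ContMDiffSMul 𝓘(ℝ, 𝔤) I ∞ G N] (g : G) :
    ContMDiff I I ∞ (fun x : N => g • x) :=
  (contMDiff_smul (I := 𝓘(ℝ, 𝔤)) (I' := I) (n := ∞) (G := G) (M := N)).comp
    (contMDiff_const.prodMk contMDiff_id)

theorem tangentMapAt_fundamentalField [ContMDiffSMul 𝓘(ℝ, 𝔤) I ∞ G N]
    (f : EquivariantMap G I I' N N') (X : 𝔤) (x : N) :
    tangentMapAt I I' f x (fundamentalField G I X x) = fundamentalField G I' X (f x) := by
  have h := tangentMapAt_comp f.smooth (contMDiff_orbitMap (𝔤 := 𝔤) (G := G) (I := I) x) 1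
  have h2 : (fun g : G => f (g • x)) = fun g : G => g • f x := funext fun g => f.equivariant g x
  have h3 : (1 : G) • x = x := one_smul G x
  rw [h2, h3] at h
  exact (congrArg (fun L : 𝔤 →L[ℝ] E' => L X) h).symm

theorem pullbackForm_comm (f : EquivariantMap G I I' N N') (g : G)
    (hg : ContMDiff I I ∞ (fun x : N => g • x)) (hg' : ContMDiff I' I' ∞ (fun x : N' => g • x))
    {k : ℕ} (α : RawForm E' N' k) :
    pullbackForm I I (fun x : N => g • x) (pullbackForm I I' f α) =
      pullbackForm I I' f (pullbackForm I' I' (fun x : N' => g • x) α) := by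
  funext x
  have h1 := tangentMapAt_comp f.smooth hg x
  have h2 := tangentMapAt_comp hg' f.smooth x
  have h3 : (fun x : N => f (g • x)) = fun x => g • f x := funext fun x => f.equivariant g x
  rw [h3, h2] at h1
  ext v
  have h4 : ∀ w, tangentMapAt I I' f (g • x) (tangentMapAt I I (fun x : N => g • x) x w) =
      tangentMapAt I' I' (fun x : N' => g • x) (f x) (tangentMapAt I I' f x w) := fun w =>
    (congrArg (fun L : E →L[ℝ] E' => L w) h1).symm
  change α (f (g • x)) (fun i => tangentMapAt I I' f (g • x)
      (tangentMapAt I I (fun x : N => g • x) x (v i))) =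
    α (g • f x) (fun i => tangentMapAt I' I' (fun x : N' => g • x) (f x)
      (tangentMapAt I I' f x (v i)))
  simp only [h4, f.equivariant]

variable [IsManifold I ∞ N] [IsManifold I' ∞ N']
  [ContMDiffSMul 𝓘(ℝ, 𝔤) I ∞ G N] [ContMDiffSMul 𝓘(ℝ, 𝔤) I' ∞ G N']

/-- The pullback of a Hamiltonian structure under an equivariant map. -/
def HamiltonianStructure.pullback (h : HamiltonianStructure 𝔤 G I' N')
    (f : EquivariantMap G I I' N N') : HamiltonianStructure 𝔤 G I N where
  form := pullbackForm I I' f h.form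
  moment := fun x => h.moment (f x)
  form_smooth := pullbackForm_mem_smoothForms f.smooth h.form_smooth
  form_closed := by
    rw [extD_pullbackForm f.smooth h.form_smooth, h.form_closed]
    rfl
  form_invariant g := by
    rw [pullbackForm_comm f g (contMDiff_smulMap 𝔤 g) (contMDiff_smulMap 𝔤 g), h.form_invariant]
  moment_smooth := h.moment_smooth.comp f.smooth
  moment_equivariant g x := by
    rw [f.equivariant, h.moment_equivariant]
  hamilton X x w := by
    have h1 : ContMDiff I' 𝓘(ℝ, ℝ) ∞ (fun y => h.moment y X) :=
      h.moment_smooth.clm_apply contMDiff_const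
    have h2 := tangentMapAt_comp h1 f.smooth x
    rw [h2, ContinuousLinearMap.comp_apply, h.hamilton, ← tangentMapAt_fundamentalField]
    change _ = h.form (f x) _
    congr 1
    funext i
    fin_cases i <;> rfl

/-- The pullback of (polynomial families of) forms, as a linear map. -/
def pullbackForms (f : EquivariantMap G I I' N N') :
    (Cochains 𝔤 E' N') →ₗ[ℝ] (Cochains 𝔤 E N) where
  toFun β := fun X k => pullbackForm I I' f (β X k)
  map_add' _ _ := rfl
  map_smul' _ _ := rfl

theorem pullbackForms_mem (f : EquivariantMap G I I' N N') {β : Cochains 𝔤 E' N'}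
    (hβ : β ∈ equivariantForms 𝔤 G I' N') : pullbackForms f β ∈ equivariantForms 𝔤 G I N := by
  refine ⟨?_, fun g X k => ?_⟩
  · have h : polynomialForms 𝔤 I' N' ≤ (polynomialForms 𝔤 I N).comap (pullbackForms f) := by
      refine Submodule.span_le.2 ?_
      rintro _ ⟨p, hp, α, hα, rfl⟩
      exact Submodule.subset_span ⟨p, hp, fun k => pullbackForm I I' f (α k),
        fun k => pullbackForm_mem_smoothForms f.smooth (hα k), rfl⟩
    exact h hβ.1
  · change pullbackForm I I _ (pullbackForm I I' f (β (adjointMap 𝔤 g X) k)) = _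
    rw [pullbackForm_comm f g (contMDiff_smulMap 𝔤 g) (contMDiff_smulMap 𝔤 g), hβ.2]
    rfl

theorem equivariantD_pullbackForms (f : EquivariantMap G I I' N N')
    {β : Cochains 𝔤 E' N'} (hβ : β ∈ equivariantForms 𝔤 G I' N') :
    equivariantD G I (pullbackForms f β) = pullbackForms f (equivariantD G I' β) := by
  funext X k
  have hd : totalD I (pullbackForms f β X) k = pullbackForm I I' f (totalD I' (β X) k) := by
    cases k with
    | zero => rfl
    | succ k => exact extD_pullbackForm f.smooth (smooth_of_mem_polynomialForms hβ.1 X k)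
  have hc : contract (fundamentalField G I X) (pullbackForms f β X) k =
      pullbackForm I I' f (contract (fundamentalField G I' X) (β X) k) := by
    funext x
    change ((β X (k + 1) (f x)).compContinuousLinearMap (tangentMapAt I I' f x)).curryLeft _ = _
    rw [ContinuousAlternatingMap.curryLeft_compContinuousLinearMap,
      tangentMapAt_fundamentalField]
    rfl
  change totalD I (pullbackForms f β X) k - contract _ (pullbackForms f β X) k =
    pullbackForm I I' f (totalD I' (β X) k) - pullbackForm I I' f (contract _ (β X) k)
  rw [hd, hc]

/-- The pullback `f^* : H_G^*(N') → H_G^*(N)` in equivariant cohomology. -/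
def EquivariantCohomology.pullback (f : EquivariantMap G I I' N N') :
    EquivariantCohomology 𝔤 G I' N' →ₗ[ℝ] EquivariantCohomology 𝔤 G I N :=
  Submodule.mapQ _ _
    ((pullbackForms f).restrict (p := equivariantCocycles 𝔤 G I' N')
      (q := equivariantCocycles 𝔤 G I N) fun β hβ => ⟨pullbackForms_mem f hβ.1, by
        rw [equivariantD_pullbackForms f hβ.1, hβ.2, map_zero]⟩)
    (by
      rintro ⟨β, hβ⟩ ⟨γ, hγ, hγβ⟩
      exact ⟨pullbackForms f γ, pullbackForms_mem f hγ, by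
        rw [equivariantD_pullbackForms f hγ, hγβ]
        rfl⟩)

/-- The pullback of a taming map. -/
def TamingMap.pullback (v : TamingMap 𝔤 G I' N') (f : EquivariantMap G I I' N N') :
    TamingMap 𝔤 G I N where
  toFun x := v (f x)
  smooth := v.smooth.comp f.smooth
  equivariant g x := by rw [f.equivariant, v.equivariant]

end Pullback

end GManifolds

section Orientations

variable {E : Type*} [NormedAddCommGroup E] [NormedSpace ℝ E]
  {H : Type*} [TopologicalSpace H]

/-- The top degree form `μ` is positive for the orientation `o`. -/
def IsPositiveForm {m : ℕ} (o : Orientation ℝ E (Fin m)) (μ : E [⋀^Fin m]→ₗ[ℝ] ℝ) : Prop :=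
  ∃ hμ : μ ≠ 0, rayOfNeZero ℝ μ hμ = o

/-- An orientation of an `m`-dimensional manifold: a choice of orientations of the tangent spaces
that is locally constant in charts. -/
structure ManifoldOrientation (I : ModelWithCorners ℝ E H) (N : Type*) [TopologicalSpace N]
    [ChartedSpace H N] (m : ℕ) where
  toFun : N → Orientation ℝ E (Fin m)
  locally_constant : ∀ x₀ : N, ∀ᶠ x in 𝓝 x₀, ∀ μ : E [⋀^Fin m]→ₗ[ℝ] ℝ,
    IsPositiveForm (toFun x₀) μ → IsPositiveForm (toFun x)
      (μ.compLinearMap (tangentMapAt I 𝓘(ℝ, E) (extChartAt I x₀) x : E →ₗ[ℝ] E))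

instance (I : ModelWithCorners ℝ E H) (N : Type*) [TopologicalSpace N] [ChartedSpace H N] (m : ℕ) :
    CoeFun (ManifoldOrientation I N m) (fun _ => N → Orientation ℝ E (Fin m)) :=
  ⟨ManifoldOrientation.toFun⟩

variable {I : ModelWithCorners ℝ E H} {N : Type*} [TopologicalSpace N] [ChartedSpace H N]

theorem tangentMapAt_extChartAt_opens [IsManifold I ∞ N] (U : TopologicalSpace.Opens N)
    (x₀ x : U) (hx : (x : N) ∈ (extChartAt I (x₀ : N)).source) :
    tangentMapAt I 𝓘(ℝ, E) (extChartAt I x₀) x =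
      tangentMapAt I 𝓘(ℝ, E) (extChartAt I (x₀ : N)) x := by
  have hcoe : ∀ y : U, (extChartAt I y : U → E) = extChartAt I (y : N) ∘ Subtype.val := fun y => rfl
  have hval : MDifferentiableAt I I (Subtype.val : U → N) x :=
    (contMDiff_subtype_val (n := ∞)).mdifferentiable (by simp) x
  have key : ∀ y : U, (x : N) ∈ (extChartAt I (y : N)).source →
      tangentMapAt I 𝓘(ℝ, E) (extChartAt I y) x =
        (tangentMapAt I 𝓘(ℝ, E) (extChartAt I (y : N)) x).comp
          (tangentMapAt I I (Subtype.val : U → N) x) := by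
    intro y hy
    have h1 : MDifferentiableAt I 𝓘(ℝ, E) (extChartAt I (y : N)) (x : N) :=
      mdifferentiableAt_extChartAt (by simpa using hy)
    unfold tangentMapAt
    rw [hcoe]
    exact mfderiv_comp x h1 hval
  have hid : tangentMapAt I I (Subtype.val : U → N) x = ContinuousLinearMap.id ℝ E := by
    have h := key x (mem_extChartAt_source _)
    rw [tangentMapAt_extChartAt_self, tangentMapAt_extChartAt_self,
      ContinuousLinearMap.id_comp] at h
    exact h.symm
  rw [key x₀ hx, hid, ContinuousLinearMap.comp_id]

/-- The restriction of an orientation to an open subset `U`. (The chart of `U` at a point is the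
restriction of the chart of `N`, so that the tangent spaces are identically the same.) -/
def ManifoldOrientation.restrict [IsManifold I ∞ N] {m : ℕ} (o : ManifoldOrientation I N m)
    (U : TopologicalSpace.Opens N) : ManifoldOrientation I U m where
  toFun x := o x
  locally_constant x₀ := by
    have h1 := continuous_subtype_val.continuousAt.eventually (o.locally_constant (x₀ : N))
    have h2 := continuous_subtype_val.continuousAt.eventually
      ((isOpen_extChartAt_source (I := I) (x₀ : N)).mem_nhds (mem_extChartAt_source _))
    filter_upwards [h1, h2] with x hx hx' μ hμ
    rw [tangentMapAt_extChartAt_opens U x₀ x hx']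
    exact hx μ hμ

end Orientations

section InvariantOpens

variable (G : Type*) [Group G] (N : Type*) [TopologicalSpace N] [MulAction G N]

/-- `G`-invariant open subsets. -/
structure InvariantOpens where
  opens : TopologicalSpace.Opens N
  smul_mem : ∀ (g : G), ∀ x ∈ opens, g • x ∈ opens

variable {G N}

instance (U : InvariantOpens G N) : MulAction G U.opens where
  smul g x := ⟨g • (x : N), U.smul_mem g x x.2⟩
  one_smul x := Subtype.ext (one_smul G (x : N))
  mul_smul g h x := Subtype.ext (mul_smul g h (x : N))

variable {𝔤 : Type*} [NormedAddCommGroup 𝔤] [NormedSpace ℝ 𝔤]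
  [TopologicalSpace G] [ChartedSpace 𝔤 G]
  {E : Type*} [NormedAddCommGroup E] [NormedSpace ℝ E]
  {H : Type*} [TopologicalSpace H] (I : ModelWithCorners ℝ E H)
  [ChartedSpace H N]

instance [ContMDiffSMul 𝓘(ℝ, 𝔤) I ∞ G N] (U : InvariantOpens G N) :
    ContMDiffSMul 𝓘(ℝ, 𝔤) I ∞ G U.opens where
  contMDiff_smul := by
    rw [← ContMDiff.subtypeVal_comp_iff]
    exact (contMDiff_smul (I := 𝓘(ℝ, 𝔤)) (I' := I) (n := ∞) (G := G) (M := N)).comp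
      (contMDiff_fst.prodMk (contMDiff_subtype_val.comp contMDiff_snd))

/-- The inclusion of an invariant open subset. -/
def InvariantOpens.incl (U : InvariantOpens G N) : EquivariantMap G I I U.opens N where
  toFun := Subtype.val
  smooth := contMDiff_subtype_val
  equivariant _ _ := rfl

end InvariantOpens

section Cobordism

/-- The model for `(m + 1)`-dimensional manifolds with boundary: the half-space
`ℝ^m × [0, ∞)` in `ℝ^m × ℝ`. -/
abbrev halfSpaceModel (m : ℕ) :=
  (𝓡 m).prod (𝓡∂ 1)

/-- A tangent vector of the half-space is outward pointing at a boundary point if its last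
coordinate is negative. -/
def IsOutward {m : ℕ} (ν : EuclideanSpace ℝ (Fin m) × EuclideanSpace ℝ (Fin 1)) : Prop :=
  ν.2 0 < 0

/-- The embedding `i : N → W` onto a part of the boundary of the oriented manifold `W` carries
the orientations `o` of the tangent spaces of `N` to the boundary orientation
(outward normal first). -/
def PreservesBoundaryOrientation {m : ℕ} {N W : Type*} [TopologicalSpace N]
    [ChartedSpace (EuclideanSpace ℝ (Fin m)) N] [TopologicalSpace W]
    [ChartedSpace (ModelProd (EuclideanSpace ℝ (Fin m)) (EuclideanHalfSpace 1)) W]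
    (i : N → W) (o : N → Orientation ℝ (EuclideanSpace ℝ (Fin m)) (Fin m))
    (oW : ManifoldOrientation (halfSpaceModel m) W (m + 1)) : Prop :=
  ∀ (x : N) (ν : EuclideanSpace ℝ (Fin m) × EuclideanSpace ℝ (Fin 1)), IsOutward ν →
    ∀ μ, IsPositiveForm (oW (i x)) μ → IsPositiveForm (o x)
      ((μ.curryLeft ν).compLinearMap
        (tangentMapAt (𝓡 m) (halfSpaceModel m) i x : EuclideanSpace ℝ (Fin m) →ₗ[ℝ] _))

universe u

variable {𝔤 : Type*} [NormedAddCommGroup 𝔤] [NormedSpace ℝ 𝔤]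
  {G : Type*} [TopologicalSpace G] [ChartedSpace 𝔤 G] [Group G]
  {m : ℕ}
  {M₀ : Type u} [TopologicalSpace M₀] [ChartedSpace (EuclideanSpace ℝ (Fin m)) M₀]
  [IsManifold (𝓡 m) ∞ M₀] [MulAction G M₀] [ContMDiffSMul 𝓘(ℝ, 𝔤) (𝓡 m) ∞ G M₀]
  {M₁ : Type u} [TopologicalSpace M₁] [ChartedSpace (EuclideanSpace ℝ (Fin m)) M₁]
  [IsManifold (𝓡 m) ∞ M₁] [MulAction G M₁] [ContMDiffSMul 𝓘(ℝ, 𝔤) (𝓡 m) ∞ G M₁]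

/-- A proper Hamiltonian cobordism between `(M₀, ω₀, Φ₀, A₀)` and `(M₁, ω₁, Φ₁, A₁)`, where
`M₀` and `M₁` are oriented `m`-manifolds without boundary: a proper Hamiltonian `G`-manifold with
boundary `W` with an equivariant cohomology class, and an equivariant orientation preserving
diffeomorphism `i = i₀ ⊔ i₁ : -M₀ ⊔ M₁ → ∂W` that pulls the structures on `W` back to the given
ones. -/
structure ProperHamiltonianCobordism
    (o₀ : ManifoldOrientation (𝓡 m) M₀ m) (h₀ : HamiltonianStructure 𝔤 G (𝓡 m) M₀)
    (A₀ : EquivariantCohomology 𝔤 G (𝓡 m) M₀)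
    (o₁ : ManifoldOrientation (𝓡 m) M₁ m) (h₁ : HamiltonianStructure 𝔤 G (𝓡 m) M₁)
    (A₁ : EquivariantCohomology 𝔤 G (𝓡 m) M₁) where
  W : Type u
  [topology : TopologicalSpace W]
  [t2 : T2Space W]
  [secondCountable : SecondCountableTopology W]
  [charted : ChartedSpace (ModelProd (EuclideanSpace ℝ (Fin m)) (EuclideanHalfSpace 1)) W]
  [manifold : IsManifold (halfSpaceModel m) ∞ W]
  [action : MulAction G W]
  [smoothAction : ContMDiffSMul 𝓘(ℝ, 𝔤) (halfSpaceModel m) ∞ G W]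
  orientation : ManifoldOrientation (halfSpaceModel m) W (m + 1)
  ham : HamiltonianStructure 𝔤 G (halfSpaceModel m) W
  proper : IsProperMap ham.moment
  cls : EquivariantCohomology 𝔤 G (halfSpaceModel m) W
  i₀ : EquivariantMap G (𝓡 m) (halfSpaceModel m) M₀ W
  i₁ : EquivariantMap G (𝓡 m) (halfSpaceModel m) M₁ W
  /-- `i` is a homeomorphism onto the boundary ... -/
  isEmbedding : IsEmbedding (Sum.elim i₀ i₁)
  range_eq : range (Sum.elim i₀ i₁) = (halfSpaceModel m).boundary W
  /-- ... and an immersion. -/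
  immersion₀ : ∀ x, Function.Injective (tangentMapAt (𝓡 m) (halfSpaceModel m) i₀ x)
  immersion₁ : ∀ x, Function.Injective (tangentMapAt (𝓡 m) (halfSpaceModel m) i₁ x)
  /-- `M₀` enters with the opposite orientation. -/
  orientation₀ : PreservesBoundaryOrientation i₀ (fun x => -o₀ x) orientation
  orientation₁ : PreservesBoundaryOrientation i₁ o₁ orientation
  ham₀ : ham.pullback i₀ = h₀
  ham₁ : ham.pullback i₁ = h₁
  cls₀ : EquivariantCohomology.pullback i₀ cls = A₀
  cls₁ : EquivariantCohomology.pullback i₁ cls = A₁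

end Cobordism

end

/-! The cobordism is a cylinder from which the unwanted part of the top has been removed. Averaging
over the compact group gives two invariant objects on `M`: a `1`-form `Θ` with `Θ(v♯) ≥ 0`, where
equality holds exactly on the localizing set `Z` and `Θ` itself vanishes on `Z`; and a smooth
function `F ≥ 0` that is nonzero exactly on `U`. Let `W` be the set of `(x, t)` in `M × [0, 1]` with
`F x + (1 - t) > 0`, that is, the cylinder minus `(M \ U) × {1}`. Its boundary is `M × {0}` together
with `U × {1}`. The function `ρ = t / (F + 1 - t)` is smooth on `W`, vanishes at `t = 0`, equals `1
/ F` at `t = 1`, and has a denominator tending to `0` at the removed points.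

Put `β = ρ · pr^* Θ` and replace `pr^*(ω + Φ)` by its difference with the equivariantly exact form
`d_G β`: the `2`-form becomes `pr^* ω - dβ`, and the moment map gains the contraction of `β` with
the fundamental fields. This is again Hamiltonian (`HamiltonianStructure.twist`), because the Lie
derivative of an invariant form along a fundamental field is zero
(`tangentMapAt_contractFundamental`). Nothing changes at `t = 0`. At `t = 1` the correction is
governed by `Θ / F`, which vanishes on `Z`, so the result is a completion relative to `Z`
(`agreeOn_of_sub_extD`).

The pairing of the new moment map with `v` is `⟨Φ, v⟩ + ρ Θ(v♯)`, a polarized function plus a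
nonnegative one. A bound on it keeps `x` in a compact set, and keeps `(x, t)` away from the removed
points, because there `Θ(v♯) > 0` (as `Z ⊆ U`) while `ρ` blows up. Hence it is proper
(`isProperMap_cylinder`); since `v` is bounded, the moment map is then proper too
(`isProperMap_of_isProperMap_apply`). The cohomology class on `W` is `pr^* A`. -/

noncomputable section

/-! ### Calculus of differential forms in charts -/

section FormCalculus

variable {E : Type*} [NormedAddCommGroup E] [NormedSpace ℝ E]
  {E' : Type*} [NormedAddCommGroup E'] [NormedSpace ℝ E']
  {E'' : Type*} [NormedAddCommGroup E''] [NormedSpace ℝ E'']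
  {H : Type*} [TopologicalSpace H] {H' : Type*} [TopologicalSpace H']
  {H'' : Type*} [TopologicalSpace H'']
  {I : ModelWithCorners ℝ E H} {I' : ModelWithCorners ℝ E' H'}
  {I'' : ModelWithCorners ℝ E'' H''}
  {N : Type*} [TopologicalSpace N] [ChartedSpace H N]
  {N' : Type*} [TopologicalSpace N'] [ChartedSpace H' N']
  {N'' : Type*} [TopologicalSpace N''] [ChartedSpace H'' N'']

theorem tangentMapAt_id (x : N) :
    tangentMapAt I I (fun y : N => y) x = ContinuousLinearMap.id ℝ E :=
  mfderiv_id

theorem tangentMapAt_const (c : N') (x : N) :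
    tangentMapAt I I' (fun _ : N => c) x = 0 :=
  mfderiv_const

theorem Filter.EventuallyEq.tangentMapAt_eq {f g : N → N'} {x : N} (h : f =ᶠ[𝓝 x] g) :
    tangentMapAt I I' f x = tangentMapAt I I' g x :=
  h.mfderiv_eq

/-- The tangent space at `x` is identified with the model space through the preferred chart at `x`
itself, so the inverse of that chart has identity differential at the base point. -/
theorem chartSymmMapAt_self [IsManifold I ∞ N] (x : N) :
    chartSymmMapAt I x (extChartAt I x x) = ContinuousLinearMap.id ℝ E := by
  have h := mfderiv_extChartAt_comp_mfderivWithin_extChartAt_symm (I := I) (x := x)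
    (mem_extChartAt_target x)
  have h2 : mfderiv I 𝓘(ℝ, E) (extChartAt I x) ((extChartAt I x).symm (extChartAt I x x)) =
      ContinuousLinearMap.id ℝ E := by
    rw [extChartAt_to_inv]
    exact mfderiv_extChartAt_self
  ext w
  have h3 := congrArg (fun L : E →L[ℝ] E => L w) h
  have h4 := congrArg (fun L : E →L[ℝ] E => L (chartSymmMapAt I x (extChartAt I x x) w)) h2
  exact h4.symm.trans h3

theorem chartRep_self [IsManifold I ∞ N] {k : ℕ} (α : RawForm E N k) (x : N) :
    chartRep I α x (extChartAt I x x) = α x := by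
  rw [chartRep, chartSymmMapAt_self, extChartAt_to_inv]
  rfl

theorem pullbackForm_id {k : ℕ} (α : RawForm E N k) :
    pullbackForm I I (fun x => x) α = α := by
  funext x
  rw [pullbackForm, tangentMapAt_id]
  rfl

theorem pullbackForm_pullbackForm {f : N → N'} {g : N' → N''} (hg : ContMDiff I' I'' ∞ g)
    (hf : ContMDiff I I' ∞ f) {k : ℕ} (α : RawForm E'' N'' k) :
    pullbackForm I I' f (pullbackForm I' I'' g α) = pullbackForm I I'' (fun x => g (f x)) α := by
  funext x
  simp only [pullbackForm, tangentMapAt_comp hg hf]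
  rfl

theorem Filter.EventuallyEq.pullbackForm_eq {f g : N → N'} {x : N} (h : f =ᶠ[𝓝 x] g)
    {k : ℕ} (α : RawForm E' N' k) :
    pullbackForm I I' f α x = pullbackForm I I' g α x := by
  simp only [pullbackForm, h.tangentMapAt_eq, h.eq_of_nhds]

/-- Chart independence of `d`: `extD` uses a different chart at every point, whereas here one chart
serves its whole target. It follows from naturality under the identity map, whose coordinate
expression is the transition map. This is what makes smoothness of `dα` and `d² = 0` accessible. -/
theorem extDerivWithin_chartRep [IsManifold I ∞ N] {k : ℕ} {α : RawForm E N k}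
    (hα : α ∈ smoothForms I N k) {x₀ : N} {z : E} (hz : z ∈ (extChartAt I x₀).target) :
    chartRep I (extD I α) x₀ z = extDerivWithin (chartRep I α x₀) (range I) z := by
  set y := (extChartAt I x₀).symm z with hy
  have hid : ContMDiff I I ∞ (fun x : N => x) := contMDiff_id
  have hs : (fun x : N => x) ((extChartAt I x₀).symm z) ∈ (extChartAt I y).source :=
    mem_extChartAt_source y
  have h1 := extDerivWithin_chartRep_pullbackForm hid hz hs hα
  have h2 := chartRep_pullbackForm hid hz hs (extD I α)
  rw [pullbackForm_id] at h1 h2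
  have h3 : coordMap I I (fun x : N => x) x₀ y z = extChartAt I y y := rfl
  rw [h1, h2, h3, chartRep_self, extD_eq]

theorem extD_mem_smoothForms [IsManifold I ∞ N] {k : ℕ} {α : RawForm E N k}
    (hα : α ∈ smoothForms I N k) : extD I α ∈ smoothForms I N (k + 1) := by
  intro x₀ z hz
  have hzr : z ∈ range I := extChartAt_target_subset_range x₀ hz
  have ha : ContDiffWithinAt ℝ ∞ (chartRep I α x₀) (range I) z :=
    (hα x₀ _ hz).mono_of_mem_nhdsWithin (extChartAt_target_mem_nhdsWithin_of_mem hz)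
  have h1 : ContDiffWithinAt ℝ ∞ (extDerivWithin (chartRep I α x₀) (range I)) (range I) z :=
    (ContinuousAlternatingMap.alternatizeUncurryFinCLM ℝ E ℝ).contDiff.contDiffAt.comp_contDiffWithinAt
      z (ha.fderivWithin_right I.uniqueDiffOn (by simp) hzr)
  exact (h1.mono (extChartAt_target_subset_range x₀)).congr
    (fun w hw => extDerivWithin_chartRep hα hw) (extDerivWithin_chartRep hα hz)

theorem extD_extD [IsManifold I ∞ N] {k : ℕ} {α : RawForm E N k}
    (hα : α ∈ smoothForms I N k) : extD I (extD I α) = 0 := by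
  funext x
  have hxt := mem_extChartAt_target (I := I) x
  have hzr := extChartAt_target_subset_range x hxt
  have hev : chartRep I (extD I α) x =ᶠ[𝓝[range I] (extChartAt I x x)]
      extDerivWithin (chartRep I α x) (range I) := by
    filter_upwards [extChartAt_target_mem_nhdsWithin_of_mem hxt] with w hw
    exact extDerivWithin_chartRep hα hw
  rw [extD_eq, hev.extDerivWithin_eq_of_mem hzr]
  have ha : ContDiffWithinAt ℝ ∞ (chartRep I α x) (range I) (extChartAt I x x) :=
    (hα x _ hxt).mono_of_mem_nhdsWithin (extChartAt_target_mem_nhdsWithin_of_mem hxt)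
  exact extDerivWithin_extDerivWithin_apply ha
    -- Symmetry of second derivatives at boundary points requires the range of the model to lie in
    -- the closure of its interior.
    (by rw [minSmoothness_of_isRCLikeNormedField]; exact ENat.LEInfty.out)
    I.uniqueDiffOn (I.range_subset_closure_interior hzr) hzr

theorem extD_zero {k : ℕ} : extD I (0 : RawForm E N k) = 0 := by
  simpa using extD_smul (I := I) (0 : ℝ) (0 : RawForm E N k)

theorem extD_sub [IsManifold I ∞ N] {k : ℕ} {α β : RawForm E N k}
    (hα : α ∈ smoothForms I N k) (hβ : β ∈ smoothForms I N k) :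
    extD I (α - β) = extD I α - extD I β := by
  rw [sub_eq_add_neg, sub_eq_add_neg, ← neg_one_smul ℝ β, ← neg_one_smul ℝ (extD I β),
    extD_add hα (Submodule.smul_mem _ _ hβ), extD_smul]

/-- The product of a function and a form. -/
def funSmul (ρ : N → ℝ) {k : ℕ} (α : RawForm E N k) : RawForm E N k := fun x => ρ x • α x

theorem funSmul_mem_smoothForms [IsManifold I ∞ N] {ρ : N → ℝ} (hρ : ContMDiff I 𝓘(ℝ, ℝ) ∞ ρ)
    {k : ℕ} {α : RawForm E N k} (hα : α ∈ smoothForms I N k) :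
    funSmul ρ α ∈ smoothForms I N k := by
  intro x₀
  have h1 : ContDiffOn ℝ ∞ (fun z => ρ ((extChartAt I x₀).symm z)) (extChartAt I x₀).target :=
    contMDiffOn_iff_contDiffOn.1 (hρ.comp_contMDiffOn (contMDiffOn_extChartAt_symm x₀))
  exact h1.smul (hα x₀)

theorem pullbackForm_funSmul (f : N → N') (ρ : N' → ℝ) {k : ℕ} (α : RawForm E' N' k) :
    pullbackForm I I' f (funSmul ρ α) = funSmul (fun x => ρ (f x)) (pullbackForm I I' f α) := rfl

/-- The `1`-form with values the given covectors. -/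
def covectorForm (c : N → E →L[ℝ] ℝ) : RawForm E N 1 :=
  fun x => ContinuousAlternatingMap.ofSubsingleton ℝ E ℝ (0 : Fin 1) (c x)

/-- The differential of a function, as a `1`-form. -/
def differentialForm (I : ModelWithCorners ℝ E H) (f : N → ℝ) : RawForm E N 1 :=
  covectorForm fun x => tangentMapAt I 𝓘(ℝ, ℝ) f x

/-- The form `df` is the pullback under `f` of the constant form `dt` on `ℝ`. -/
theorem differentialForm_mem_smoothForms [IsManifold I ∞ N] {f : N → ℝ}
    (hf : ContMDiff I 𝓘(ℝ, ℝ) ∞ f) : differentialForm I f ∈ smoothForms I N 1 := by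
  have h : (fun _ : ℝ => ContinuousAlternatingMap.ofSubsingleton ℝ ℝ ℝ (0 : Fin 1)
      (ContinuousLinearMap.id ℝ ℝ)) ∈ smoothForms 𝓘(ℝ, ℝ) ℝ 1 := by
    intro x₀
    have : chartRep 𝓘(ℝ, ℝ) (fun _ : ℝ => ContinuousAlternatingMap.ofSubsingleton ℝ ℝ ℝ (0 : Fin 1)
      (ContinuousLinearMap.id ℝ ℝ)) x₀ = fun _ => ContinuousAlternatingMap.ofSubsingleton ℝ ℝ ℝ
        (0 : Fin 1) (ContinuousLinearMap.id ℝ ℝ) := by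
      funext z
      have h1 : chartSymmMapAt 𝓘(ℝ, ℝ) x₀ z = ContinuousLinearMap.id ℝ ℝ :=
        chartSymmMapAt_self (I := 𝓘(ℝ, ℝ)) z
      rw [chartRep, h1]
      rfl
    rw [this]
    exact contDiffOn_const
  exact pullbackForm_mem_smoothForms hf h

theorem pullbackForm_apply (f : N → N') {k : ℕ} (α : RawForm E' N' k) (x : N)
    (w : Fin k → E) :
    pullbackForm I I' f α x w = α (f x) (fun i => tangentMapAt I I' f x (w i)) := rfl

/-- A form is smooth as soon as it agrees with a smooth form near every point. -/
theorem mem_smoothForms_of_locally [IsManifold I ∞ N] {k : ℕ} {α : RawForm E N k}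
    (h : ∀ x, ∃ β ∈ smoothForms I N k, α =ᶠ[𝓝 x] β) : α ∈ smoothForms I N k := by
  intro x₀ z hz
  obtain ⟨β, hβ, hαβ⟩ := h ((extChartAt I x₀).symm z)
  have hc : Tendsto (extChartAt I x₀).symm (𝓝[(extChartAt I x₀).target] z)
      (𝓝 ((extChartAt I x₀).symm z)) := continuousOn_extChartAt_symm x₀ z hz
  refine (hβ x₀ z hz).congr_of_eventuallyEq ?_ ?_
  · filter_upwards [hc.eventually hαβ] with w hw
    simp only [chartRep, hw]
  · simp only [chartRep, hαβ.eq_of_nhds]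

theorem contMDiff_of_contDiffOn_charts [IsManifold I ∞ N] {f : N → E'}
    (h : ∀ x₀, ContDiffOn ℝ ∞ (fun z => f ((extChartAt I x₀).symm z)) (extChartAt I x₀).target) :
    ContMDiff I 𝓘(ℝ, E') ∞ f := by
  intro x
  have h1 : ContMDiffOn 𝓘(ℝ, E) 𝓘(ℝ, E') ∞ (fun z => f ((extChartAt I x).symm z))
      (extChartAt I x).target := contMDiffOn_iff_contDiffOn.2 (h x)
  have h2 := h1.comp (contMDiffOn_extChartAt (x := x) (n := ∞) (I := I)) (fun y hy => by
    exact (extChartAt I x).map_source (by simpa using hy))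
  have h3 := h2.contMDiffAt ((chartAt H x).open_source.mem_nhds (mem_chart_source H x))
  refine h3.congr_of_eventuallyEq ?_
  filter_upwards [extChartAt_source_mem_nhds (I := I) x] with y hy
  simp only [Function.comp_apply, (extChartAt I x).left_inv hy]

/-- Together with `zeroForm_mem_smoothForms`, this allows functions to be averaged as forms of
degree zero. -/
theorem contMDiff_of_zeroForm_mem [IsManifold I ∞ N] {α : RawForm E N 0}
    (hα : α ∈ smoothForms I N 0) (w : Fin 0 → E) :
    ContMDiff I 𝓘(ℝ, ℝ) ∞ (fun x => α x w) := by
  refine contMDiff_of_contDiffOn_charts fun x₀ => ?_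
  have h := (ContinuousAlternatingMap.apply ℝ E ℝ w).contDiff.comp_contDiffOn (hα x₀)
  refine h.congr fun z _ => ?_
  exact congrArg _ (Subsingleton.elim _ _)

theorem zeroForm_mem_smoothForms [IsManifold I ∞ N] {f : N → ℝ}
    (hf : ContMDiff I 𝓘(ℝ, ℝ) ∞ f) :
    (fun x => ContinuousAlternatingMap.constOfIsEmpty ℝ E (Fin 0) (f x)) ∈ smoothForms I N 0 := by
  intro x₀
  have h1 : ContDiffOn ℝ ∞ (fun z => f ((extChartAt I x₀).symm z)) (extChartAt I x₀).target :=
    contMDiffOn_iff_contDiffOn.1 (hf.comp_contMDiffOn (contMDiffOn_extChartAt_symm x₀))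
  exact (ContinuousAlternatingMap.constOfIsEmptyLIE ℝ E ℝ (Fin 0)).contDiff.comp_contDiffOn h1

end FormCalculus

/-! ### Restricting forms on a product to slices -/

section Slices

variable {E : Type*} [NormedAddCommGroup E] [NormedSpace ℝ E]
  {E' : Type*} [NormedAddCommGroup E'] [NormedSpace ℝ E']
  {H : Type*} [TopologicalSpace H] {H' : Type*} [TopologicalSpace H']
  {I : ModelWithCorners ℝ E H} {J : ModelWithCorners ℝ E' H'}
  {N : Type*} [TopologicalSpace N] [ChartedSpace H N] [IsManifold I ∞ N]
  {K : Type*} [TopologicalSpace K] [ChartedSpace H' K] [IsManifold J ∞ K]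

/-- In product charts, inclusion of a slice is `w ↦ (const, w)`, with derivative `inr`. The
coordinate expression of the slice therefore depends smoothly on the parameter `g` as soon as `B` is
smooth. -/
theorem chartRep_slice_right {k : ℕ} (B : RawForm (E' × E) (K × N) k) {g₀ g : K} {x₀ : N}
    (hg : g ∈ (extChartAt J g₀).source) {z : E} (hz : z ∈ (extChartAt I x₀).target) :
    chartRep I (pullbackForm I (J.prod I) (fun x : N => (g, x)) B) x₀ z =
      (chartRep (J.prod I) B (g₀, x₀) (extChartAt J g₀ g, z)).compContinuousLinearMap
        (ContinuousLinearMap.inr ℝ E' E) := by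
  have hf : ContMDiff I (J.prod I) ∞ (fun x : N => (g, x)) := contMDiff_const.prodMk contMDiff_id
  have hs : ((g, (extChartAt I x₀).symm z) : K × N) ∈ (extChartAt (J.prod I) (g₀, x₀)).source := by
    rw [extChartAt_prod]
    exact ⟨hg, (extChartAt I x₀).map_target hz⟩
  have hc : ∀ w ∈ (extChartAt I x₀).target,
      coordMap I (J.prod I) (fun x : N => (g, x)) x₀ (g₀, x₀) w = (extChartAt J g₀ g, w) := by
    intro w hw
    rw [coordMap, extChartAt_prod]
    exact Prod.ext rfl ((extChartAt I x₀).right_inv hw)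
  have hev : coordMap I (J.prod I) (fun x : N => (g, x)) x₀ (g₀, x₀) =ᶠ[𝓝[range I] z]
      fun w => (extChartAt J g₀ g, w) := by
    filter_upwards [extChartAt_target_mem_nhdsWithin_of_mem hz] with w hw using hc w hw
  have hd : fderivWithin ℝ (coordMap I (J.prod I) (fun x : N => (g, x)) x₀ (g₀, x₀)) (range I) z =
      ContinuousLinearMap.inr ℝ E' E := by
    rw [hev.fderivWithin_eq (hc z hz)]
    exact (hasFDerivAt_prodMk_right _ _).hasFDerivWithinAt.fderivWithin
      (I.uniqueDiffOn _ (extChartAt_target_subset_range x₀ hz))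
  rw [chartRep_pullbackForm hf hz hs, hd, hc z hz]

theorem chartRep_slice_left {k : ℕ} (B : RawForm (E' × E) (K × N) k) {g₀ : K} {x x₀ : N}
    (hx : x ∈ (extChartAt I x₀).source) {γ : E'} (hγ : γ ∈ (extChartAt J g₀).target) :
    chartRep J (pullbackForm J (J.prod I) (fun g : K => (g, x)) B) g₀ γ =
      (chartRep (J.prod I) B (g₀, x₀) (γ, extChartAt I x₀ x)).compContinuousLinearMap
        (ContinuousLinearMap.inl ℝ E' E) := by
  have hf : ContMDiff J (J.prod I) ∞ (fun g : K => (g, x)) := contMDiff_id.prodMk contMDiff_const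
  have hs : (((extChartAt J g₀).symm γ, x) : K × N) ∈ (extChartAt (J.prod I) (g₀, x₀)).source := by
    rw [extChartAt_prod]
    exact ⟨(extChartAt J g₀).map_target hγ, hx⟩
  have hc : ∀ w ∈ (extChartAt J g₀).target,
      coordMap J (J.prod I) (fun g : K => (g, x)) g₀ (g₀, x₀) w = (w, extChartAt I x₀ x) := by
    intro w hw
    rw [coordMap, extChartAt_prod]
    exact Prod.ext ((extChartAt J g₀).right_inv hw) rfl
  have hev : coordMap J (J.prod I) (fun g : K => (g, x)) g₀ (g₀, x₀) =ᶠ[𝓝[range J] γ]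
      fun w => (w, extChartAt I x₀ x) := by
    filter_upwards [extChartAt_target_mem_nhdsWithin_of_mem hγ] with w hw using hc w hw
  have hd : fderivWithin ℝ (coordMap J (J.prod I) (fun g : K => (g, x)) g₀ (g₀, x₀)) (range J) γ =
      ContinuousLinearMap.inl ℝ E' E := by
    rw [hev.fderivWithin_eq (hc γ hγ)]
    exact (hasFDerivAt_prodMk_left _ _).hasFDerivWithinAt.fderivWithin
      (J.uniqueDiffOn _ (extChartAt_target_subset_range g₀ hγ))
  rw [chartRep_pullbackForm hf hγ hs, hd, hc γ hγ]

end Slices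

/-! ### The action map, fundamental fields and invariant forms -/

section Action

variable {𝔤 : Type*} [NormedAddCommGroup 𝔤] [NormedSpace ℝ 𝔤]
  {G : Type*} [TopologicalSpace G] [ChartedSpace 𝔤 G] [Group G]
  {E : Type*} [NormedAddCommGroup E] [NormedSpace ℝ E]
  {H : Type*} [TopologicalSpace H] {I : ModelWithCorners ℝ E H}
  {N : Type*} [TopologicalSpace N] [ChartedSpace H N] [MulAction G N]
  [ContMDiffSMul 𝓘(ℝ, 𝔤) I ∞ G N]

variable (𝔤 G I) in
/-- The pullback of a form on `N` under the action map `G × N → N`. -/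
def actionPullback {k : ℕ} (α : RawForm E N k) : RawForm (𝔤 × E) (G × N) k :=
  pullbackForm (𝓘(ℝ, 𝔤).prod I) I (fun p : G × N => p.1 • p.2) α

theorem contMDiff_action : ContMDiff (𝓘(ℝ, 𝔤).prod I) I ∞ (fun p : G × N => p.1 • p.2) :=
  contMDiff_smul

/-- Invariant forms. -/
def IsInvariantForm (G : Type*) [Group G] [MulAction G N] (I : ModelWithCorners ℝ E H) {k : ℕ}
    (α : RawForm E N k) : Prop :=
  ∀ g : G, pullbackForm I I (fun x : N => g • x) α = α

theorem pullbackForm_actionPullback_right [IsManifold 𝓘(ℝ, 𝔤) ∞ G] [IsManifold I ∞ N]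
    {k : ℕ} (α : RawForm E N k) (g : G) :
    pullbackForm I (𝓘(ℝ, 𝔤).prod I) (fun x : N => (g, x)) (actionPullback 𝔤 G I α) =
      pullbackForm I I (fun x : N => g • x) α :=
  pullbackForm_pullbackForm contMDiff_action (contMDiff_const.prodMk contMDiff_id) α

theorem pullbackForm_actionPullback_left [IsManifold 𝓘(ℝ, 𝔤) ∞ G] [IsManifold I ∞ N]
    {k : ℕ} (α : RawForm E N k) (x : N) :
    pullbackForm 𝓘(ℝ, 𝔤) (𝓘(ℝ, 𝔤).prod I) (fun g : G => (g, x)) (actionPullback 𝔤 G I α) =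
      pullbackForm 𝓘(ℝ, 𝔤) I (fun g : G => g • x) α :=
  pullbackForm_pullbackForm contMDiff_action (contMDiff_id.prodMk contMDiff_const) α

/-- Differentiate `(g h g⁻¹) • (g • x) = g • (h • x)` in `h` at `h = 1`. -/
theorem tangentMapAt_smul_fundamentalField [LieGroup 𝓘(ℝ, 𝔤) ∞ G]
    (g : G) (X : 𝔤) (x : N) :
    tangentMapAt I I (fun y : N => g • y) x (fundamentalField G I X x) =
      fundamentalField G I (adjointMap 𝔤 g X) (g • x) := by
  have hg : ContMDiff I I ∞ (fun y : N => g • y) := contMDiff_smulMap 𝔤 g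
  have hc : ContMDiff 𝓘(ℝ, 𝔤) 𝓘(ℝ, 𝔤) ∞ (fun h : G => g * h * g⁻¹) :=
    (contMDiff_const.mul contMDiff_id).mul contMDiff_const
  have h1 := tangentMapAt_comp hg (contMDiff_orbitMap (𝔤 := 𝔤) (G := G) (I := I) x) 1
  have h2 := tangentMapAt_comp (contMDiff_orbitMap (𝔤 := 𝔤) (G := G) (I := I) (g • x)) hc 1
  have h3 : (fun h : G => (g * h * g⁻¹) • g • x) = fun h => g • h • x := by
    funext h
    rw [smul_smul, smul_smul, inv_mul_cancel_right]
  rw [h3, h1] at h2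
  have h4 := congrArg (fun L : 𝔤 →L[ℝ] E => L X) h2
  simp only [one_smul, mul_one, mul_inv_cancel] at h4
  exact h4

variable [IsManifold 𝓘(ℝ, 𝔤) ∞ G] [IsManifold I ∞ N]

variable (𝔤 G I) in
/-- The contraction of a `1`-form with the fundamental vector fields, as a covector on `𝔤`. -/
def contractFundamental (β : RawForm E N 1) (x : N) : 𝔤 →L[ℝ] ℝ :=
  (ContinuousAlternatingMap.ofSubsingleton ℝ 𝔤 ℝ (0 : Fin 1)).symm
    ((β x).compContinuousLinearMap (tangentMapAt 𝓘(ℝ, 𝔤) I (fun g : G => g • x) 1))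

theorem contractFundamental_apply (β : RawForm E N 1) (x : N) (X : 𝔤) :
    contractFundamental 𝔤 G I β x X = β x ![fundamentalField G I X x] := by
  change β x (fun _ => _) = _
  congr 1
  funext i
  fin_cases i
  rfl

/-- The `G`-component at `g = 1` of the pullback under the action map is the contraction with
fundamental fields. Its companion `chartRep_actionPullback_inr` identifies the `N`-component at `g`
with the pullback by `g`. Smoothness of the pullback on `G × N` thus controls both. -/
theorem chartRep_actionPullback_inl (α : RawForm E N 1) {x x₀ : N}
    (hx : x ∈ (extChartAt I x₀).source) :
    (chartRep (𝓘(ℝ, 𝔤).prod I) (actionPullback 𝔤 G I α) (1, x₀)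
      (extChartAt 𝓘(ℝ, 𝔤) (1 : G) 1, extChartAt I x₀ x)).compContinuousLinearMap
        (ContinuousLinearMap.inl ℝ 𝔤 E) =
      ContinuousAlternatingMap.ofSubsingleton ℝ 𝔤 ℝ (0 : Fin 1)
        (contractFundamental 𝔤 G I α x) := by
  rw [← chartRep_slice_left (actionPullback 𝔤 G I α) hx (mem_extChartAt_target (1 : G)),
    pullbackForm_actionPullback_left, chartRep_self, contractFundamental, Equiv.apply_symm_apply,
    pullbackForm, one_smul]

theorem chartRep_actionPullback_inr {k : ℕ} {α : RawForm E N k} {x₀ : N}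
    {g₀ g : G} (hg : g ∈ (extChartAt 𝓘(ℝ, 𝔤) g₀).source) {z : E}
    (hz : z ∈ (extChartAt I x₀).target) :
    (chartRep (𝓘(ℝ, 𝔤).prod I) (actionPullback 𝔤 G I α) (g₀, x₀)
      (extChartAt 𝓘(ℝ, 𝔤) g₀ g, z)).compContinuousLinearMap (ContinuousLinearMap.inr ℝ 𝔤 E) =
      chartRep I (pullbackForm I I (fun x : N => g • x) α) x₀ z := by
  rw [← chartRep_slice_right (actionPullback 𝔤 G I α) hg hz, pullbackForm_actionPullback_right]

theorem actionPullback_mem_smoothForms {k : ℕ} {α : RawForm E N k} (hα : α ∈ smoothForms I N k) :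
    actionPullback 𝔤 G I α ∈ smoothForms (𝓘(ℝ, 𝔤).prod I) (G × N) k :=
  pullbackForm_mem_smoothForms contMDiff_action hα

theorem contMDiff_contractFundamental {β : RawForm E N 1} (hβ : β ∈ smoothForms I N 1) :
    ContMDiff I 𝓘(ℝ, 𝔤 →L[ℝ] ℝ) ∞ (contractFundamental 𝔤 G I β) := by
  refine contMDiff_of_contDiffOn_charts fun x₀ => ?_
  have h1 := actionPullback_mem_smoothForms (𝔤 := 𝔤) (G := G) hβ (1, x₀)
  have h2 : ContDiffOn ℝ ∞ (fun z : E => ((extChartAt 𝓘(ℝ, 𝔤) (1 : G) 1, z) : 𝔤 × E))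
      (extChartAt I x₀).target := contDiffOn_const.prodMk contDiffOn_id
  have h3 := h1.comp h2 (fun z hz => by
    rw [extChartAt_prod]
    exact ⟨mem_extChartAt_target _, hz⟩)
  have h4 := (contDiff_compCLM (E := 𝔤) (E' := 𝔤 × E) 1).comp_contDiffOn
    (h3.prodMk (contDiffOn_const (c := ContinuousLinearMap.inl ℝ 𝔤 E)))
  have h5 := (ContinuousAlternatingMap.ofSubsingletonLIE (𝕜 := ℝ) (E := 𝔤) (F := ℝ) (0 : Fin 1)).symm.contDiff.comp_contDiffOn h4
  refine h5.congr fun z hz => ?_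
  have h6 := chartRep_actionPullback_inl (𝔤 := 𝔤) (G := G) β ((extChartAt I x₀).map_target hz)
  rw [(extChartAt I x₀).right_inv hz] at h6
  simp only [Function.comp_apply, h6]
  exact ((ContinuousAlternatingMap.ofSubsingletonLIE (𝕜 := ℝ) (E := 𝔤) (F := ℝ) (0 : Fin 1)).symm_apply_apply _).symm

theorem tangentMapAt_action_inr (x : N) (w : E) :
    tangentMapAt (𝓘(ℝ, 𝔤).prod I) I (fun p : G × N => p.1 • p.2) (1, x) (0, w) = w := by
  have h := tangentMapAt_comp (contMDiff_action (𝔤 := 𝔤) (G := G) (I := I) (N := N))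
    (show ContMDiff I (𝓘(ℝ, 𝔤).prod I) ∞ fun x : N => ((1 : G), x) from
      contMDiff_const.prodMk contMDiff_id) x
  have h2 : tangentMapAt I (𝓘(ℝ, 𝔤).prod I) (fun x : N => ((1 : G), x)) x =
      ContinuousLinearMap.inr ℝ 𝔤 E := mfderiv_prod_right
  have h3 : (fun x : N => (1 : G) • x) = fun x => x := funext fun x => one_smul G x
  rw [h2] at h
  have h4 := congrArg (fun L : E →L[ℝ] E => L w) h
  simp only [h3, tangentMapAt_id] at h4
  exact h4.symm

theorem tangentMapAt_action_inl (x : N) (X : 𝔤) :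
    tangentMapAt (𝓘(ℝ, 𝔤).prod I) I (fun p : G × N => p.1 • p.2) (1, x) (X, 0) =
      fundamentalField G I X x := by
  have h := tangentMapAt_comp (contMDiff_action (𝔤 := 𝔤) (G := G) (I := I) (N := N))
    (show ContMDiff 𝓘(ℝ, 𝔤) (𝓘(ℝ, 𝔤).prod I) ∞ fun g : G => (g, x) from
      contMDiff_id.prodMk contMDiff_const) 1
  have h2 : tangentMapAt 𝓘(ℝ, 𝔤) (𝓘(ℝ, 𝔤).prod I) (fun g : G => (g, x)) 1 =
      ContinuousLinearMap.inl ℝ 𝔤 E := mfderiv_prod_left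
  rw [h2] at h
  exact (congrArg (fun L : 𝔤 →L[ℝ] E => L X) h).symm

/-- The Lie derivative of an invariant `1`-form along a fundamental vector field vanishes. -/
theorem tangentMapAt_contractFundamental {β : RawForm E N 1} (hβ : β ∈ smoothForms I N 1)
    (hinv : IsInvariantForm G I β) (X : 𝔤) (x : N) (w : E) :
    tangentMapAt I 𝓘(ℝ, ℝ) (fun y => contractFundamental 𝔤 G I β y X) x w =
      - extD I β x ![fundamentalField G I X x, w] := by
  -- No flow is needed: the identity comes from evaluating `d` of the pullback of `β` to `G × N` at
  -- `(1, x)` on the pair `(X, 0), (0, w)` in two ways.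
  set B := actionPullback 𝔤 G I β with hB
  have hBs : B ∈ smoothForms (𝓘(ℝ, 𝔤).prod I) (G × N) 1 := actionPullback_mem_smoothForms hβ
  set p : G × N := (1, x) with hp
  set γ₀ := extChartAt 𝓘(ℝ, 𝔤) (1 : G) 1 with hγ₀
  set z₀ := extChartAt I x x with hz₀
  have hp0 : extChartAt (𝓘(ℝ, 𝔤).prod I) p p = (γ₀, z₀) := by rw [extChartAt_prod]; rfl
  have hr : range (𝓘(ℝ, 𝔤).prod I) = univ ×ˢ range I := by
    rw [modelWithCorners_prod_coe, range_prodMap]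
    simp
  have hzr : z₀ ∈ range I := mem_range_self _
  have hdiff := differentiableWithinAt_chartRep hBs p
  rw [hp0] at hdiff
  have hD := hdiff.hasFDerivWithinAt
  set D := fderivWithin ℝ (chartRep (𝓘(ℝ, 𝔤).prod I) B p) (range (𝓘(ℝ, 𝔤).prod I)) (γ₀, z₀)
  have e1 : extD (𝓘(ℝ, 𝔤).prod I) B p ![(X, 0), (0, w)] =
      extD I β x ![fundamentalField G I X x, w] := by
    rw [hB, actionPullback, extD_pullbackForm contMDiff_action hβ, pullbackForm_apply]
    simp only [hp, one_smul]
    congr 1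
    funext i
    fin_cases i
    · exact tangentMapAt_action_inl x X
    · exact tangentMapAt_action_inr x w
  -- The coordinate formula `dB(a, b) = (∂_a B)(b) - (∂_b B)(a)` for constant vectors `a`, `b`.
  have e2 : extD (𝓘(ℝ, 𝔤).prod I) B p ![(X, 0), (0, w)] =
      D (X, 0) ![(0, w)] - D (0, w) ![(X, 0)] := by
    rw [extD_eq, hp0, extDerivWithin, ContinuousAlternatingMap.alternatizeUncurryFin_apply,
      Fin.sum_univ_two]
    simp only [Fin.val_zero, pow_zero, one_smul, Fin.val_one, pow_one, neg_smul,
      Matrix.cons_val_zero, Matrix.cons_val_one, sub_eq_add_neg]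
    congr 2
    congr 1
    funext i
    fin_cases i
    rfl
  -- Invariance says that the `N`-component of `B` is `β` for every `g`, hence constant in the group
  -- direction.
  have e3 : D (X, 0) ![(0, w)] = 0 := by
    have h1 : HasFDerivAt (fun γ : 𝔤 => chartRep (𝓘(ℝ, 𝔤).prod I) B p (γ, z₀))
        (D.comp (ContinuousLinearMap.inl ℝ 𝔤 E)) γ₀ := by
      rw [← hasFDerivWithinAt_univ]
      have h0 : HasFDerivWithinAt (fun γ : 𝔤 => (γ, z₀)) (ContinuousLinearMap.inl ℝ 𝔤 E) univ γ₀ :=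
        (hasFDerivAt_prodMk_left γ₀ z₀).hasFDerivWithinAt
      refine hD.comp γ₀ h0 (fun γ _ => ?_)
      rw [hr]
      exact ⟨mem_univ _, hzr⟩
    have h2 : HasFDerivAt (fun γ : 𝔤 => chartRep (𝓘(ℝ, 𝔤).prod I) B p (γ, z₀) ![(0, w)])
        ((ContinuousAlternatingMap.apply ℝ (𝔤 × E) ℝ ![(0, w)]).comp
          (D.comp (ContinuousLinearMap.inl ℝ 𝔤 E))) γ₀ :=
      (ContinuousAlternatingMap.apply ℝ (𝔤 × E) ℝ ![(0, w)]).hasFDerivAt.comp γ₀ h1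
    have h3 : (fun γ : 𝔤 => chartRep (𝓘(ℝ, 𝔤).prod I) B p (γ, z₀) ![(0, w)]) =ᶠ[𝓝 γ₀]
        fun _ => chartRep I β x z₀ ![w] := by
      filter_upwards [extChartAt_target_mem_nhds (I := 𝓘(ℝ, 𝔤)) (1 : G)] with γ hγ
      have h4 := chartRep_actionPullback_inr (α := β) (x₀ := x)
        ((extChartAt 𝓘(ℝ, 𝔤) (1 : G)).map_target hγ) (mem_extChartAt_target (I := I) x)
      rw [(extChartAt 𝓘(ℝ, 𝔤) (1 : G)).right_inv hγ, hinv] at h4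
      rw [← h4]
      change _ = chartRep (𝓘(ℝ, 𝔤).prod I) B p (γ, z₀) _
      congr 1
      funext i; fin_cases i; rfl
    have h5 := (h2.congr_of_eventuallyEq h3.symm).unique (hasFDerivAt_const _ _)
    exact congrArg (fun L : 𝔤 →L[ℝ] ℝ => L X) h5
  -- The `G`-component of `B` at `g = 1` is the contraction of `β` with `X♯`, so its derivative in
  -- the direction `w` is the left-hand side of the claim.
  have e4 : D (0, w) ![(X, 0)] =
      tangentMapAt I 𝓘(ℝ, ℝ) (fun y => contractFundamental 𝔤 G I β y X) x w := by
    have h1 : HasFDerivWithinAt (fun z : E => chartRep (𝓘(ℝ, 𝔤).prod I) B p (γ₀, z))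
        (D.comp (ContinuousLinearMap.inr ℝ 𝔤 E)) (range I) z₀ := by
      have h0 : HasFDerivWithinAt (fun z : E => (γ₀, z)) (ContinuousLinearMap.inr ℝ 𝔤 E)
          (range I) z₀ := (hasFDerivAt_prodMk_right γ₀ z₀).hasFDerivWithinAt
      refine hD.comp z₀ h0 (fun z hz => ?_)
      rw [hr]
      exact ⟨mem_univ _, hz⟩
    have h2 : HasFDerivWithinAt (fun z : E => chartRep (𝓘(ℝ, 𝔤).prod I) B p (γ₀, z) ![(X, 0)])
        ((ContinuousAlternatingMap.apply ℝ (𝔤 × E) ℝ ![(X, 0)]).comp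
          (D.comp (ContinuousLinearMap.inr ℝ 𝔤 E))) (range I) z₀ :=
      (ContinuousAlternatingMap.apply ℝ (𝔤 × E) ℝ ![(X, 0)]).hasFDerivAt.comp_hasFDerivWithinAt z₀ h1
    have hval : ∀ z ∈ (extChartAt I x).target,
        contractFundamental 𝔤 G I β ((extChartAt I x).symm z) X =
          chartRep (𝓘(ℝ, 𝔤).prod I) B p (γ₀, z) ![(X, 0)] := by
      intro z hz
      have h4 := chartRep_actionPullback_inl (𝔤 := 𝔤) (G := G) β ((extChartAt I x).map_target hz)
      rw [(extChartAt I x).right_inv hz] at h4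
      have h5 := congrArg (fun L : 𝔤 [⋀^Fin 1]→L[ℝ] ℝ => L ![X]) h4
      refine h5.symm.trans ?_
      change chartRep (𝓘(ℝ, 𝔤).prod I) B p (γ₀, z) _ = _
      congr 1
      funext i; fin_cases i; rfl
    have h3 : HasFDerivWithinAt
        (fun z : E => contractFundamental 𝔤 G I β ((extChartAt I x).symm z) X)
        ((ContinuousAlternatingMap.apply ℝ (𝔤 × E) ℝ ![(X, 0)]).comp
          (D.comp (ContinuousLinearMap.inr ℝ 𝔤 E))) (range I) z₀ := by
      refine h2.congr_of_eventuallyEq ?_ (hval z₀ (mem_extChartAt_target x))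
      filter_upwards [extChartAt_target_mem_nhdsWithin_of_mem (mem_extChartAt_target (I := I) x)]
        with z hz using hval z hz
    have hsm : ContMDiff I 𝓘(ℝ, ℝ) ∞ (fun y => contractFundamental 𝔤 G I β y X) :=
      (contMDiff_contractFundamental hβ).clm_apply contMDiff_const
    rw [tangentMapAt_eq_fderivWithin hsm]
    have h4 := h3.fderivWithin (I.uniqueDiffOn _ hzr)
    exact (congrArg (fun L : E →L[ℝ] ℝ => L w) h4).symm
  rw [← e1, e2, e3, e4]
  ring

end Action

/-! ### Changing a Hamiltonian structure by an equivariantly exact form -/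

section Twist

variable {𝔤 : Type*} [NormedAddCommGroup 𝔤] [NormedSpace ℝ 𝔤]
  {G : Type*} [TopologicalSpace G] [ChartedSpace 𝔤 G] [Group G] [LieGroup 𝓘(ℝ, 𝔤) ∞ G]
  {E : Type*} [NormedAddCommGroup E] [NormedSpace ℝ E]
  {H : Type*} [TopologicalSpace H] {I : ModelWithCorners ℝ E H}
  {N : Type*} [TopologicalSpace N] [ChartedSpace H N] [MulAction G N]
  [ContMDiffSMul 𝓘(ℝ, 𝔤) I ∞ G N] [IsManifold I ∞ N]

theorem adjointMap_adjointMap_inv (g : G) (X : 𝔤) :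
    adjointMap 𝔤 g (adjointMap 𝔤 g⁻¹ X) = X := by
  have hc : ∀ g : G, ContMDiff 𝓘(ℝ, 𝔤) 𝓘(ℝ, 𝔤) ∞ (fun h : G => g * h * g⁻¹) := fun g =>
    (contMDiff_const.mul contMDiff_id).mul contMDiff_const
  have h := tangentMapAt_comp (hc g) (hc g⁻¹) 1
  have h1 : (fun h : G => g * (g⁻¹ * h * g⁻¹⁻¹) * g⁻¹) = fun h => h := by
    funext h
    group
  rw [h1, tangentMapAt_id] at h
  have h2 := congrArg (fun L : 𝔤 →L[ℝ] 𝔤 => L X) h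
  simp only [mul_one, mul_inv_cancel] at h2
  exact h2.symm

/-- Translation by `g` carries the fundamental field of `Ad_{g⁻¹} X` to that of `X`; invariance of
`β` absorbs the translation. -/
theorem IsInvariantForm.contractFundamental_smul {β : RawForm E N 1} (hβ : IsInvariantForm G I β)
    (g : G) (x : N) :
    contractFundamental 𝔤 G I β (g • x) =
      (contractFundamental 𝔤 G I β x).comp (adjointMap 𝔤 g⁻¹) := by
  ext X
  have h := congrArg (fun α : RawForm E N 1 =>
    α x ![fundamentalField G I (adjointMap 𝔤 g⁻¹ X) x]) (hβ g)
  rw [ContinuousLinearMap.comp_apply, contractFundamental_apply, contractFundamental_apply, ← h]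
  simp only [pullbackForm_apply]
  congr 1
  funext i
  fin_cases i
  change _ = tangentMapAt I I _ x (fundamentalField G I (adjointMap 𝔤 g⁻¹ X) x)
  rw [tangentMapAt_smul_fundamentalField, adjointMap_adjointMap_inv]
  rfl

/-- The Hamiltonian structure obtained by subtracting the equivariantly exact form `d_G β` of an
invariant `1`-form `β`. -/
def HamiltonianStructure.twist (h : HamiltonianStructure 𝔤 G I N) (β : RawForm E N 1)
    (hβ : β ∈ smoothForms I N 1) (hinv : IsInvariantForm G I β) :
    HamiltonianStructure 𝔤 G I N where
  form := h.form - extD I β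
  moment := fun x => h.moment x + contractFundamental 𝔤 G I β x
  form_smooth := Submodule.sub_mem _ h.form_smooth (extD_mem_smoothForms hβ)
  form_closed := by
    rw [extD_sub h.form_smooth (extD_mem_smoothForms hβ), h.form_closed, extD_extD hβ, sub_zero]
  form_invariant g := by
    change pullbackForm I I _ h.form - pullbackForm I I _ (extD I β) = _
    rw [h.form_invariant, ← extD_pullbackForm (contMDiff_smulMap 𝔤 g) hβ, hinv g]
  moment_smooth := h.moment_smooth.add (contMDiff_contractFundamental hβ)
  moment_equivariant g x := by
    rw [h.moment_equivariant, hinv.contractFundamental_smul, ContinuousLinearMap.add_comp]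
  -- The new term satisfies `d(β(X♯)) = -ι(X♯) dβ`, matching the summand `-dβ` of the new `2`-form.
  hamilton X x w := by
    have h1 : ContMDiff I 𝓘(ℝ, ℝ) ∞ (fun y => h.moment y X) :=
      h.moment_smooth.clm_apply contMDiff_const
    have h2 : ContMDiff I 𝓘(ℝ, ℝ) ∞ (fun y => contractFundamental 𝔤 G I β y X) :=
      (contMDiff_contractFundamental hβ).clm_apply contMDiff_const
    have h3 : tangentMapAt I 𝓘(ℝ, ℝ)
        (fun y => h.moment y X + contractFundamental 𝔤 G I β y X) x =
        tangentMapAt I 𝓘(ℝ, ℝ) (fun y => h.moment y X) x +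
        tangentMapAt I 𝓘(ℝ, ℝ) (fun y => contractFundamental 𝔤 G I β y X) x :=
      mfderiv_add (h1.mdifferentiable (by simp) x) (h2.mdifferentiable (by simp) x)
    change tangentMapAt I 𝓘(ℝ, ℝ)
        (fun y => h.moment y X + contractFundamental 𝔤 G I β y X) x w = _
    rw [h3, add_apply, h.hamilton, tangentMapAt_contractFundamental hβ hinv,
      ← sub_eq_add_neg]
    rfl

end Twist

/-! ### Integrals of smooth families over a compact manifold -/

section ParametricIntegral

universe u

variable {𝔤 : Type*} [NormedAddCommGroup 𝔤] [NormedSpace ℝ 𝔤]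
  {K : Type*} [TopologicalSpace K] [ChartedSpace 𝔤 K]
  {E V : Type u} [NormedAddCommGroup E] [NormedSpace ℝ E] [NormedAddCommGroup V] [NormedSpace ℝ V]

variable (𝔤) in
/-- A family `F g : E → V` of functions on `S ⊆ E`, parametrized by a manifold, that is jointly
smooth in `(g, z)`. -/
def IsSmoothFamilyOn (F : K → E → V) (S : Set E) : Prop :=
  ∀ g₀ : K, ContDiffOn ℝ ∞ (fun p : 𝔤 × E => F ((extChartAt 𝓘(ℝ, 𝔤) g₀).symm p.1) p.2)
    ((extChartAt 𝓘(ℝ, 𝔤) g₀).target ×ˢ S)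

variable {F : K → E → V} {S : Set E}

theorem IsSmoothFamilyOn.continuousAt (hF : IsSmoothFamilyOn 𝔤 F S) (hS : IsOpen S) {g : K} {z : E}
    (hz : z ∈ S) : ContinuousAt (fun p : K × E => F p.1 p.2) (g, z) := by
  have h1 : ContinuousAt (fun p : 𝔤 × E => F ((extChartAt 𝓘(ℝ, 𝔤) g).symm p.1) p.2)
      (extChartAt 𝓘(ℝ, 𝔤) g g, z) :=
    (hF g).continuousOn.continuousAt
      (((isOpen_extChartAt_target g).prod hS).mem_nhds ⟨mem_extChartAt_target g, hz⟩)
  have h2 : ContinuousAt (fun p : K × E => ((extChartAt 𝓘(ℝ, 𝔤) g p.1, p.2) : 𝔤 × E)) (g, z) :=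
    ((continuousAt_extChartAt (I := 𝓘(ℝ, 𝔤)) g).comp continuousAt_fst).prodMk continuousAt_snd
  refine (ContinuousAt.comp (x := (g, z)) (f := fun p : K × E =>
    ((extChartAt 𝓘(ℝ, 𝔤) g p.1, p.2) : 𝔤 × E)) h1 h2).congr ?_
  have h3 : ∀ᶠ p : K × E in 𝓝 (g, z), p.1 ∈ (extChartAt 𝓘(ℝ, 𝔤) g).source :=
    continuousAt_fst.eventually (extChartAt_source_mem_nhds (I := 𝓘(ℝ, 𝔤)) g)
  filter_upwards [h3] with p hp
  simp only [Function.comp_apply, (extChartAt 𝓘(ℝ, 𝔤) g).left_inv hp]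

theorem IsSmoothFamilyOn.continuous (hF : IsSmoothFamilyOn 𝔤 F S) (hS : IsOpen S) {z : E}
    (hz : z ∈ S) : Continuous (fun g => F g z) :=
  continuous_iff_continuousAt.2 fun g =>
    ContinuousAt.comp (x := g) (f := fun g : K => (g, z)) (hF.continuousAt hS hz)
      (continuousAt_id.prodMk continuousAt_const)

theorem IsSmoothFamilyOn.differentiableAt (hF : IsSmoothFamilyOn 𝔤 F S) (hS : IsOpen S) (g : K)
    {z : E} (hz : z ∈ S) : DifferentiableAt ℝ (F g) z := by
  have h1 := ((hF g).contDiffAt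
      (((isOpen_extChartAt_target (I := 𝓘(ℝ, 𝔤)) g).prod hS).mem_nhds
        (show ((extChartAt 𝓘(ℝ, 𝔤) g g, z) : 𝔤 × E) ∈ _ from
          ⟨mem_extChartAt_target g, hz⟩))).differentiableAt (by simp)
  have h2 := h1.comp z (hasFDerivAt_prodMk_right (𝕜 := ℝ) (extChartAt 𝓘(ℝ, 𝔤) g g) z).differentiableAt
  simpa [Function.comp_def] using h2

/-- The derivative in `z` alone is the total derivative in `(γ, z)` composed with `inr`, so joint
smoothness persists and differentiation can be iterated. -/
theorem IsSmoothFamilyOn.fderiv (hF : IsSmoothFamilyOn 𝔤 F S) (hS : IsOpen S) :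
    IsSmoothFamilyOn 𝔤 (fun g => fderiv ℝ (F g)) S := by
  intro g₀
  have ho := (isOpen_extChartAt_target (I := 𝓘(ℝ, 𝔤)) g₀).prod hS
  have h1 := (hF g₀).fderiv_of_isOpen ho (m := ∞) (by simp)
  have h2 : ContDiffOn ℝ ∞ (fun p : 𝔤 × E =>
      (_root_.fderiv ℝ (fun p : 𝔤 × E => F ((extChartAt 𝓘(ℝ, 𝔤) g₀).symm p.1) p.2) p).comp
        (ContinuousLinearMap.inr ℝ 𝔤 E)) ((extChartAt 𝓘(ℝ, 𝔤) g₀).target ×ˢ S) :=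
    h1.clm_comp contDiffOn_const
  refine h2.congr fun p hp => ?_
  have h3 := (((hF g₀).contDiffAt (ho.mem_nhds hp)).differentiableAt (by simp)).hasFDerivAt
  have h4 := h3.comp p.2 (hasFDerivAt_prodMk_right (𝕜 := ℝ) p.1 p.2)
  exact h4.fderiv

variable [CompactSpace K] [MeasurableSpace K] [BorelSpace K] [SecondCountableTopology K]
  (μ : MeasureTheory.Measure K) [MeasureTheory.IsFiniteMeasure μ]

theorem integrable_of_continuous {W : Type*} [NormedAddCommGroup W] {f : K → W}
    (hf : Continuous f) : MeasureTheory.Integrable f μ :=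
  hf.integrable_of_hasCompactSupport (HasCompactSupport.of_compactSpace f)

theorem IsSmoothFamilyOn.hasFDerivAt_integral (hF : IsSmoothFamilyOn 𝔤 F S) (hS : IsOpen S) {z : E}
    (hz : z ∈ S) :
    HasFDerivAt (fun z => ∫ g, F g z ∂μ) (∫ g, _root_.fderiv ℝ (F g) z ∂μ) z := by
  have hF' := hF.fderiv hS
  obtain ⟨C, hC⟩ := isCompact_univ.exists_bound_of_continuousOn (hF'.continuous hS hz).continuousOn
  -- A dominating constant: `C` bounds the derivatives at `z`, and joint continuity with compactness
  -- of `K` extends the bound `C + 1`, uniformly in `g`, to a neighbourhood of `z`.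
  have hev : ∀ᶠ w in 𝓝 z, ∀ g ∈ (univ : Set K), ‖_root_.fderiv ℝ (F g) w‖ < C + 1 := by
    refine isCompact_univ.eventually_forall_of_forall_eventually fun g _ => ?_
    have h1 := (hF'.continuousAt hS (g := g) hz).norm
    have h2 : ∀ᶠ p : K × E in 𝓝 (g, z), ‖_root_.fderiv ℝ (F p.1) p.2‖ < C + 1 :=
      h1.eventually (gt_mem_nhds (lt_of_le_of_lt (hC g (mem_univ g)) (lt_add_one C)))
    rw [nhds_swap (g : K) z] at h2
    exact h2
  have hs := hev.and (hS.mem_nhds hz)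
  refine hasFDerivAt_integral_of_dominated_of_fderiv_le (bound := fun _ => C + 1)
    (F := fun z g => F g z) (F' := fun z g => _root_.fderiv ℝ (F g) z)
    (s := {w | (∀ g ∈ (univ : Set K), ‖_root_.fderiv ℝ (F g) w‖ < C + 1) ∧ w ∈ S}) hs ?_ ?_ ?_ ?_ ?_ ?_
  · filter_upwards [hS.mem_nhds hz] with w hw
    exact (hF.continuous hS hw).aestronglyMeasurable
  · exact integrable_of_continuous μ (hF.continuous hS hz)
  · exact (hF'.continuous hS hz).aestronglyMeasurable
  · exact Eventually.of_forall fun g w hw => (hw.1 g (mem_univ g)).le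
  · exact MeasureTheory.integrable_const _
  · exact Eventually.of_forall fun g w hw => (hF.differentiableAt hS g hw.2).hasFDerivAt

/-- The target `V` is quantified inside the induction because the derivative of the integral is an
integral with values in `E →L[ℝ] V`. This is also why `E` and `V` share a universe. -/
theorem IsSmoothFamilyOn.contDiffOn_integral_nat (n : ℕ) :
    ∀ {V : Type u} [NormedAddCommGroup V] [NormedSpace ℝ V] {F : K → E → V} {S : Set E},
      IsSmoothFamilyOn 𝔤 F S → IsOpen S → ContDiffOn ℝ n (fun z => ∫ g, F g z ∂μ) S := by
  induction n with
  | zero =>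
    intro V _ _ F S hF hS
    rw [Nat.cast_zero, contDiffOn_zero]
    exact fun z hz => (hF.hasFDerivAt_integral μ hS hz).continuousAt.continuousWithinAt
  | succ n ih =>
    intro V _ _ F S hF hS
    rw [Nat.cast_add, Nat.cast_one, contDiffOn_succ_iff_fderiv_of_isOpen hS]
    refine ⟨fun z hz => (hF.hasFDerivAt_integral μ hS hz).differentiableAt.differentiableWithinAt,
      by simp, (ih (hF.fderiv hS) hS).congr fun z hz => (hF.hasFDerivAt_integral μ hS hz).fderiv⟩

/-- Differentiation under the integral sign, for smooth families over compact manifolds. -/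
theorem IsSmoothFamilyOn.contDiffOn_integral (hF : IsSmoothFamilyOn 𝔤 F S) (hS : IsOpen S) :
    ContDiffOn ℝ ∞ (fun z => ∫ g, F g z ∂μ) S :=
  contDiffOn_infty.2 fun n => hF.contDiffOn_integral_nat μ n hS

end ParametricIntegral

/-! ### Averaging forms over the group -/

section Averaging

universe u

variable {𝔤 : Type*} [NormedAddCommGroup 𝔤] [NormedSpace ℝ 𝔤]
  {G : Type*} [TopologicalSpace G] [ChartedSpace 𝔤 G] [Group G] [LieGroup 𝓘(ℝ, 𝔤) ∞ G]
  [CompactSpace G] [MeasurableSpace G] [BorelSpace G] [SecondCountableTopology G]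
  (μ : MeasureTheory.Measure G) [MeasureTheory.IsFiniteMeasure μ]
  {E : Type u} [NormedAddCommGroup E] [NormedSpace ℝ E]
  {H : Type*} [TopologicalSpace H] {I : ModelWithCorners ℝ E H} [I.Boundaryless]
  {N : Type*} [TopologicalSpace N] [ChartedSpace H N] [MulAction G N]
  [IsManifold I ∞ N]

variable (I) in
/-- The average of a form over the group. -/
def averageForm {k : ℕ} (α : RawForm E N k) : RawForm E N k :=
  fun x => ∫ g, pullbackForm I I (fun y : N => g • y) α x ∂μ

/-- The translates of `α` are the `N`-slices of a single smooth form on `G × N`, the pullback under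
the action map. -/
theorem isSmoothFamilyOn_chartRep [ContMDiffSMul 𝓘(ℝ, 𝔤) I ∞ G N] {k : ℕ} {α : RawForm E N k} (hα : α ∈ smoothForms I N k)
    (x₀ : N) :
    IsSmoothFamilyOn 𝔤 (fun g : G => chartRep I (pullbackForm I I (fun y : N => g • y) α) x₀)
      (extChartAt I x₀).target := by
  intro g₀
  have h1 := actionPullback_mem_smoothForms (𝔤 := 𝔤) (G := G) hα (g₀, x₀)
  rw [extChartAt_prod] at h1
  have h2 := (contDiff_compCLM (E := E) (E' := 𝔤 × E) k).comp_contDiffOn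
    (h1.prodMk (contDiffOn_const (c := ContinuousLinearMap.inr ℝ 𝔤 E)))
  refine h2.congr fun p hp => ?_
  have h3 := chartRep_actionPullback_inr (α := α) (x₀ := x₀)
    ((extChartAt 𝓘(ℝ, 𝔤) g₀).map_target hp.1) hp.2
  rw [(extChartAt 𝓘(ℝ, 𝔤) g₀).right_inv hp.1] at h3
  exact h3.symm

theorem continuous_pullbackForm_smul [ContMDiffSMul 𝓘(ℝ, 𝔤) I ∞ G N] {k : ℕ} {α : RawForm E N k} (hα : α ∈ smoothForms I N k)
    (x : N) : Continuous (fun g : G => pullbackForm I I (fun y : N => g • y) α x) := by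
  have h := (isSmoothFamilyOn_chartRep (𝔤 := 𝔤) (G := G) hα x).continuous
    (isOpen_extChartAt_target x) (mem_extChartAt_target x)
  simpa only [chartRep_self] using h

theorem averageForm_apply [ContMDiffSMul 𝓘(ℝ, 𝔤) I ∞ G N] {k : ℕ} {α : RawForm E N k} (hα : α ∈ smoothForms I N k)
    (x : N) (w : Fin k → E) :
    averageForm μ I α x w = ∫ g, pullbackForm I I (fun y : N => g • y) α x w ∂μ :=
  ((ContinuousAlternatingMap.apply ℝ E ℝ w).integral_comp_comm
    (integrable_of_continuous μ (continuous_pullbackForm_smul (𝔤 := 𝔤) hα x))).symm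

theorem averageForm_mem_smoothForms [ContMDiffSMul 𝓘(ℝ, 𝔤) I ∞ G N] {k : ℕ} {α : RawForm E N k} (hα : α ∈ smoothForms I N k) :
    averageForm μ I α ∈ smoothForms I N k := by
  intro x₀
  refine ((isSmoothFamilyOn_chartRep (𝔤 := 𝔤) (G := G) hα x₀).contDiffOn_integral μ
    (isOpen_extChartAt_target x₀)).congr fun z hz => ?_
  exact ((ContinuousAlternatingMap.compContinuousLinearMapCLM
    (chartSymmMapAt I x₀ z)).integral_comp_comm (integrable_of_continuous μ
      (continuous_pullbackForm_smul (𝔤 := 𝔤) hα _))).symm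

/-- Pullback is contravariant: pulling back by `h` turns the term at `g` into the term at `g * h`.
Hence it is right invariance of `μ` that matters. -/
theorem isInvariantForm_averageForm [ContMDiffSMul 𝓘(ℝ, 𝔤) I ∞ G N] [μ.IsMulRightInvariant] {k : ℕ} {α : RawForm E N k}
    (hα : α ∈ smoothForms I N k) : IsInvariantForm G I (averageForm μ I α) := by
  intro h
  funext x
  have h1 : pullbackForm I I (fun y : N => h • y) (averageForm μ I α) x =
      ∫ g, pullbackForm I I (fun y : N => h • y) (pullbackForm I I (fun y : N => g • y) α) x ∂μ :=
    ((ContinuousAlternatingMap.compContinuousLinearMapCLM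
      (tangentMapAt I I (fun y : N => h • y) x)).integral_comp_comm (integrable_of_continuous μ
        (continuous_pullbackForm_smul (𝔤 := 𝔤) hα _))).symm
  have h2 : ∀ g : G,
      pullbackForm I I (fun y : N => h • y) (pullbackForm I I (fun y : N => g • y) α) x =
        pullbackForm I I (fun y : N => (g * h) • y) α x := by
    intro g
    rw [pullbackForm_pullbackForm (contMDiff_smulMap 𝔤 g) (contMDiff_smulMap 𝔤 h)]
    simp only [smul_smul]
  have : IsTopologicalGroup G := topologicalGroup_of_lieGroup 𝓘(ℝ, 𝔤) ∞
  rw [h1]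
  simp only [h2]
  exact MeasureTheory.integral_mul_right_eq_self
    (fun g => pullbackForm I I (fun y : N => g • y) α x) h

end Averaging

/-- Inversion turns the left-invariant Haar measure into a right-invariant one. Positivity on open
sets makes the average of a nonnegative continuous function strictly positive unless the function
vanishes identically. -/
theorem exists_rightInvariant_measure (G : Type*) [TopologicalSpace G] [Group G]
    [IsTopologicalGroup G] [CompactSpace G] [MeasurableSpace G] [BorelSpace G] :
    ∃ μ : MeasureTheory.Measure G, MeasureTheory.IsFiniteMeasure μ ∧ μ.IsMulRightInvariant ∧
      μ.IsOpenPosMeasure := by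
  refine ⟨(MeasureTheory.Measure.haar : MeasureTheory.Measure G).inv, ?_, inferInstance, ?_⟩
  · exact MeasureTheory.Measure.isFiniteMeasure_map _ _
  · exact continuous_inv.isOpenPosMeasure_map inv_surjective

/-! ### A `1`-form detecting the zeros of `v♯` -/

section TamingForm

universe u

variable {𝔤 : Type*} [NormedAddCommGroup 𝔤] [NormedSpace ℝ 𝔤]
  {G : Type*} [TopologicalSpace G] [ChartedSpace 𝔤 G] [Group G] [LieGroup 𝓘(ℝ, 𝔤) ∞ G]
  {E : Type u} [NormedAddCommGroup E] [NormedSpace ℝ E]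
  {H : Type*} [TopologicalSpace H] {I : ModelWithCorners ℝ E H}
  {N : Type*} [TopologicalSpace N] [ChartedSpace H N] [MulAction G N]
  [ContMDiffSMul 𝓘(ℝ, 𝔤) I ∞ G N] [IsManifold I ∞ N]

theorem TamingMap.sharp_smul (v : TamingMap 𝔤 G I N) (g : G) (x : N) :
    v.sharp (g • x) = tangentMapAt I I (fun y : N => g • y) x (v.sharp x) := by
  rw [TamingMap.sharp, TamingMap.sharp, tangentMapAt_smul_fundamentalField, v.equivariant]

/-- The `1`-form `df(v♯) df`. -/
def tamingSquare (v : TamingMap 𝔤 G I N) (f : N → ℝ) : RawForm E N 1 :=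
  funSmul (fun x => contractFundamental 𝔤 G I (differentialForm I f) x (v x)) (differentialForm I f)

theorem tamingSquare_apply (v : TamingMap 𝔤 G I N) (f : N → ℝ) (x : N) (w : Fin 1 → E) :
    tamingSquare v f x w =
      tangentMapAt I 𝓘(ℝ, ℝ) f x (v.sharp x) * tangentMapAt I 𝓘(ℝ, ℝ) f x (w 0) := by
  change contractFundamental 𝔤 G I (differentialForm I f) x (v x) * _ = _
  rw [contractFundamental_apply]
  rfl

theorem tamingSquare_mem_smoothForms (v : TamingMap 𝔤 G I N) {f : N → ℝ}
    (hf : ContMDiff I 𝓘(ℝ, ℝ) ∞ f) : tamingSquare v f ∈ smoothForms I N 1 :=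
  funSmul_mem_smoothForms
    ((contMDiff_contractFundamental (differentialForm_mem_smoothForms hf)).clm_apply v.smooth)
    (differentialForm_mem_smoothForms hf)

/-- The form is `⟨v♯, ·⟩` for the metric `∑ df ⊗ df`, where `f` runs over the coordinates of charts
cut off by a locally finite family of bump functions. Its value on `v♯` is a sum of squares. Near
each point some bump function is `1`, so vanishing of the squares forces all coordinates of `v♯` in
a chart to vanish. Each term has a factor `df(v♯)`, so the form vanishes where `v♯` does. -/
theorem exists_tamingForm [FiniteDimensional ℝ E] [T2Space N] [SigmaCompactSpace N]
    (v : TamingMap 𝔤 G I N) :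
    ∃ Θ ∈ smoothForms I N 1, (∀ x, 0 ≤ Θ x ![v.sharp x]) ∧
      (∀ x, Θ x ![v.sharp x] = 0 → v.sharp x = 0) ∧ ∀ x, v.sharp x = 0 → Θ x = 0 := by
  classical
  obtain ⟨ι, fs, -⟩ := SmoothBumpCovering.exists_isSubordinate (I := I) (s := (univ : Set N))
    (U := fun _ => univ) isClosed_univ (fun _ _ => univ_mem)
  let b := Module.finBasis ℝ E
  let f : ι → N → E := fun i x => fs i x • extChartAt I (fs.c i) x
  let ℓ : Fin (Module.finrank ℝ E) → E →L[ℝ] ℝ := fun j => (b.coord j).toContinuousLinearMap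
  have hf : ∀ i, ContMDiff I 𝓘(ℝ, E) ∞ (f i) := fun i =>
    (fs i).contMDiff_smul contMDiffOn_extChartAt
  have hfj : ∀ i j, ContMDiff I 𝓘(ℝ, ℝ) ∞ (fun x => ℓ j (f i x)) := fun i j =>
    (ℓ j).contMDiff.comp (hf i)
  let Θ : ι → RawForm E N 1 := fun i => ∑ j, tamingSquare v (fun x => ℓ j (f i x))
  have hΘ : ∀ i, Θ i ∈ smoothForms I N 1 := fun i =>
    Submodule.sum_mem _ fun j _ => tamingSquare_mem_smoothForms v (hfj i j)
  have happ : ∀ i x w, Θ i x w = ∑ j, tamingSquare v (fun x => ℓ j (f i x)) x w := by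
    intro i x w
    simp only [Θ, Finset.sum_apply, ContinuousAlternatingMap.sum_apply]
  -- The closure is needed because the terms involve derivatives of the bump functions. Closures of
  -- a locally finite family are still locally finite.
  have hsupp : ∀ i, Function.support (Θ i) ⊆ closure (Function.support (fs i)) := by
    intro i x hx
    by_contra hxn
    refine hx ?_
    have h1 : ∀ᶠ y in 𝓝 x, fs i y = 0 := by
      filter_upwards [isClosed_closure.isOpen_compl.mem_nhds hxn] with y hy
      by_contra h
      exact hy (subset_closure h)
    ext w
    rw [happ]
    refine Finset.sum_eq_zero fun j _ => ?_
    have h2 : (fun x => ℓ j (f i x)) =ᶠ[𝓝 x] fun _ => (0 : ℝ) := by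
      filter_upwards [h1] with y hy
      simp only [f, hy, zero_smul, map_zero]
    rw [tamingSquare_apply, h2.tangentMapAt_eq, tangentMapAt_const]
    simp
  have hlf : LocallyFinite fun i => Function.support (Θ i) :=
    fs.locallyFinite.closure.subset hsupp
  have hloc : ∀ x, ∃ s : Finset ι, (∀ᶠ y in 𝓝 x, ∑ᶠ i, Θ i y = ∑ i ∈ s, Θ i y) ∧
      ∀ i ∉ s, Θ i x = 0 := by
    intro x
    obtain ⟨s, n, hn, -, hs'⟩ := hlf.exists_finset_nhds_support_subset (U := fun _ => univ)
      (fun _ => subset_univ _) (fun _ => isOpen_univ) x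
    have hs : ∀ᶠ y in 𝓝 x, (Function.support fun i => Θ i y) ⊆ s := mem_of_superset hn hs'
    refine ⟨s, ?_, fun i hi => ?_⟩
    · filter_upwards [hs] with y hy using finsum_eq_sum_of_support_subset _ hy
    · by_contra h
      exact hi (hs.self_of_nhds h)
  have hval : ∀ i x, Θ i x ![v.sharp x] =
      ∑ j, (tangentMapAt I 𝓘(ℝ, ℝ) (fun x => ℓ j (f i x)) x (v.sharp x)) ^ 2 := by
    intro i x
    rw [happ]
    refine Finset.sum_congr rfl fun j _ => ?_
    rw [tamingSquare_apply, sq]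
    rfl
  have hnn : ∀ i x, 0 ≤ Θ i x ![v.sharp x] := fun i x => by
    rw [hval]
    exact Finset.sum_nonneg fun j _ => sq_nonneg _
  refine ⟨fun x => ∑ᶠ i, Θ i x, ?_, ?_, ?_, ?_⟩
  · refine mem_smoothForms_of_locally fun x => ?_
    obtain ⟨s, hs, -⟩ := hloc x
    refine ⟨∑ i ∈ s, Θ i, Submodule.sum_mem _ fun i _ => hΘ i, ?_⟩
    filter_upwards [hs] with y hy
    rw [hy, Finset.sum_apply]
  · intro x
    obtain ⟨s, hs, -⟩ := hloc x
    simp only [hs.self_of_nhds, ContinuousAlternatingMap.sum_apply]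
    exact Finset.sum_nonneg fun i _ => hnn i x
  · intro x hx
    obtain ⟨s, hs, hs'⟩ := hloc x
    simp only [hs.self_of_nhds, ContinuousAlternatingMap.sum_apply] at hx
    rw [Finset.sum_eq_zero_iff_of_nonneg fun i _ => hnn i x] at hx
    -- The index of a bump function equal to `1` near `x`; there `f i` is the chart itself, with
    -- injective differential.
    set i := fs.ind x (mem_univ x)
    have hi : Θ i x ![v.sharp x] = 0 := by
      by_cases h : i ∈ s
      · exact hx i h
      · rw [hs' i h]
        rfl
    rw [hval, Finset.sum_eq_zero_iff_of_nonneg fun j _ => sq_nonneg _] at hi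
    have hsrc : x ∈ (extChartAt I (fs.c i)).source := fs.mem_extChartAt_ind_source x (mem_univ x)
    have hchart : MDifferentiableAt I 𝓘(ℝ, E) (extChartAt I (fs.c i)) x :=
      mdifferentiableAt_extChartAt (by simpa using hsrc)
    have h1 : f i =ᶠ[𝓝 x] extChartAt I (fs.c i) := by
      filter_upwards [fs.eventuallyEq_one x (mem_univ x)] with y hy
      have hy' : fs i y = 1 := hy
      simp only [f, hy', one_smul]
    set L := tangentMapAt I 𝓘(ℝ, E) (extChartAt I (fs.c i)) x with hL
    have h2 : ∀ j, ℓ j (L (v.sharp x)) = 0 := by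
      intro j
      have h3 : (fun x => ℓ j (f i x)) =ᶠ[𝓝 x] fun y => ℓ j (extChartAt I (fs.c i) y) := by
        filter_upwards [h1] with y hy
        rw [hy]
      have h4 := hi j (Finset.mem_univ j)
      rw [h3.tangentMapAt_eq] at h4
      have h5 : tangentMapAt I 𝓘(ℝ, ℝ) (fun y => ℓ j (extChartAt I (fs.c i) y)) x =
          (ℓ j).comp L := by
        have h6 := mfderiv_comp (I' := 𝓘(ℝ, E)) (I'' := 𝓘(ℝ, ℝ)) x
          ((ℓ j).mdifferentiableAt (x := extChartAt I (fs.c i) x)) hchart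
        rw [ContinuousLinearMap.mfderiv_eq] at h6
        exact h6
      rw [h5] at h4
      exact pow_eq_zero_iff (two_ne_zero) |>.1 h4
    have h7 : L (v.sharp x) = 0 := by
      apply b.ext_elem
      intro j
      rw [map_zero]
      exact h2 j
    have h8 : Function.Injective L :=
      (isInvertible_mfderiv_extChartAt (I := I) hsrc).injective
    exact h8 (h7.trans (map_zero L).symm)
  · intro x hx
    have h : ∀ i, Θ i x = 0 := by
      intro i
      ext w
      rw [happ]
      refine Finset.sum_eq_zero fun j _ => ?_
      rw [tamingSquare_apply, hx, map_zero, zero_mul]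
    simp only [h, finsum_zero]

end TamingForm

/-! ### Invariant versions by averaging -/

section Invariant

universe u

variable {𝔤 : Type*} [NormedAddCommGroup 𝔤] [NormedSpace ℝ 𝔤] [FiniteDimensional ℝ 𝔤]
  {G : Type*} [TopologicalSpace G] [CompactSpace G] [ChartedSpace 𝔤 G] [Group G]
  [LieGroup 𝓘(ℝ, 𝔤) ∞ G]
  {E : Type u} [NormedAddCommGroup E] [NormedSpace ℝ E] [FiniteDimensional ℝ E]
  {H : Type*} [TopologicalSpace H] {I : ModelWithCorners ℝ E H} [I.Boundaryless]
  {N : Type*} [TopologicalSpace N] [T2Space N] [SigmaCompactSpace N] [ChartedSpace H N]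
  [MulAction G N] [IsManifold I ∞ N]

/-- Since `v♯` is itself invariant under the action, evaluating the translate of `Θ` by `g` on `v♯`
at `x` gives `Θ(v♯)` at `g • x`. Thus all three sign and vanishing conditions survive averaging. -/
theorem exists_invariant_tamingForm [ContMDiffSMul 𝓘(ℝ, 𝔤) I ∞ G N] (v : TamingMap 𝔤 G I N) :
    ∃ Θ ∈ smoothForms I N 1, IsInvariantForm G I Θ ∧ (∀ x, 0 ≤ Θ x ![v.sharp x]) ∧
      (∀ x, Θ x ![v.sharp x] = 0 → v.sharp x = 0) ∧ ∀ x, v.sharp x = 0 → Θ x = 0 := by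
  have : IsTopologicalGroup G := topologicalGroup_of_lieGroup 𝓘(ℝ, 𝔤) ∞
  have : SecondCountableTopology G := ChartedSpace.secondCountable_of_sigmaCompact 𝔤 G
  let _ : MeasurableSpace G := borel G
  have : BorelSpace G := ⟨rfl⟩
  obtain ⟨μ, _, _, _⟩ := exists_rightInvariant_measure G
  obtain ⟨Θ, hΘ, hpos, hne, hzero⟩ := exists_tamingForm v
  have hval : ∀ x (g : G), pullbackForm I I (fun y : N => g • y) Θ x ![v.sharp x] =
      Θ (g • x) ![v.sharp (g • x)] := by
    intro x g
    rw [pullbackForm_apply, v.sharp_smul]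
    congr 1
    funext i
    fin_cases i
    rfl
  refine ⟨averageForm μ I Θ, averageForm_mem_smoothForms (𝔤 := 𝔤) μ hΘ,
    isInvariantForm_averageForm (𝔤 := 𝔤) μ hΘ, fun x => ?_, fun x hx => ?_, fun x hx => ?_⟩
  · rw [averageForm_apply (𝔤 := 𝔤) μ hΘ]
    exact MeasureTheory.integral_nonneg fun g => by
      simp only [Pi.zero_apply, hval]
      exact hpos _
  · rw [averageForm_apply (𝔤 := 𝔤) μ hΘ] at hx
    by_contra h
    -- The integrand is continuous, nonnegative and nonzero at `g = 1`, so its integral is strictly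
    -- positive.
    have hc : Continuous fun g : G =>
        pullbackForm I I (fun y : N => g • y) Θ x ![v.sharp x] :=
      (ContinuousAlternatingMap.apply ℝ E ℝ ![v.sharp x]).continuous.comp
        (continuous_pullbackForm_smul (𝔤 := 𝔤) hΘ x)
    refine (hc.integral_pos_of_hasCompactSupport_nonneg_nonzero (μ := μ) (x := 1)
      (HasCompactSupport.of_compactSpace _) (fun g => ?_) ?_).ne' hx
    · simp only [Pi.zero_apply, hval]
      exact hpos _
    · rw [hval, one_smul]
      exact fun h' => h (hne x h')
  · ext w
    rw [averageForm_apply (𝔤 := 𝔤) μ hΘ]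
    have h : ∀ g : G, pullbackForm I I (fun y : N => g • y) Θ x w = 0 := by
      intro g
      rw [pullbackForm_apply, hzero (g • x) (by rw [v.sharp_smul, hx, map_zero])]
      rfl
    simp only [h, MeasureTheory.integral_zero]
    rfl

/-- Average a nonnegative smooth function whose nonzero set is `U`. Invariance of `U` keeps the
average zero outside `U`, and on `U` the integrand is already positive at `g = 1`. -/
theorem exists_invariant_support_eq [ContMDiffSMul 𝓘(ℝ, 𝔤) I ∞ G N] (U : InvariantOpens G N) :
    ∃ F : N → ℝ, ContMDiff I 𝓘(ℝ, ℝ) ∞ F ∧ (∀ (g : G) x, F (g • x) = F x) ∧ (∀ x, 0 ≤ F x) ∧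
      ∀ x, F x ≠ 0 ↔ x ∈ U.opens := by
  have : IsTopologicalGroup G := topologicalGroup_of_lieGroup 𝓘(ℝ, 𝔤) ∞
  have : SecondCountableTopology G := ChartedSpace.secondCountable_of_sigmaCompact 𝔤 G
  let _ : MeasurableSpace G := borel G
  have : BorelSpace G := ⟨rfl⟩
  obtain ⟨μ, _, _, _⟩ := exists_rightInvariant_measure G
  obtain ⟨f, hfU, hf, hf0⟩ := U.opens.isOpen.exists_contMDiff_support_eq (n := ⊤) I
  let α : RawForm E N 0 := fun x => ContinuousAlternatingMap.constOfIsEmpty ℝ E (Fin 0) (f x)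
  have hα : α ∈ smoothForms I N 0 := zeroForm_mem_smoothForms hf
  have hF : ∀ x, averageForm μ I α x ![] = ∫ g, f (g • x) ∂μ := fun x =>
    averageForm_apply (𝔤 := 𝔤) μ hα x ![]
  have hfc : ∀ x, Continuous fun g : G => f (g • x) := fun x =>
    hf.continuous.comp (contMDiff_orbitMap (𝔤 := 𝔤) (I := I) x).continuous
  have hmem : ∀ x, f x ≠ 0 ↔ x ∈ U.opens := fun x => by
    change x ∈ Function.support f ↔ _
    rw [hfU]
    rfl
  refine ⟨fun x => averageForm μ I α x ![],
    contMDiff_of_zeroForm_mem (averageForm_mem_smoothForms (𝔤 := 𝔤) μ hα) _, fun g x => ?_,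
    fun x => ?_, fun x => ?_⟩
  · have h := congrArg (fun β : RawForm E N 0 => β x ![])
      (isInvariantForm_averageForm (𝔤 := 𝔤) μ hα g)
    refine Eq.trans ?_ h
    exact congrArg _ (Subsingleton.elim _ _)
  · simp only [hF]
    exact MeasureTheory.integral_nonneg fun g => hf0 _
  · simp only [hF]
    constructor
    · intro h
      by_contra hx
      refine h ?_
      have h0 : ∀ g : G, f (g • x) = 0 := by
        intro g
        by_contra hg
        have := U.smul_mem g⁻¹ _ ((hmem _).1 hg)
        rw [inv_smul_smul] at this
        exact hx this
      simp only [h0, MeasureTheory.integral_zero]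
    · intro hx
      refine ((hfc x).integral_pos_of_hasCompactSupport_nonneg_nonzero (μ := μ) (x := 1)
        (HasCompactSupport.of_compactSpace _) (fun g => hf0 _) ?_).ne'
      rw [one_smul]
      exact (hmem x).2 hx

end Invariant

/-! ### Orientations as signs relative to a basis -/

section OrientationSigns

variable {V : Type*} [NormedAddCommGroup V] [NormedSpace ℝ V] {k : ℕ}

open Classical in
/-- The sign of an orientation relative to a basis. -/
def orientationSign (b : Module.Basis (Fin k) ℝ V) (o : Orientation ℝ V (Fin k)) : ℝ :=
  if o = b.orientation then 1 else -1

/-- The orientation with a given sign relative to a basis. -/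
def orientationOfSign (b : Module.Basis (Fin k) ℝ V) (s : ℝ) : Orientation ℝ V (Fin k) :=
  if 0 < s then b.orientation else -b.orientation

/-- A top degree form is `μ b` times the determinant of `b`. This reduces every orientation
statement to a sign computation. -/
theorem isPositiveForm_basis_orientation (b : Module.Basis (Fin k) ℝ V) (μ : V [⋀^Fin k]→ₗ[ℝ] ℝ) :
    IsPositiveForm b.orientation μ ↔ 0 < μ b := by
  have hμ : μ = μ b • b.det := μ.eq_smul_basis_det b
  constructor
  · rintro ⟨h0, h1⟩
    have h2 := (ray_eq_iff h0 b.det_ne_zero).1 h1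
    rw [hμ, sameRay_smul_left_iff_of_ne b.det_ne_zero] at h2
    · exact h2
    · intro h
      rw [h, zero_smul] at hμ
      exact h0 hμ
  · intro h
    have h0 : μ ≠ 0 := by
      rintro rfl
      simp at h
    refine ⟨h0, (ray_eq_iff h0 b.det_ne_zero).2 ?_⟩
    rw [hμ]
    exact SameRay.sameRay_pos_smul_left _ h

theorem isPositiveForm_neg (o : Orientation ℝ V (Fin k)) (μ : V [⋀^Fin k]→ₗ[ℝ] ℝ) :
    IsPositiveForm (-o) μ ↔ IsPositiveForm o (-μ) := by
  constructor
  · rintro ⟨h0, h1⟩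
    refine ⟨neg_ne_zero.2 h0, ?_⟩
    rw [← neg_rayOfNeZero ℝ μ h0, h1]
    exact neg_neg (G := Module.Ray ℝ (V [⋀^Fin k]→ₗ[ℝ] ℝ)) o
  · rintro ⟨h0, h1⟩
    refine ⟨neg_ne_zero.1 h0, ?_⟩
    rw [← h1, ← neg_rayOfNeZero]
    exact (neg_neg (G := Module.Ray ℝ (V [⋀^Fin k]→ₗ[ℝ] ℝ)) _).symm

theorem isPositiveForm_iff (b : Module.Basis (Fin k) ℝ V) (o : Orientation ℝ V (Fin k))
    (μ : V [⋀^Fin k]→ₗ[ℝ] ℝ) : IsPositiveForm o μ ↔ 0 < orientationSign b o * μ b := by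
  rw [orientationSign]
  split_ifs with h
  · rw [h, one_mul, isPositiveForm_basis_orientation]
  · have h1 := (b.orientation_eq_or_eq_neg o).resolve_left h
    rw [h1, isPositiveForm_neg, isPositiveForm_basis_orientation, neg_one_mul,
      AlternatingMap.neg_apply]

theorem isPositiveForm_orientationOfSign (b : Module.Basis (Fin k) ℝ V) {s : ℝ} (hs : s ≠ 0)
    (μ : V [⋀^Fin k]→ₗ[ℝ] ℝ) : IsPositiveForm (orientationOfSign b s) μ ↔ 0 < s * μ b := by
  rw [orientationOfSign]
  split_ifs with h
  · rw [isPositiveForm_basis_orientation, mul_pos_iff_of_pos_left h]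
  · have h1 : 0 < -s := neg_pos.2 (lt_of_le_of_ne (not_lt.1 h) hs)
    rw [isPositiveForm_neg, isPositiveForm_basis_orientation, ← neg_mul_neg,
      mul_pos_iff_of_pos_left h1, AlternatingMap.neg_apply]

theorem orientationSign_ne_zero (b : Module.Basis (Fin k) ℝ V) (o : Orientation ℝ V (Fin k)) :
    orientationSign b o ≠ 0 := by
  rw [orientationSign]
  split_ifs <;> norm_num

end OrientationSigns

/-! ### Orientation of the cylinder `M × [0, 1]` -/

section Cylinder

variable {m : ℕ}

/-- The standard basis of `ℝ^m × ℝ`, the last factor first. -/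
def cylinderBasis (m : ℕ) :
    Module.Basis (Fin (m + 1)) ℝ (EuclideanSpace ℝ (Fin m) × EuclideanSpace ℝ (Fin 1)) :=
  ((EuclideanSpace.basisFun (Fin m) ℝ).toBasis.prod
    ((EuclideanSpace.basisFun (Fin 1) ℝ).toBasis.reindex (Equiv.equivPUnit.{1, 1} (Fin 1)))).reindex
      ((Equiv.optionEquivSumPUnit.{0, 0} (Fin m)).symm.trans (finSuccEquiv m).symm)

theorem cylinderBasis_zero (m : ℕ) :
    cylinderBasis m 0 = (0, EuclideanSpace.single 0 1) := by
  simp [cylinderBasis, finSuccEquiv_zero]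

theorem cylinderBasis_succ (i : Fin m) :
    cylinderBasis m i.succ = (EuclideanSpace.single i 1, 0) := by
  simp [cylinderBasis, finSuccEquiv_succ]

theorem alternatingMap_cylinderBasis
    (μ : (EuclideanSpace ℝ (Fin m) × EuclideanSpace ℝ (Fin 1)) [⋀^Fin (m + 1)]→ₗ[ℝ] ℝ) :
    μ (cylinderBasis m) = (μ.curryLeft (0, EuclideanSpace.single 0 1)).compLinearMap
      (LinearMap.inl ℝ _ _) (EuclideanSpace.basisFun (Fin m) ℝ).toBasis := by
  rw [AlternatingMap.compLinearMap_apply, AlternatingMap.curryLeft_apply_apply]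
  congr 1
  funext i
  refine Fin.cases ?_ (fun i => ?_) i
  · rw [cylinderBasis_zero]
    rfl
  · rw [cylinderBasis_succ]
    simp

/-- In a top degree form, a vector may be replaced by its last coordinate if the other vectors are
those of the first factor. -/
theorem curryLeft_inl_cylinder
    (μ : (EuclideanSpace ℝ (Fin m) × EuclideanSpace ℝ (Fin 1)) [⋀^Fin (m + 1)]→ₗ[ℝ] ℝ)
    (ν : EuclideanSpace ℝ (Fin m) × EuclideanSpace ℝ (Fin 1)) :
    (μ.curryLeft ν).compLinearMap (LinearMap.inl ℝ _ _)
      (EuclideanSpace.basisFun (Fin m) ℝ).toBasis = ν.2 0 * μ (cylinderBasis m) := by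
  set e := (EuclideanSpace.basisFun (Fin m) ℝ).toBasis with he
  let ℓ : (EuclideanSpace ℝ (Fin m) × EuclideanSpace ℝ (Fin 1)) →ₗ[ℝ] ℝ :=
    { toFun := fun ν => (μ.curryLeft ν).compLinearMap (LinearMap.inl ℝ _ _) e
      map_add' := fun a b => by simp
      map_smul' := fun c a => by simp }
  -- A vector of the first factor is a combination of the `e i`, and inserting `e i` repeats an
  -- argument of the alternating form.
  have h0 : ℓ ∘ₗ LinearMap.inl ℝ _ _ = 0 := by
    refine e.ext fun i => ?_
    change μ (Fin.cons (e i, 0) (fun j => (e j, 0))) = 0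
    exact μ.map_eq_zero_of_eq _ (i := 0) (j := i.succ) (by simp) (Fin.succ_ne_zero i).symm
  have h1 : ν = (ν.1, 0) + ν.2 0 • ((0, EuclideanSpace.single 0 1) :
      EuclideanSpace ℝ (Fin m) × EuclideanSpace ℝ (Fin 1)) := by
    refine Prod.ext (by simp) ?_
    ext i
    fin_cases i
    simp
  have h2 : ℓ (ν.1, 0) = 0 := congrArg (fun L => L ν.1) h0
  have h3 : ℓ ν = ν.2 0 * ℓ (0, EuclideanSpace.single 0 1) := by
    conv_lhs => rw [h1]
    rw [map_add, h2, zero_add, map_smul, smul_eq_mul]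
  rw [alternatingMap_cylinderBasis]
  exact h3

/-- The sign of the preferred chart of `[0, 1]` at `t`. -/
def intervalChartSign (t : Icc (0 : ℝ) 1) : ℝ := if (t : ℝ) < 1 then 1 else -1

theorem intervalChartSign_ne_zero (t : Icc (0 : ℝ) 1) : intervalChartSign t ≠ 0 := by
  rw [intervalChartSign]
  split_ifs <;> norm_num

theorem intervalChartSign_mul_self (t : Icc (0 : ℝ) 1) :
    intervalChartSign t * intervalChartSign t = 1 := by
  rw [intervalChartSign]
  split_ifs <;> norm_num

/-- The preferred chart of `[0, 1]` is `t` at points below `1` and `1 - t` at the point `1`. As each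
tangent space is read in the chart of its own point, comparing the two charts produces the sign. -/
theorem tangentMapAt_extChartAt_Icc (t₀ : Icc (0 : ℝ) 1) : ∀ᶠ t in 𝓝 t₀,
    tangentMapAt (𝓡∂ 1) 𝓘(ℝ, EuclideanSpace ℝ (Fin 1)) (extChartAt (𝓡∂ 1) t₀) t =
      (intervalChartSign t₀ * intervalChartSign t) • ContinuousLinearMap.id ℝ _ := by
  have hself : ∀ t : Icc (0 : ℝ) 1, tangentMapAt (𝓡∂ 1) 𝓘(ℝ, EuclideanSpace ℝ (Fin 1))
      (extChartAt (𝓡∂ 1) t) t = ContinuousLinearMap.id ℝ _ := fun t =>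
    tangentMapAt_extChartAt_self t
  have hsame : ∀ t : Icc (0 : ℝ) 1, chartAt (EuclideanHalfSpace 1) t₀ =
      chartAt (EuclideanHalfSpace 1) t → intervalChartSign t₀ = intervalChartSign t →
      tangentMapAt (𝓡∂ 1) 𝓘(ℝ, EuclideanSpace ℝ (Fin 1)) (extChartAt (𝓡∂ 1) t₀) t =
      (intervalChartSign t₀ * intervalChartSign t) • ContinuousLinearMap.id ℝ _ := by
    intro t h h'
    rw [h', intervalChartSign_mul_self, one_smul, ← hself t, extChartAt, h, extChartAt]
  by_cases h0 : (t₀ : ℝ) < 1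
  · have hev : ∀ᶠ t : Icc (0 : ℝ) 1 in 𝓝 t₀, (t : ℝ) < 1 :=
      continuous_subtype_val.continuousAt.eventually (gt_mem_nhds h0)
    filter_upwards [hev] with t ht
    refine hsame t ?_ ?_
    · rw [Icc_chartedSpaceChartAt_of_le_top h0, Icc_chartedSpaceChartAt_of_le_top ht]
    · simp only [intervalChartSign, h0, ht]
  · refine Eventually.of_forall fun t => ?_
    by_cases ht : (t : ℝ) < 1
    -- The only case with a genuine change of chart: `t₀ = 1` and `t < 1`.
    · have hfun : (extChartAt (𝓡∂ 1) t₀ : Icc (0 : ℝ) 1 → EuclideanSpace ℝ (Fin 1)) =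
          fun s => EuclideanSpace.single 0 1 - extChartAt (𝓡∂ 1) t s := by
        funext s
        rw [extChartAt, extChartAt, Icc_chartedSpaceChartAt_of_le_top ht,
          Icc_chartedSpaceChartAt_of_top_le (not_lt.1 h0)]
        ext i
        fin_cases i
        simp [IccLeftChart, IccRightChart, modelWithCornersEuclideanHalfSpace]
      have hd : MDifferentiableAt (𝓡∂ 1) 𝓘(ℝ, EuclideanSpace ℝ (Fin 1)) (extChartAt (𝓡∂ 1) t) t :=
        mdifferentiableAt_extChartAt (mem_chart_source _ t)
      have h1 : tangentMapAt (𝓡∂ 1) 𝓘(ℝ, EuclideanSpace ℝ (Fin 1))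
          (fun s => EuclideanSpace.single 0 1 - extChartAt (𝓡∂ 1) t s) t =
          0 - ContinuousLinearMap.id ℝ _ := by
        rw [← hself t, ← tangentMapAt_const (I := 𝓡∂ 1)
          (I' := 𝓘(ℝ, EuclideanSpace ℝ (Fin 1))) (EuclideanSpace.single (0 : Fin 1) (1 : ℝ)) t]
        exact mfderiv_sub mdifferentiableAt_const hd
      rw [hfun, h1]
      simp only [intervalChartSign, h0, ht, if_true, if_false, mul_one, zero_sub]
      exact (neg_one_smul ℝ (ContinuousLinearMap.id ℝ (EuclideanSpace ℝ (Fin 1)))).symm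
    · refine hsame t ?_ ?_
      · rw [Icc_chartedSpaceChartAt_of_top_le (not_lt.1 h0),
          Icc_chartedSpaceChartAt_of_top_le (not_lt.1 ht)]
      · simp only [intervalChartSign, h0, ht]

variable {M : Type*} [TopologicalSpace M] [ChartedSpace (EuclideanSpace ℝ (Fin m)) M]
  [IsManifold (𝓡 m) ∞ M]

theorem tangentMapAt_extChartAt_prod {E E' H H' : Type*} [NormedAddCommGroup E] [NormedSpace ℝ E]
    [NormedAddCommGroup E'] [NormedSpace ℝ E'] [TopologicalSpace H] [TopologicalSpace H']
    {I : ModelWithCorners ℝ E H} {I' : ModelWithCorners ℝ E' H'}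
    {N N' : Type*} [TopologicalSpace N] [ChartedSpace H N] [IsManifold I ∞ N]
    [TopologicalSpace N'] [ChartedSpace H' N'] [IsManifold I' ∞ N'] (p₀ p : N × N')
    (h₁ : p.1 ∈ (extChartAt I p₀.1).source) (h₂ : p.2 ∈ (extChartAt I' p₀.2).source) (w : E × E') :
    tangentMapAt (I.prod I') 𝓘(ℝ, E × E') (extChartAt (I.prod I') p₀) p w =
      (tangentMapAt I 𝓘(ℝ, E) (extChartAt I p₀.1) p.1 w.1,
        tangentMapAt I' 𝓘(ℝ, E') (extChartAt I' p₀.2) p.2 w.2) := by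
  have hd : MDifferentiableAt (I.prod I') 𝓘(ℝ, E × E') (extChartAt (I.prod I') p₀) p := by
    refine mdifferentiableAt_extChartAt ?_
    rw [← extChartAt_source (I.prod I'), extChartAt_prod]
    exact ⟨h₁, h₂⟩
  have hd₁ : MDifferentiableAt I 𝓘(ℝ, E) (extChartAt I p₀.1) p.1 :=
    mdifferentiableAt_extChartAt (by simpa using h₁)
  have hd₂ : MDifferentiableAt I' 𝓘(ℝ, E') (extChartAt I' p₀.2) p.2 :=
    mdifferentiableAt_extChartAt (by simpa using h₂)
  refine Prod.ext ?_ ?_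
  · have h3 := mfderiv_comp (I' := 𝓘(ℝ, E × E')) (I'' := 𝓘(ℝ, E)) p
      ((ContinuousLinearMap.fst ℝ E E').mdifferentiableAt (x := extChartAt (I.prod I') p₀ p)) hd
    rw [ContinuousLinearMap.mfderiv_eq] at h3
    have h4 := mfderiv_comp (I := I.prod I') (I' := I) (I'' := 𝓘(ℝ, E)) (f := Prod.fst) p hd₁
      mdifferentiableAt_fst
    rw [mfderiv_fst] at h4
    have h5 : (ContinuousLinearMap.fst ℝ E E' ∘ extChartAt (I.prod I') p₀) =
        extChartAt I p₀.1 ∘ Prod.fst := by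
      rw [extChartAt_prod]
      rfl
    rw [h5] at h3
    exact congrArg (fun L : (E × E') →L[ℝ] E => L w) (h3.symm.trans h4)
  · have h3 := mfderiv_comp (I' := 𝓘(ℝ, E × E')) (I'' := 𝓘(ℝ, E')) p
      ((ContinuousLinearMap.snd ℝ E E').mdifferentiableAt (x := extChartAt (I.prod I') p₀ p)) hd
    rw [ContinuousLinearMap.mfderiv_eq] at h3
    have h4 := mfderiv_comp (I := I.prod I') (I' := I') (I'' := 𝓘(ℝ, E')) (f := Prod.snd) p hd₂
      mdifferentiableAt_snd
    rw [mfderiv_snd] at h4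
    have h5 : (ContinuousLinearMap.snd ℝ E E' ∘ extChartAt (I.prod I') p₀) =
        extChartAt I' p₀.2 ∘ Prod.snd := by
      rw [extChartAt_prod]
      rfl
    rw [h5] at h3
    exact congrArg (fun L : (E × E') →L[ℝ] E' => L w) (h3.symm.trans h4)

/-- The orientation of `M × [0, 1]` for which the boundary orientation of `M × {1}` is that
of `M`. -/
def cylinderOrientation (o : ManifoldOrientation (𝓡 m) M m) :
    ManifoldOrientation (halfSpaceModel m) (M × Icc (0 : ℝ) 1) (m + 1) where
  toFun p := orientationOfSign (cylinderBasis m)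
    (orientationSign (EuclideanSpace.basisFun (Fin m) ℝ).toBasis (o p.1) * intervalChartSign p.2)
  locally_constant p₀ := by
    set e := (EuclideanSpace.basisFun (Fin m) ℝ).toBasis
    have h1 := (continuousAt_fst (p := p₀)).eventually (o.locally_constant p₀.1)
    have h2 := (continuousAt_snd (p := p₀)).eventually (tangentMapAt_extChartAt_Icc p₀.2)
    have h3 := (continuousAt_fst (p := p₀)).eventually (extChartAt_source_mem_nhds (I := 𝓡 m) p₀.1)
    have h4 := (continuousAt_snd (p := p₀)).eventually
      (extChartAt_source_mem_nhds (I := 𝓡∂ 1) p₀.2)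
    filter_upwards [h1, h2, h3, h4] with p hp1 hp2 hp3 hp4 μ hμ
    have hs : ∀ q : M × Icc (0 : ℝ) 1, orientationSign e (o q.1) * intervalChartSign q.2 ≠ 0 :=
      fun q => mul_ne_zero (orientationSign_ne_zero _ _) (intervalChartSign_ne_zero _)
    rw [isPositiveForm_orientationOfSign _ (hs _)] at hμ ⊢
    set ν := (μ.curryLeft (0, EuclideanSpace.single 0 1)).compLinearMap
      (LinearMap.inl ℝ (EuclideanSpace ℝ (Fin m)) (EuclideanSpace ℝ (Fin 1))) with hν
    rw [alternatingMap_cylinderBasis, ← hν] at hμ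
    -- Rescaling by the chart sign turns a form positive on the cylinder into one positive on `M`,
    -- to which local constancy of `o` applies.
    have h5 := hp1 (intervalChartSign p₀.2 • ν) (by
      rw [isPositiveForm_iff e, AlternatingMap.smul_apply, smul_eq_mul, ← mul_assoc]
      exact hμ)
    rw [isPositiveForm_iff e] at h5
    set A := tangentMapAt (𝓡 m) 𝓘(ℝ, EuclideanSpace ℝ (Fin m)) (extChartAt (𝓡 m) p₀.1) p.1
    have h6 : ∀ i, (tangentMapAt (halfSpaceModel m) 𝓘(ℝ, _) (extChartAt (halfSpaceModel m) p₀) p)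
        (cylinderBasis m i) = Fin.cons (α := fun _ => EuclideanSpace ℝ (Fin m) ×
          EuclideanSpace ℝ (Fin 1)) ((intervalChartSign p₀.2 * intervalChartSign p.2) •
          (0, EuclideanSpace.single 0 1)) (fun i => (A (e i), 0)) i := by
      intro i
      refine (tangentMapAt_extChartAt_prod p₀ p hp3 hp4 _).trans ?_
      refine Fin.cases ?_ (fun i => ?_) i
      · rw [cylinderBasis_zero, hp2, Fin.cons_zero]
        simp
      · rw [cylinderBasis_succ, Fin.cons_succ]
        simp [e, A]
    have h7 : μ (fun i => (tangentMapAt (halfSpaceModel m) 𝓘(ℝ, _)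
        (extChartAt (halfSpaceModel m) p₀) p) (cylinderBasis m i)) =
        (intervalChartSign p₀.2 * intervalChartSign p.2) * ν (fun i => A (e i)) := by
      simp only [h6]
      change μ.curryLeft _ _ = _
      rw [map_smul]
      rfl
    have h8 : 0 < orientationSign e (o p.1) * (intervalChartSign p₀.2 * ν (fun i => A (e i))) := h5
    refine lt_of_lt_of_eq h8 ?_
    change _ = _ * μ (fun i => (tangentMapAt (halfSpaceModel m) 𝓘(ℝ, _)
        (extChartAt (halfSpaceModel m) p₀) p) (cylinderBasis m i))
    rw [h7]
    linear_combination (- orientationSign e (o p.1) * intervalChartSign p₀.2 *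
      ν (fun i => A (e i))) * intervalChartSign_mul_self p.2

theorem isPositiveForm_cylinderOrientation (o : ManifoldOrientation (𝓡 m) M m)
    (p : M × Icc (0 : ℝ) 1)
    (μ : (EuclideanSpace ℝ (Fin m) × EuclideanSpace ℝ (Fin 1)) [⋀^Fin (m + 1)]→ₗ[ℝ] ℝ) :
    IsPositiveForm (cylinderOrientation o p) μ ↔
      0 < orientationSign (EuclideanSpace.basisFun (Fin m) ℝ).toBasis (o p.1) *
        intervalChartSign p.2 * μ (cylinderBasis m) :=
  isPositiveForm_orientationOfSign _
    (mul_ne_zero (orientationSign_ne_zero _ _) (intervalChartSign_ne_zero _)) μ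

end Cylinder

/-! ### Properness of the pairing and of the moment map -/

section Properness

/-- Since `|⟨Φ, v⟩| ≤ ‖Φ‖ ‖v‖` and `v` is bounded, a bound on `Φ` bounds the pairing. The preimage
of a compact set is then closed in a compact set. -/
theorem isProperMap_of_isProperMap_apply {𝔤 : Type*} [NormedAddCommGroup 𝔤] [NormedSpace ℝ 𝔤]
    [FiniteDimensional ℝ 𝔤] {S : Type*} [TopologicalSpace S] {Φ : S → 𝔤 →L[ℝ] ℝ} {v : S → 𝔤}
    (hΦ : Continuous Φ) (hv : Bornology.IsBounded (range v))
    (hproper : IsProperMap fun x => Φ x (v x)) : IsProperMap Φ := by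
  have : ProperSpace (𝔤 →L[ℝ] ℝ) := FiniteDimensional.proper_real _
  refine isProperMap_iff_isCompact_preimage.2 ⟨hΦ, fun K hK => ?_⟩
  obtain ⟨C, hC⟩ := hv.exists_norm_le
  obtain ⟨R, hR⟩ := hK.isBounded.exists_norm_le
  refine (hproper.isCompact_preimage (isCompact_closedBall 0 (R * C))).of_isClosed_subset
    (hK.isClosed.preimage hΦ) fun x hx => ?_
  rw [mem_preimage, mem_closedBall_zero_iff]
  refine ((Φ x).le_opNorm _).trans ?_
  have h1 := hR _ hx
  exact mul_le_mul h1 (hC _ (mem_range_self x)) (norm_nonneg _) ((norm_nonneg _).trans h1)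

/-- Here `f` is the original pairing, `q = Θ(v♯)`, and the added term is nonnegative. An upper bound
`c` on the sum therefore confines `f` to a bounded interval and limits the added term, which
prevents approach to the removed points `F = 0`, `t = 1`, where `q > 0`. -/
theorem isProperMap_cylinder {M : Type*} [TopologicalSpace M] {f q F : M → ℝ} (hf : IsProperMap f)
    (hfb : BddBelow (range f)) (hq : Continuous q) (hF : Continuous F) (hq0 : ∀ x, 0 ≤ q x)
    (hF0 : ∀ x, 0 ≤ F x) (hqF : ∀ x, F x = 0 → q x ≠ 0)
    (W : TopologicalSpace.Opens (M × Icc (0 : ℝ) 1))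
    (hW : ∀ p, p ∈ W ↔ 0 < F p.1 + (1 - (p.2 : ℝ))) :
    IsProperMap fun w : W => f w.1.1 + (w.1.2 : ℝ) / (F w.1.1 + (1 - (w.1.2 : ℝ))) * q w.1.1 := by
  have hfc := hf.continuous
  have hden : ∀ w : W, F w.1.1 + (1 - (w.1.2 : ℝ)) ≠ 0 := fun w => ((hW _).1 w.2).ne'
  have hc : Continuous fun w : W =>
      f w.1.1 + (w.1.2 : ℝ) / (F w.1.1 + (1 - (w.1.2 : ℝ))) * q w.1.1 := by
    refine Continuous.add (by fun_prop) (Continuous.mul (Continuous.div ?_ ?_ hden) (by fun_prop))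
    · fun_prop
    · fun_prop
  refine isProperMap_iff_isCompact_preimage.2 ⟨hc, fun K hK => ?_⟩
  obtain ⟨b, hb⟩ := hfb
  obtain ⟨c, hcK⟩ := hK.bddAbove
  -- The bound by `c`, cleared of its denominator, makes sense on the whole cylinder and cuts out a
  -- compact set there. At a removed point it would read `q ≤ 0`, so this compact set lies inside
  -- `W`.
  let T : Set (M × Icc (0 : ℝ) 1) := ((f ⁻¹' Icc b c) ×ˢ univ) ∩
    {p | (p.2 : ℝ) * q p.1 ≤ (c - f p.1) * (F p.1 + (1 - (p.2 : ℝ)))}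
  have hT : IsCompact T := ((hf.isCompact_preimage isCompact_Icc).prod isCompact_univ).inter_right
    (isClosed_le (by fun_prop) (by fun_prop))
  have hTW : T ⊆ range (Subtype.val : W → M × Icc (0 : ℝ) 1) := by
    rintro p ⟨-, hp⟩
    rw [Subtype.range_coe]
    refine (hW p).2 (lt_of_le_of_ne (add_nonneg (hF0 _) (sub_nonneg.2 p.2.2.2)) fun h => ?_)
    have h1 := hF0 p.1
    have h2 : (p.2 : ℝ) ≤ 1 := p.2.2.2
    have h3 : F p.1 = 0 := by linarith
    have h4 : (p.2 : ℝ) = 1 := by linarith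
    have hp' : (p.2 : ℝ) * q p.1 ≤ (c - f p.1) * (F p.1 + (1 - (p.2 : ℝ))) := hp
    rw [← h, mul_zero, h4, one_mul] at hp'
    exact hqF _ h3 (le_antisymm hp' (hq0 _))
  refine (IsInducing.subtypeVal.isCompact_preimage' hT hTW).of_isClosed_subset
    (hK.isClosed.preimage hc) fun w hw => ?_
  have hw' : f w.1.1 + (w.1.2 : ℝ) / (F w.1.1 + (1 - (w.1.2 : ℝ))) * q w.1.1 ≤ c := hcK hw
  have hpos := (hW _).1 w.2
  have ht : (0 : ℝ) ≤ (w.1.2 : ℝ) := w.1.2.2.1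
  have hnn : 0 ≤ (w.1.2 : ℝ) / (F w.1.1 + (1 - (w.1.2 : ℝ))) * q w.1.1 :=
    mul_nonneg (div_nonneg ht hpos.le) (hq0 _)
  refine ⟨⟨⟨hb (mem_range_self _), by linarith⟩, mem_univ _⟩, ?_⟩
  change (w.1.2 : ℝ) * q w.1.1 ≤ (c - f w.1.1) * (F w.1.1 + (1 - (w.1.2 : ℝ)))
  rw [div_mul_eq_mul_div] at hw'
  rw [← div_le_iff₀ hpos]
  linarith

end Properness

/-! ### Functoriality of pullbacks and agreement on a subset -/

section Functoriality

variable {𝔤 : Type*} [NormedAddCommGroup 𝔤] [NormedSpace ℝ 𝔤]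
  {G : Type*} [TopologicalSpace G] [ChartedSpace 𝔤 G] [Group G]
  {E : Type*} [NormedAddCommGroup E] [NormedSpace ℝ E]
  {E' : Type*} [NormedAddCommGroup E'] [NormedSpace ℝ E']
  {E'' : Type*} [NormedAddCommGroup E''] [NormedSpace ℝ E'']
  {H : Type*} [TopologicalSpace H] {H' : Type*} [TopologicalSpace H']
  {H'' : Type*} [TopologicalSpace H'']
  {I : ModelWithCorners ℝ E H} {I' : ModelWithCorners ℝ E' H'}
  {I'' : ModelWithCorners ℝ E'' H''}
  {N : Type*} [TopologicalSpace N] [ChartedSpace H N] [MulAction G N]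
  {N' : Type*} [TopologicalSpace N'] [ChartedSpace H' N'] [MulAction G N']
  {N'' : Type*} [TopologicalSpace N''] [ChartedSpace H'' N''] [MulAction G N'']

theorem HamiltonianStructure.ext_of_eq {h h' : HamiltonianStructure 𝔤 G I N}
    (h₁ : h.form = h'.form) (h₂ : h.moment = h'.moment) : h = h' := by
  cases h
  cases h'
  cases h₁
  cases h₂
  rfl

variable [IsManifold I ∞ N] [IsManifold I' ∞ N'] [IsManifold I'' ∞ N'']
  [ContMDiffSMul 𝓘(ℝ, 𝔤) I ∞ G N] [ContMDiffSMul 𝓘(ℝ, 𝔤) I' ∞ G N']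
  [ContMDiffSMul 𝓘(ℝ, 𝔤) I'' ∞ G N'']

theorem EquivariantCohomology.pullback_pullback (f : EquivariantMap G I I' N N')
    (g : EquivariantMap G I' I'' N' N'') (k : EquivariantMap G I I'' N N'')
    (hk : ∀ x, g (f x) = k x) (A : EquivariantCohomology 𝔤 G I'' N'') :
    EquivariantCohomology.pullback f (EquivariantCohomology.pullback g A) =
      EquivariantCohomology.pullback k A := by
  obtain ⟨β, rfl⟩ := Submodule.mkQ_surjective _ A
  refine congrArg (Submodule.mkQ _) (Subtype.ext (funext fun X => funext fun j => ?_))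
  change pullbackForm I I' f (pullbackForm I' I'' g (β.1 X j)) = pullbackForm I I'' k (β.1 X j)
  rw [pullbackForm_pullbackForm g.smooth f.smooth, show (fun x => g (f x)) = k from funext hk]

theorem EquivariantCohomology.pullback_pullback_of_leftInverse (f : EquivariantMap G I I' N N')
    (g : EquivariantMap G I' I N' N) (hfg : ∀ x, g (f x) = x) (A : EquivariantCohomology 𝔤 G I N) :
    EquivariantCohomology.pullback f (EquivariantCohomology.pullback g A) = A := by
  obtain ⟨β, rfl⟩ := Submodule.mkQ_surjective _ A
  refine congrArg (Submodule.mkQ _) (Subtype.ext (funext fun X => funext fun j => ?_))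
  change pullbackForm I I' f (pullbackForm I' I g (β.1 X j)) = β.1 X j
  rw [pullbackForm_pullbackForm g.smooth f.smooth,
    show (fun x => g (f x)) = fun x => x from funext hfg, pullbackForm_id]

theorem contractFundamental_pullbackForm [IsManifold 𝓘(ℝ, 𝔤) ∞ G] (f : EquivariantMap G I I' N N') (β : RawForm E' N' 1)
    (x : N) (X : 𝔤) :
    contractFundamental 𝔤 G I (pullbackForm I I' f β) x X =
      β (f x) ![fundamentalField G I' X (f x)] := by
  rw [contractFundamental_apply, pullbackForm_apply]
  congr 1
  funext i
  fin_cases i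
  exact tangentMapAt_fundamentalField f X x

theorem IsInvariantForm.pullbackForm {β : RawForm E' N' 1} (hβ : IsInvariantForm G I' β)
    (f : EquivariantMap G I I' N N') (hs : ∀ g : G, ContMDiff I I ∞ (fun x : N => g • x))
    (hs' : ∀ g : G, ContMDiff I' I' ∞ (fun x : N' => g • x)) :
    IsInvariantForm G I (_root_.pullbackForm I I' f β) := by
  intro g
  rw [pullbackForm_comm f g (hs g) (hs' g), hβ]

theorem IsInvariantForm.funSmul {k : ℕ} {β : RawForm E N k} (hβ : IsInvariantForm G I β)
    {ρ : N → ℝ} (hρ : ∀ (g : G) x, ρ (g • x) = ρ x) :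
    IsInvariantForm G I (_root_.funSmul ρ β) := by
  intro g
  rw [pullbackForm_funSmul, hβ]
  simp only [hρ]

/-- A smooth map on an open subset of `ℝ^m` agrees near every point with the restriction of a
smooth map on `ℝ^m` with the same values. -/
theorem exists_contMDiff_eventuallyEq {m : ℕ} {D : Set (EuclideanSpace ℝ (Fin m))} (hD : IsOpen D)
    {p : EuclideanSpace ℝ (Fin m) → N} (hp : ContMDiffOn (𝓡 m) I ∞ p D)
    {u : EuclideanSpace ℝ (Fin m)} (hu : u ∈ D) :
    ∃ φ : EuclideanSpace ℝ (Fin m) → EuclideanSpace ℝ (Fin m), (∀ y, φ y ∈ D) ∧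
      ContMDiff (𝓡 m) I ∞ (fun y => p (φ y)) ∧ p =ᶠ[𝓝 u] fun y => p (φ y) := by
  obtain ⟨r, hr, hball⟩ := Metric.isOpen_iff.1 hD u hu
  let χ : ContDiffBump u := ⟨r / 2, r, half_pos hr, half_lt_self hr⟩
  -- The cut-off shrinks `y - u` so that all of `ℝ^m` lands in a ball inside `D`, and `φ` is the
  -- identity near `u`.
  let φ : EuclideanSpace ℝ (Fin m) → EuclideanSpace ℝ (Fin m) := fun y => u + χ y • (y - u)
  have hφ : ContDiff ℝ ∞ φ := contDiff_const.add (χ.contDiff.smul (contDiff_id.sub contDiff_const))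
  have hφD : ∀ y, φ y ∈ D := by
    intro y
    refine hball ?_
    rw [Metric.mem_ball, dist_eq_norm]
    simp only [φ, add_sub_cancel_left, norm_smul, Real.norm_eq_abs, abs_of_nonneg χ.nonneg]
    by_cases hy : y ∈ Metric.ball u r
    · rw [Metric.mem_ball, dist_eq_norm] at hy
      exact lt_of_le_of_lt (mul_le_of_le_one_left (norm_nonneg _) χ.le_one) hy
    · rw [χ.zero_of_le_dist (not_lt.1 hy), zero_mul]
      exact hr
  refine ⟨φ, hφD, hp.comp_contMDiff hφ.contMDiff hφD, ?_⟩
  filter_upwards [χ.eventuallyEq_one] with y hy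
  have hy' : χ y = 1 := hy
  simp only [φ, hy', one_smul, add_sub_cancel]

/-- If `β` vanishes at the points of `Y`, then `p^* dβ = d(p^* β) = 0` for every `p` into `Y`. The
form `dβ` itself need not vanish at the points of `Y`, which is why agreement is tested by
pullbacks. -/
theorem agreeOn_of_sub_extD {Y : Set N} {σ σ' : RawForm E N 2} {Φ Φ' : N → 𝔤 →L[ℝ] ℝ}
    {β : RawForm E N 1} (hβ : β ∈ smoothForms I N 1) (hσ : σ' = σ - extD I β)
    (hβY : ∀ x ∈ Y, β x = 0) (hΦ : ∀ x ∈ Y, Φ' x = Φ x) : AgreeOn 𝔤 I Y σ' Φ' σ Φ := by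
  intro m _ D hD p hp hpY u hu
  refine ⟨?_, hΦ _ (hpY hu)⟩
  -- Commuting `d` with pullback is available for globally smooth maps, so `p` is first replaced by
  -- one that agrees with it near `u` and still maps into `Y`.
  obtain ⟨φ, hφD, hφ, hpφ⟩ := exists_contMDiff_eventuallyEq hD hp hu
  rw [hpφ.pullbackForm_eq, hpφ.pullbackForm_eq, hσ]
  have h1 : pullbackForm (𝓡 m) I (fun y => p (φ y)) (extD I β) = 0 := by
    rw [← extD_pullbackForm hφ hβ]
    have h2 : pullbackForm (𝓡 m) I (fun y => p (φ y)) β = 0 := by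
      funext y
      rw [pullbackForm, hβY _ (hpY (hφD y))]
      rfl
    rw [h2, extD_zero]
  change pullbackForm (𝓡 m) I (fun y => p (φ y)) σ u -
    pullbackForm (𝓡 m) I (fun y => p (φ y)) (extD I β) u = _
  rw [h1]
  exact sub_zero _

theorem tangentMapAt_subtype_val (U : TopologicalSpace.Opens N) (x : U) :
    tangentMapAt I I (Subtype.val : U → N) x = ContinuousLinearMap.id ℝ E := by
  have h1 : MDifferentiableAt I 𝓘(ℝ, E) (extChartAt I (x : N)) (x : N) :=
    mdifferentiableAt_extChartAt (mem_chart_source _ _)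
  have hval : MDifferentiableAt I I (Subtype.val : U → N) x :=
    (contMDiff_subtype_val (n := ∞)).mdifferentiable (by simp) x
  have h2 : tangentMapAt I 𝓘(ℝ, E) (extChartAt I (x : N) ∘ (Subtype.val : U → N)) x =
      (tangentMapAt I 𝓘(ℝ, E) (extChartAt I (x : N)) x).comp
        (tangentMapAt I I (Subtype.val : U → N) x) :=
    mfderiv_comp x h1 hval
  have h3 : tangentMapAt I 𝓘(ℝ, E) (extChartAt I (x : N) ∘ (Subtype.val : U → N)) x =
      ContinuousLinearMap.id ℝ E := tangentMapAt_extChartAt_self (I := I) x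
  rw [h3, tangentMapAt_extChartAt_self, ContinuousLinearMap.id_comp] at h2
  exact h2.symm

end Functoriality

/-! ### The action on the cylinder and the punctured cylinder -/

section CylinderAction

variable {𝔤 : Type*} [NormedAddCommGroup 𝔤] [NormedSpace ℝ 𝔤]
  {G : Type*} [TopologicalSpace G] [ChartedSpace 𝔤 G] [Group G]
  {m : ℕ} {M : Type*} [TopologicalSpace M] [ChartedSpace (EuclideanSpace ℝ (Fin m)) M]
  [MulAction G M]

/-- The action on the first factor of `M × [0, 1]`. -/
instance cylinderMulAction : MulAction G (M × Icc (0 : ℝ) 1) where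
  smul g p := (g • p.1, p.2)
  one_smul p := Prod.ext (one_smul G p.1) rfl
  mul_smul g h p := Prod.ext (mul_smul g h p.1) rfl

instance cylinderContMDiffSMul [ContMDiffSMul 𝓘(ℝ, 𝔤) (𝓡 m) ∞ G M] :
    ContMDiffSMul 𝓘(ℝ, 𝔤) (halfSpaceModel m) ∞ G (M × Icc (0 : ℝ) 1) where
  contMDiff_smul := by
    have h1 : ContMDiff (𝓘(ℝ, 𝔤).prod (halfSpaceModel m)) (𝓡 m) ∞
        (fun p : G × (M × Icc (0 : ℝ) 1) => p.1 • p.2.1) :=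
      (contMDiff_action (𝔤 := 𝔤) (G := G) (I := 𝓡 m) (N := M)).comp
        (contMDiff_fst.prodMk (contMDiff_fst.comp contMDiff_snd))
    exact h1.prodMk (contMDiff_snd.comp contMDiff_snd)

/-- The open subset `{(x, t) | 0 < F x + (1 - t)}` of `M × [0, 1]`. -/
def cylinderOpens (G : Type*) [Group G] [MulAction G M] (F : M → ℝ) (hF : Continuous F)
    (hinv : ∀ (g : G) x, F (g • x) = F x) : InvariantOpens G (M × Icc (0 : ℝ) 1) where
  opens := ⟨{p | 0 < F p.1 + (1 - (p.2 : ℝ))}, isOpen_lt (by fun_prop) (by fun_prop)⟩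
  smul_mem g p hp := by
    change 0 < F (g • p.1) + (1 - (p.2 : ℝ))
    rw [hinv]
    exact hp

end CylinderAction

/-! ### The two ends of the punctured cylinder -/

section CobordismConstruction

universe u

variable {𝔤 : Type*} [NormedAddCommGroup 𝔤] [NormedSpace ℝ 𝔤]
  {G : Type*} [TopologicalSpace G] [ChartedSpace 𝔤 G] [Group G]
  [LieGroup 𝓘(ℝ, 𝔤) ∞ G]
  {m : ℕ} {M : Type u} [TopologicalSpace M]
  [ChartedSpace (EuclideanSpace ℝ (Fin m)) M] [IsManifold (𝓡 m) ∞ M]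
  [MulAction G M] [ContMDiffSMul 𝓘(ℝ, 𝔤) (𝓡 m) ∞ G M]

variable (G m) in
/-- The projection of an invariant open subset of `M × [0, 1]` to `M`. -/
def cylinderProj (W : InvariantOpens G (M × Icc (0 : ℝ) 1)) :
    EquivariantMap G (halfSpaceModel m) (𝓡 m) W.opens M where
  toFun w := w.1.1
  smooth := contMDiff_fst.comp contMDiff_subtype_val
  equivariant _ _ := rfl

variable (m) in
/-- The inclusion of `M × {0}`. -/
def cylinderBottom (W : InvariantOpens G (M × Icc (0 : ℝ) 1))
    (hW : ∀ x, ((x, 0) : M × Icc (0 : ℝ) 1) ∈ W.opens) :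
    EquivariantMap G (𝓡 m) (halfSpaceModel m) M W.opens where
  toFun x := ⟨(x, 0), hW x⟩
  smooth := by
    rw [← ContMDiff.subtypeVal_comp_iff]
    exact contMDiff_id.prodMk contMDiff_const
  equivariant _ _ := rfl

variable (m) in
/-- The inclusion of `U × {1}`. -/
def cylinderTop (W : InvariantOpens G (M × Icc (0 : ℝ) 1)) (U : InvariantOpens G M)
    (hU : ∀ x ∈ U.opens, ((x, 1) : M × Icc (0 : ℝ) 1) ∈ W.opens) :
    EquivariantMap G (𝓡 m) (halfSpaceModel m) U.opens W.opens where
  toFun x := ⟨(x.1, 1), hU x x.2⟩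
  smooth := by
    rw [← ContMDiff.subtypeVal_comp_iff]
    exact contMDiff_subtype_val.prodMk contMDiff_const
  equivariant _ _ := rfl

variable (W : InvariantOpens G (M × Icc (0 : ℝ) 1)) (U : InvariantOpens G M)
  (hW : ∀ x, ((x, 0) : M × Icc (0 : ℝ) 1) ∈ W.opens)
  (hU : ∀ x ∈ U.opens, ((x, 1) : M × Icc (0 : ℝ) 1) ∈ W.opens)

theorem tangentMapAt_cylinderBottom (x : M) :
    tangentMapAt (𝓡 m) (halfSpaceModel m) (cylinderBottom m W hW) x =
      ContinuousLinearMap.inl ℝ _ _ := by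
  have h := tangentMapAt_comp (contMDiff_subtype_val (n := ∞) (I := halfSpaceModel m))
    (cylinderBottom m W hW).smooth x
  rw [tangentMapAt_subtype_val, ContinuousLinearMap.id_comp] at h
  exact h.symm.trans mfderiv_prod_left

theorem tangentMapAt_cylinderTop (x : U.opens) :
    tangentMapAt (𝓡 m) (halfSpaceModel m) (cylinderTop m W U hU) x =
      ContinuousLinearMap.inl ℝ _ _ := by
  have h := tangentMapAt_comp (contMDiff_subtype_val (n := ∞) (I := halfSpaceModel m))
    (cylinderTop m W U hU).smooth x
  rw [tangentMapAt_subtype_val, ContinuousLinearMap.id_comp] at h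
  have h1 : ContMDiff (𝓡 m) (halfSpaceModel m) ∞ (fun y : M => (y, (1 : Icc (0 : ℝ) 1))) :=
    contMDiff_id.prodMk contMDiff_const
  have h2 := tangentMapAt_comp h1 (contMDiff_subtype_val (n := ∞) (I := 𝓡 m) (U := U.opens)) x
  rw [tangentMapAt_subtype_val, ContinuousLinearMap.comp_id] at h2
  exact h.symm.trans (h2.trans mfderiv_prod_left)

/-- At `t = 0` the chart sign is `1`, and an outward vector has negative last coordinate;
contracting with it reverses the sign and produces `-o`. -/
theorem preservesBoundaryOrientation_cylinderBottom (o : ManifoldOrientation (𝓡 m) M m) :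
    PreservesBoundaryOrientation (cylinderBottom m W hW) (fun x => -o x)
      ((cylinderOrientation o).restrict W.opens) := by
  intro x ν hν μ hμ
  set e := (EuclideanSpace.basisFun (Fin m) ℝ).toBasis
  have h1 := (isPositiveForm_cylinderOrientation o (x, 0) μ).1 hμ
  have h2 : intervalChartSign 0 = 1 := if_pos zero_lt_one
  rw [tangentMapAt_cylinderBottom, isPositiveForm_neg, isPositiveForm_iff e,
    AlternatingMap.neg_apply]
  have h3 : (μ.curryLeft ν).compLinearMap
      ((ContinuousLinearMap.inl ℝ (EuclideanSpace ℝ (Fin m)) (EuclideanSpace ℝ (Fin 1)) :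
        _ →L[ℝ] _) : _ →ₗ[ℝ] _) e = ν.2 0 * μ (cylinderBasis m) := curryLeft_inl_cylinder μ ν
  rw [h3]
  simp only [h2, mul_one] at h1
  have h4 : ν.2 0 < 0 := hν
  nlinarith [mul_pos (neg_pos.2 h4) h1]

/-- At `t = 1` the chart is `1 - t`, with sign `-1`, and this cancels the negative last coordinate
of the outward vector. -/
theorem preservesBoundaryOrientation_cylinderTop (o : ManifoldOrientation (𝓡 m) M m) :
    PreservesBoundaryOrientation (cylinderTop m W U hU) (o.restrict U.opens)
      ((cylinderOrientation o).restrict W.opens) := by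
  intro x ν hν μ hμ
  set e := (EuclideanSpace.basisFun (Fin m) ℝ).toBasis
  have h1 := (isPositiveForm_cylinderOrientation o (x.1, 1) μ).1 hμ
  have h2 : intervalChartSign 1 = -1 := if_neg (lt_irrefl _)
  rw [tangentMapAt_cylinderTop, isPositiveForm_iff e]
  have h3 : (μ.curryLeft ν).compLinearMap
      ((ContinuousLinearMap.inl ℝ (EuclideanSpace ℝ (Fin m)) (EuclideanSpace ℝ (Fin 1)) :
        _ →L[ℝ] _) : _ →ₗ[ℝ] _) e = ν.2 0 * μ (cylinderBasis m) := curryLeft_inl_cylinder μ ν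
  rw [h3]
  simp only [h2] at h1
  have h4 : ν.2 0 < 0 := hν
  change 0 < orientationSign e (o x.1) * _
  nlinarith [mul_pos (neg_pos.2 h4) h1]

theorem isClosedEmbedding_cylinderBottom [T2Space M] :
    IsClosedEmbedding (cylinderBottom m W hW) :=
  Function.LeftInverse.isClosedEmbedding (f := cylinderProj G m W) (fun _ => rfl)
    (cylinderProj G m W).smooth.continuous (cylinderBottom m W hW).smooth.continuous

theorem isClosedEmbedding_cylinderTop (hU' : ∀ x, ((x, 1) : M × Icc (0 : ℝ) 1) ∈ W.opens →
    x ∈ U.opens) : IsClosedEmbedding (cylinderTop m W U hU) where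
  toIsEmbedding := by
    refine IsEmbedding.of_comp (cylinderTop m W U hU).smooth.continuous
      (cylinderProj G m W).smooth.continuous ?_
    exact IsEmbedding.subtypeVal
  isClosed_range := by
    have h : range (cylinderTop m W U hU) = {w : W.opens | w.1.2 = 1} := by
      ext w
      constructor
      · rintro ⟨x, rfl⟩
        rfl
      · intro hw
        have hw' : w.1 = (w.1.1, 1) := Prod.ext rfl hw
        exact ⟨⟨w.1.1, hU' _ (hw' ▸ w.2)⟩, Subtype.ext hw'.symm⟩
    rw [h]
    exact isClosed_eq (continuous_snd.comp continuous_subtype_val) continuous_const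

/-- Each end is closed in `W`: the bottom is a section of the projection to the Hausdorff space `M`,
the top is the slice `t = 1`. Two closed embeddings with disjoint images combine to an embedding of
the disjoint union. -/
theorem isEmbedding_cylinderBoundary [T2Space M]
    (hU' : ∀ x, ((x, 1) : M × Icc (0 : ℝ) 1) ∈ W.opens → x ∈ U.opens) :
    IsEmbedding (Sum.elim (cylinderBottom m W hW) (cylinderTop m W U hU)) := by
  refine ((isClosedEmbedding_cylinderBottom W hW).sumElim
    (isClosedEmbedding_cylinderTop W U hU hU') ?_).isEmbedding
  rintro (x | x) (y | y) h
  · exact congrArg _ ((isClosedEmbedding_cylinderBottom (m := m) W hW).injective h)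
  · exact absurd (congrArg (fun w : W.opens => w.1.2) h) (zero_ne_one (α := Icc (0 : ℝ) 1))
  · exact absurd (congrArg (fun w : W.opens => w.1.2) h) (one_ne_zero (α := Icc (0 : ℝ) 1))
  · exact congrArg _ ((isClosedEmbedding_cylinderTop (m := m) W U hU hU').injective h)

theorem range_cylinderBoundary
    (hU' : ∀ x, ((x, 1) : M × Icc (0 : ℝ) 1) ∈ W.opens → x ∈ U.opens) :
    range (Sum.elim (cylinderBottom m W hW) (cylinderTop m W U hU)) =
      (halfSpaceModel m).boundary W.opens := by
  rw [ModelWithCorners.boundary_open, ModelWithCorners.boundary_of_boundaryless_left, boundary_Icc]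
  ext w
  constructor
  · rintro ⟨x | x, rfl⟩
    · exact ⟨mem_univ _, Or.inl rfl⟩
    · exact ⟨mem_univ _, Or.inr rfl⟩
  · rintro ⟨-, hw | hw⟩
    · exact ⟨Sum.inl w.1.1, Subtype.ext (Prod.ext rfl (Eq.symm hw))⟩
    · have hw' : w.1 = (w.1.1, 1) := Prod.ext rfl hw
      exact ⟨Sum.inr ⟨w.1.1, hU' _ (hw' ▸ w.2)⟩, Subtype.ext hw'.symm⟩

end CobordismConstruction

/-! ### Construction of the completion and the cobordism -/

theorem exists_polarizedCompletion_cobordism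
    {𝔤 : Type*} [NormedAddCommGroup 𝔤] [NormedSpace ℝ 𝔤] [FiniteDimensional ℝ 𝔤]
    {G : Type*} [TopologicalSpace G] [CompactSpace G] [ChartedSpace 𝔤 G] [Group G]
    [LieGroup 𝓘(ℝ, 𝔤) ∞ G]
    {m : ℕ}
    {M : Type*} [TopologicalSpace M] [T2Space M] [SecondCountableTopology M]
    [ChartedSpace (EuclideanSpace ℝ (Fin m)) M] [IsManifold (𝓡 m) ∞ M]
    [MulAction G M] [ContMDiffSMul 𝓘(ℝ, 𝔤) (𝓡 m) ∞ G M]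
    (o : ManifoldOrientation (𝓡 m) M m)
    (h : HamiltonianStructure 𝔤 G (𝓡 m) M)
    (v : TamingMap 𝔤 G (𝓡 m) M)
    (hv : Bornology.IsBounded (Set.range v))
    (hΦ : IsPolarized v h.moment)
    (U : InvariantOpens G M) (hU : v.localizingSet ⊆ U.opens)
    (A : EquivariantCohomology 𝔤 G (𝓡 m) M) :
    ∃ hZ : HamiltonianStructure 𝔤 G (𝓡 m) U.opens,
      IsPolarizedCompletion (v.pullback (U.incl (𝓡 m))) (h.pullback (U.incl (𝓡 m))) hZ
        (Subtype.val ⁻¹' v.localizingSet) ∧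
      Nonempty (ProperHamiltonianCobordism o h A (o.restrict U.opens) hZ
        (EquivariantCohomology.pullback (U.incl (𝓡 m)) A)) := by
  have : LocallyCompactSpace M := ChartedSpace.locallyCompactSpace (EuclideanSpace ℝ (Fin m)) M
  obtain ⟨Θ, hΘ, hΘinv, hΘ0, hΘne, hΘZ⟩ := exists_invariant_tamingForm v
  obtain ⟨F, hF, hFinv, hF0, hFU⟩ := exists_invariant_support_eq (𝔤 := 𝔤) (I := 𝓡 m) U
  -- `q = Θ(v♯)` is continuous with zero set exactly `Z`; this also shows that `Z` is closed.
  let q : M → ℝ := fun x => contractFundamental 𝔤 G (𝓡 m) Θ x (v x)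
  have hq : ∀ x, q x = Θ x ![v.sharp x] := fun x => contractFundamental_apply Θ x (v x)
  have hqc : Continuous q :=
    ((contMDiff_contractFundamental hΘ).clm_apply v.smooth).continuous
  have hZq : v.localizingSet = q ⁻¹' {0} := by
    ext x
    rw [mem_preimage, mem_singleton_iff, hq]
    exact ⟨fun hx => by rw [hΘZ x hx]; rfl, hΘne x⟩
  have hZc : IsClosed v.localizingSet := hZq ▸ isClosed_singleton.preimage hqc
  let W := cylinderOpens G F hF.continuous hFinv
  have hWmem : ∀ p : M × Icc (0 : ℝ) 1, p ∈ W.opens ↔ 0 < F p.1 + (1 - (p.2 : ℝ)) :=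
    fun p => Iff.rfl
  have hW : ∀ x, ((x, 0) : M × Icc (0 : ℝ) 1) ∈ W.opens := fun x =>
    (hWmem _).2 (by simpa using add_pos_of_nonneg_of_pos (hF0 x) one_pos)
  have hWU : ∀ x, ((x, 1) : M × Icc (0 : ℝ) 1) ∈ W.opens ↔ x ∈ U.opens := fun x => by
    rw [hWmem, ← hFU]
    simp [(hF0 x).lt_iff_ne']
  let pr := cylinderProj G m W
  let i₀ := cylinderBottom m W hW
  let i₁ := cylinderTop m W U fun x => (hWU x).2
  -- The numerator makes `ρ` vanish on the bottom, so that end is unchanged. The denominator is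
  -- positive on `W` and tends to `0` at the removed points, which yields properness.
  let ρ : W.opens → ℝ := fun w => (w.1.2 : ℝ) / (F w.1.1 + (1 - (w.1.2 : ℝ)))
  have hρ : ContMDiff (halfSpaceModel m) 𝓘(ℝ, ℝ) ∞ ρ := by
    have ht : ContMDiff (halfSpaceModel m) 𝓘(ℝ, ℝ) ∞ (fun w : W.opens => (w.1.2 : ℝ)) :=
      contMDiff_subtypeVal_Icc.comp (contMDiff_snd.comp contMDiff_subtype_val)
    exact ht.div₀ ((hF.comp pr.smooth).add (contMDiff_const.sub ht))
      fun w => ((hWmem _).1 w.2).ne'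
  let β : RawForm _ W.opens 1 := funSmul ρ (pullbackForm (halfSpaceModel m) (𝓡 m) pr Θ)
  have hβ : β ∈ smoothForms (halfSpaceModel m) W.opens 1 :=
    funSmul_mem_smoothForms hρ (pullbackForm_mem_smoothForms pr.smooth hΘ)
  have hβinv : IsInvariantForm G (halfSpaceModel m) β := by
    refine IsInvariantForm.funSmul ?_ fun g w => ?_
    · exact hΘinv.pullbackForm pr (contMDiff_smulMap 𝔤) (contMDiff_smulMap 𝔤)
    · change (w.1.2 : ℝ) / (F (g • w.1.1) + (1 - (w.1.2 : ℝ))) = _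
      rw [hFinv]
  have hβX : ∀ w X, contractFundamental 𝔤 G (halfSpaceModel m) β w X =
      ρ w * Θ w.1.1 ![fundamentalField G (𝓡 m) X w.1.1] := by
    intro w X
    have h1 := contractFundamental_pullbackForm pr Θ w X
    rw [contractFundamental_apply] at h1 ⊢
    exact congrArg (ρ w * ·) h1
  let ham := (h.pullback pr).twist β hβ hβinv
  have hham : ∀ w, ham.moment w (v w.1.1) =
      h.moment w.1.1 (v w.1.1) + ρ w * q w.1.1 := by
    intro w
    change h.moment w.1.1 (v w.1.1) + contractFundamental 𝔤 G (halfSpaceModel m) β w (v w.1.1) = _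
    rw [hβX, hq]
    rfl
  have hq0 : ∀ x, 0 ≤ q x := fun x => hq x ▸ hΘ0 x
  -- The assumption `Z ⊆ U` enters here: outside `U` the field `v♯` has no zeros.
  have hqF : ∀ x, F x = 0 → q x ≠ 0 := fun x hx hqx =>
    (hFU x).2 (hU (by rw [hZq]; exact hqx)) hx
  have hproper : IsProperMap fun w : W.opens => ham.moment w (v w.1.1) := by
    simp only [hham]
    exact isProperMap_cylinder hΦ.1 hΦ.2 hqc hF.continuous hq0 hF0 hqF W.opens hWmem
  have hβ₀ : pullbackForm (𝓡 m) (halfSpaceModel m) i₀ β = 0 := by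
    funext x
    have h1 : ρ (i₀ x) = 0 := zero_div _
    ext w
    change ρ (i₀ x) * _ = (0 : ℝ)
    rw [h1, zero_mul]
  have hβ₁ : ∀ x : U.opens, (x : M) ∈ v.localizingSet →
      pullbackForm (𝓡 m) (halfSpaceModel m) i₁ β x = 0 := by
    intro x hx
    ext w
    change ρ (i₁ x) * (Θ x.1 _) = 0
    rw [hΘZ _ hx]
    exact mul_zero _
  -- Stated for an arbitrary smooth map into `W`, so that it serves both ends: on the bottom the
  -- correction is zero, on the top it is `d` of a form vanishing on `Z`.
  have hform : ∀ {N : Type _} [TopologicalSpace N] [ChartedSpace (EuclideanSpace ℝ (Fin m)) N]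
      [IsManifold (𝓡 m) ∞ N] (i : N → W.opens), ContMDiff (𝓡 m) (halfSpaceModel m) ∞ i →
      pullbackForm (𝓡 m) (halfSpaceModel m) i ham.form =
        pullbackForm (𝓡 m) (𝓡 m) (fun x => pr (i x)) h.form -
          extD (𝓡 m) (pullbackForm (𝓡 m) (halfSpaceModel m) i β) := by
    intro N _ _ _ i hi
    rw [← pullbackForm_pullbackForm pr.smooth hi, extD_pullbackForm hi hβ]
    rfl
  refine ⟨ham.pullback i₁, ⟨?_, ?_, ?_, ⟨?_, ?_⟩, ?_⟩, ⟨?_⟩⟩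
  · exact hZc.preimage continuous_subtype_val
  · intro g x hx
    change v.sharp (g • (x : M)) = 0
    rw [v.sharp_smul, show v.sharp (x : M) = 0 from hx, map_zero]
  · have hemb : IsClosedEmbedding
        (fun y : (Subtype.val ⁻¹' v.localizingSet : Set U.opens) => (y : M)) :=
      { toIsEmbedding := IsEmbedding.subtypeVal.comp IsEmbedding.subtypeVal
        isClosed_range := by
          have : range (fun y : (Subtype.val ⁻¹' v.localizingSet : Set U.opens) => (y : M)) =
              v.localizingSet := by
            ext x
            exact ⟨fun ⟨y, hy⟩ => hy ▸ y.2, fun hx => ⟨⟨⟨x, hU hx⟩, hx⟩, rfl⟩⟩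
          rw [this]
          exact hZc }
    exact ⟨hΦ.1.comp hemb.isProperMap, hΦ.2.mono (range_subset_iff.2 fun y => mem_range_self _)⟩
  -- Polarization of the completion is properness on `W` restricted to the closed end `U × {1}`.
  · exact hproper.comp (isClosedEmbedding_cylinderTop W U _ fun x => (hWU x).1).isProperMap
  · obtain ⟨b, hb⟩ := hΦ.2
    refine ⟨b, ?_⟩
    rintro _ ⟨x, rfl⟩
    change b ≤ ham.moment (i₁ x) (v (i₁ x).1.1)
    rw [hham]
    exact (hb (mem_range_self _)).trans (le_add_of_nonneg_right
      (mul_nonneg (div_nonneg (i₁ x).1.2.2.1 ((hWmem _).1 (i₁ x).2).le) (hq0 _)))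
  · refine agreeOn_of_sub_extD (pullbackForm_mem_smoothForms i₁.smooth hβ) (hform i₁ i₁.smooth)
      (fun x hx => hβ₁ x hx) fun x hx => ?_
    ext X
    change h.moment x.1 X + contractFundamental 𝔤 G (halfSpaceModel m) β (i₁ x) X = _
    rw [hβX]
    have h1 : Θ (i₁ x).1.1 = 0 := hΘZ _ hx
    rw [h1]
    exact (congrArg _ (mul_zero _)).trans (add_zero _)
  · exact
    { W := W.opens
      orientation := (cylinderOrientation o).restrict W.opens
      ham := ham
      proper := by
        refine isProperMap_of_isProperMap_apply ham.moment_smooth.continuous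
          (v := fun w => v w.1.1) (hv.subset ?_) hproper
        exact range_subset_iff.2 fun w => mem_range_self _
      cls := EquivariantCohomology.pullback pr A
      i₀ := i₀
      i₁ := i₁
      isEmbedding := isEmbedding_cylinderBoundary W U hW _ fun x => (hWU x).1
      range_eq := range_cylinderBoundary W U hW _ fun x => (hWU x).1
      immersion₀ := fun x => by
        rw [tangentMapAt_cylinderBottom]
        exact LinearMap.inl_injective
      immersion₁ := fun x => by
        rw [tangentMapAt_cylinderTop]
        exact LinearMap.inl_injective
      orientation₀ := preservesBoundaryOrientation_cylinderBottom W hW o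
      orientation₁ := preservesBoundaryOrientation_cylinderTop W U _ o
      ham₀ := by
        refine HamiltonianStructure.ext_of_eq ?_ ?_
        · refine (hform i₀ i₀.smooth).trans ?_
          rw [hβ₀, extD_zero, sub_zero]
          exact pullbackForm_id h.form
        · funext x
          ext X
          change h.moment x X + contractFundamental 𝔤 G (halfSpaceModel m) β (i₀ x) X = _
          have h1 : ρ (i₀ x) = 0 := zero_div _
          rw [hβX, h1, zero_mul, add_zero]
      -- The completion was defined as the restriction of the structure on `W` to the top.
      ham₁ := rfl
      cls₀ := EquivariantCohomology.pullback_pullback_of_leftInverse i₀ pr (fun _ => rfl) A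
      cls₁ := EquivariantCohomology.pullback_pullback i₁ pr (U.incl (𝓡 m)) (fun _ => rfl) A }

end

theorem mainTheorem4
    {𝔤 : Type*} [NormedAddCommGroup 𝔤] [NormedSpace ℝ 𝔤] [FiniteDimensional ℝ 𝔤]
    {G : Type*} [TopologicalSpace G] [T2Space G] [CompactSpace G] [ChartedSpace 𝔤 G] [Group G]
    [LieGroup 𝓘(ℝ, 𝔤) ∞ G]
    {n : ℕ}
    {M : Type*} [TopologicalSpace M] [T2Space M] [SecondCountableTopology M]
    [ChartedSpace (EuclideanSpace ℝ (Fin (2 * n))) M] [IsManifold (𝓡 (2 * n)) ∞ M]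
    [MulAction G M] [ContMDiffSMul 𝓘(ℝ, 𝔤) (𝓡 (2 * n)) ∞ G M]
    (o : ManifoldOrientation (𝓡 (2 * n)) M (2 * n))
    (h : HamiltonianStructure 𝔤 G (𝓡 (2 * n)) M)
    (v : TamingMap 𝔤 G (𝓡 (2 * n)) M)
    (hv : Bornology.IsBounded (Set.range v))
    (hΦ : IsPolarized v h.moment)
    (U : InvariantOpens G M) (hU : v.localizingSet ⊆ U.opens)
    (A : EquivariantCohomology 𝔤 G (𝓡 (2 * n)) M) :
    ∃ hZ : HamiltonianStructure 𝔤 G (𝓡 (2 * n)) U.opens,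
      IsPolarizedCompletion (v.pullback (U.incl (𝓡 (2 * n)))) (h.pullback (U.incl (𝓡 (2 * n)))) hZ
        (Subtype.val ⁻¹' v.localizingSet) ∧
      Nonempty (ProperHamiltonianCobordism o h A (o.restrict U.opens) hZ
        (EquivariantCohomology.pullback (U.incl (𝓡 (2 * n))) A)) := by
  exact exists_polarizedCompletion_cobordism o h v hv hΦ U hU A
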